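/- \textbf{Terms and monoids.} Terms are built by a binary operation $(t,u)\mapsto (tu)$ from a constant $\mathbf 1$ and generators $\lfloor k\rfloor$ (cup terms), $\lceil k\rceil$ (cap terms), $\sigma_k$ (crossing terms), $k\in\mathbf N^+$. The monoid $\mathcal{SK}_\omega$ is the set of terms modulo the congruence generated by $\mathbf 1t=t\mathbf 1=t$, $t(uv)=(tu)v$ and the following equations, for all $i,j,k\in\mathbf N^+$ with $j\le k$: $\lfloor k\rfloor\lfloor j\rfloor=\lfloor j\rfloor\lfloor k+2\rfloor$, $\lceil j\rceil\lceil k\rceil=\lceil k+2\rceil\lceil j\rceil$, $\lfloor k+2\rfloor\lceil j\rceil=\lceil j\rceil\lfloor k\rfloor$, $\lfloor j\rfloor\lceil k+2\rceil=\lceil k\rceil\lfloor j\rfloor$, $\lfloor i\rfloor\lceil i+1\rceil=\mathbf 1$; $\sigma_{k+2}\sigma_j=\sigma_j\sigma_{k+2}$, $\sigma_i\sigma_i=\mathbf 1$, $\sigma_{i+1}\sigma_i\sigma_{i+1}=\sigma_i\sigma_{i+1}\sigma_i$; $\lfloor k+2\rfloor\sigma_j=\sigma_j\lfloor k+2\rfloor$,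 $\lfloor j\rfloor\sigma_{k+2}=\sigma_k\lfloor j\rfloor$, $\lfloor i\rfloor\sigma_i=\lfloor i\rfloor$, $\lfloor i+1\rfloor\sigma_i=\lfloor i\rfloor\sigma_{i+1}$; $\sigma_j\lceil k+2\rceil=\lceil k+2\rceil\sigma_j$, $\sigma_{k+2}\lceil j\rceil=\lceil j\rceil\sigma_k$, $\sigma_i\lceil i\rceil=\lceil i\rceil$, $\sigma_i\lceil i+1\rceil=\sigma_{i+1}\lceil i\rceil$. The monoid $\mathcal{SJ}_\omega$ is obtained by adding the equations $\lfloor k\rfloor\lceil k\rceil=\mathbf 1$. \textbf{Diagrams.} An $\mathcal{SJ}$ diagram is a partition $D$ of $\mathbf Z\setminus\{0\}$ into two-element sets (threads) such that for some $n,m\in\mathbf N^+$ all the sets $\{n+k,-(m+k)\}$, $k\in\mathbf N$, are threads. Positive integers are points of the top line, negative ones of the bottom line. The composite $D_2\circ D_1$ is obtained by identifying each bottom point $-n$ of $D_1$ with the top point $n$ of $D_2$; its threads join the points of the top line of $D_1$ and of the bottom line of $D_2$ that are connected in the resulting picture. Connected components of the picture that contain no such point are called circular. The unit is $I=\{\{n,-n\}: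 n\in\mathbf N^+\}$. An $\mathcal{SK}$ diagram is a pair $(D,n)$ of an $\mathcal{SJ}$ diagram and $n\in\mathbf N$, with unit $(I,0)$ and composition $(D_2,n_2)\circ(D_1,n_1)=(D_2\circ D_1,\,n_1+n_2+r)$, where $r$ is the (finite) number of circular components. For $k\in\mathbf N^+$ let $V_k$ have the threads $\{k,k+1\}$, $\{n,-n\}$ for $n<k$, and $\{n+2,-n\}$ for $n\ge k$; $\Lambda_k$ the threads $\{-k,-(k+1)\}$, $\{n,-n\}$ for $n<k$, and $\{n,-(n+2)\}$ for $n\ge k$; $X_k$ the threads $\{k,-(k+1)\}$, $\{k+1,-k\}$, and $\{n,-n\}$ for $n\ne k,k+1$. Define $\iota$ from terms to $\mathcal{SJ}$ diagrams by $\iota(\lfloor k\rfloor)=V_k$, $\iota(\lceil k\rceil)=\Lambda_k$, $\iota(\sigma_k)=X_k$, $\iota(\mathbf 1)=I$, $\iota(tu)=\iota(t)\circ\iota(u)$, and $\kappa$ from terms to $\mathcal{SK}$ diagrams by $\kappa(t)=(\iota(t),0)$ for $t$ a generator or $\mathbf 1$ and $\kappa(tu)=\kappa(t)\circ\kappa(u)$.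 \textbf{Normal forms.} For $j\le i$ let $\lfloor j,i\rfloor=\lfloor j\rfloor\sigma_{j+1}\cdots\sigma_i$, $\lceil i,j\rceil=\sigma_i\cdots\sigma_{j+1}\lceil j\rceil$ and $[i,j]=\sigma_i\sigma_{i-1}\cdots\sigma_j$. Fix any $k\in\mathbf N^+$ and write $c$ for $\lfloor k\rfloor\lceil k\rceil$. A term is in normal form if, up to parentheses, it is $$c^l\lceil i_p,j_p\rceil\cdots\lceil i_1,j_1\rceil\,\mathbf 1\,[k_1,l_1]\cdots[k_q,l_q]\lfloor m_1,n_1\rfloor\cdots\lfloor m_r,n_r\rfloor$$ with $l,p,q,r\ge0$, $j_1<\dots<j_p$, $k_1<\dots<k_q$, $m_1<\dots<m_r$; here $j_s\le i_s$, $l_s\le k_s$, $m_s\le n_s$. It is in $\mathcal J$-normal form if moreover $l=0$. \textbf{Theorem.} Composition of $\mathcal{SJ}$ diagrams and of $\mathcal{SK}$ diagrams is associative, with units $I$ and $(I,0)$, and for all terms $t,u$: \begin{enumerate} \item (Soundness) If $t=u$ in $\mathcal{SK}_\omega$, then $\kappa(t)=\kappa(u)$; if $t=u$ in $\mathcal{SJ}_\omega$,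 then $\iota(t)=\iota(u)$. \item (Generating) Every $\mathcal{SJ}$ diagram is obtained by composition from $I$ and the diagrams $V_k,\Lambda_k,X_k$; every $\mathcal{SK}$ diagram is obtained by composition from $(I,0)$ and the diagrams $(V_k,0),(\Lambda_k,0),(X_k,0)$. \item (Auxiliary) If $t,u$ are in normal form and $\kappa(t)=\kappa(u)$, then $t$ and $u$ are the same term (up to parentheses); if $t,u$ are in $\mathcal J$-normal form and $\iota(t)=\iota(u)$, then $t$ and $u$ are the same term (up to parentheses). \item (Completeness) If $\kappa(t)=\kappa(u)$, then $t=u$ in $\mathcal{SK}_\omega$; if $\iota(t)=\iota(u)$, then $t=u$ in $\mathcal{SJ}_\omega$. \item Hence $\kappa$ induces a monoid isomorphism from $\mathcal{SK}_\omega$ onto the monoid of $\mathcal{SK}$ diagrams, and $\iota$ induces a monoid isomorphism from $\mathcal{SJ}_\omega$ onto the monoid of $\mathcal{SJ}$ diagrams. \end{enumerate} -/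

import Mathlib

/-! ### Coupling diagrams -/

/-- The set `ℤ - {0}`. A positive integer `n` is the `n`-th point of the top line of a diagram,
a negative integer `-n` the `n`-th point of its bottom line. -/
abbrev NZInt : Type := {z : ℤ // z ≠ 0}

/-- The point on the opposite line in the same position. -/
def NZInt.opp (a : NZInt) : NZInt := ⟨-a.1, neg_ne_zero.mpr a.2⟩

/-- A coupling diagram: a partition of `ℤ - {0}` into two-element subsets (threads), given by the
fixed-point-free involution that sends each point to the other end of its thread. -/
@[ext]
structure CouplingDiagram where
  mate : NZInt → NZInt
  mate_mate : ∀ a, mate (mate a) = a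
  mate_ne : ∀ a, mate a ≠ a

/-- `(n, m)` is a type of `D`: for every `k : ℕ`, `{n + k, -(m + k)}` is a thread of `D`. -/
def CouplingDiagram.IsOfType (D : CouplingDiagram) (n m : ℕ+) : Prop :=
  ∀ (k : ℕ) (a : NZInt), (a : ℤ) = n + k → (D.mate a : ℤ) = -(m + k)

/-- An `SJ` diagram: a coupling diagram that has a type. -/
@[ext]
structure SJDiagram extends CouplingDiagram where
  exists_type : ∃ n m : ℕ+, toCouplingDiagram.IsOfType n m

/-- An `SK` diagram: an `SJ` diagram together with a number of circular components. -/
@[ext]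
structure SKDiagram where
  diagram : SJDiagram
  circles : ℕ

/-! ### Composition of diagrams -/

namespace Gluing

/-- The points of the picture in which `D₁` is drawn above `D₂`: `Sum.inl a` is the point `a`
of `D₁`, and `Sum.inr a` is the point `a` of `D₂`. -/
abbrev Point : Type := NZInt ⊕ NZInt

/-- Two points of the picture are linked when they are the ends of a thread of `D₁`, or the ends
of a thread of `D₂`, or when they are a point `-n` of the bottom line of `D₁` and the point `n` of
the top line of `D₂`, which are identified. -/
inductive Link (D₂ D₁ : CouplingDiagram) : Point → Point → Prop
  | upper (a : NZInt) : Link D₂ D₁ (Sum.inl a) (Sum.inl (D₁.mate a))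
  | lower (a : NZInt) : Link D₂ D₁ (Sum.inr a) (Sum.inr (D₂.mate a))
  | ident (a b : NZInt) (hb : 0 < (b : ℤ)) (hab : (a : ℤ) = -b) :
      Link D₂ D₁ (Sum.inl a) (Sum.inr b)

/-- Two points of the picture are connected when they are in the same connected component. -/
def connected (D₂ D₁ : CouplingDiagram) : Setoid Point :=
  Relation.EqvGen.setoid (Link D₂ D₁)

/-- The points of the composite, as points of the picture: its top line is the top line of `D₁`,
and its bottom line is the bottom line of `D₂`. -/
def outer (a : NZInt) : Point := if 0 < (a : ℤ) then Sum.inl a else Sum.inr a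

/-- The circular components of the picture: the connected components that do not reach the top
line of `D₁` nor the bottom line of `D₂`. -/
def circularComponents (D₂ D₁ : CouplingDiagram) : Set (Quotient (connected D₂ D₁)) :=
  {c | ∀ a : NZInt, c ≠ Quotient.mk (connected D₂ D₁) (outer a)}

/-- The threads of the two diagrams, as an involution of the points of the picture. -/
def thread (D₂ D₁ : CouplingDiagram) : Equiv.Perm Point :=
  Function.Involutive.toPerm (Sum.map D₁.mate D₂.mate) (by
    rintro (a | a) <;> simp [CouplingDiagram.mate_mate])

/-- The identification of the middle lines, as an involution fixing the outer points. -/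
def glue : Equiv.Perm Point :=
  Function.Involutive.toPerm
    (Sum.elim (fun a => if (a : ℤ) < 0 then Sum.inr a.opp else Sum.inl a)
      (fun b => if 0 < (b : ℤ) then Sum.inl b.opp else Sum.inr b)) (by
    rintro (a | a)
    · by_cases h : (a : ℤ) < 0 <;> simp [h, NZInt.opp]
    · by_cases h : 0 < (a : ℤ) <;> simp [h, NZInt.opp])

theorem glue_inl (a : NZInt) :
    glue (Sum.inl a) = if (a : ℤ) < 0 then Sum.inr a.opp else Sum.inl a := rfl

theorem glue_inr (b : NZInt) :
    glue (Sum.inr b) = if 0 < (b : ℤ) then Sum.inl b.opp else Sum.inr b := rfl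

theorem thread_thread (D₂ D₁ : CouplingDiagram) (p : Point) :
    thread D₂ D₁ (thread D₂ D₁ p) = p :=
  Function.Involutive.toPerm_involutive _ p

theorem glue_glue (p : Point) : glue (glue p) = p :=
  Function.Involutive.toPerm_involutive _ p

theorem thread_ne (D₂ D₁ : CouplingDiagram) (p : Point) : thread D₂ D₁ p ≠ p := by
  rcases p with a | a
  · exact fun h => D₁.mate_ne a (Sum.inl_injective h)
  · exact fun h => D₂.mate_ne a (Sum.inr_injective h)

theorem glue_outer (a : NZInt) : glue (outer a) = outer a := by
  by_cases h : 0 < (a : ℤ)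
  · simp [outer, glue_inl, h, h.le]
  · simp [outer, glue_inr, h]

theorem outer_injective : Function.Injective outer := by
  intro a b h
  unfold outer at h
  split_ifs at h <;> simp_all

theorem exists_outer_of_glue {p : Point} (h : glue p = p) : ∃ a, p = outer a := by
  rcases p with a | a
  · refine ⟨a, ?_⟩
    by_cases ha : (a : ℤ) < 0
    · simp [glue_inl, ha] at h
    · have := a.2
      have h' : 0 < (a : ℤ) := by omega
      simp [outer, h']
  · refine ⟨a, ?_⟩
    by_cases ha : 0 < (a : ℤ)
    · simp [glue_inr, ha] at h
    · simp [outer, ha]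

theorem connected_thread (D₂ D₁ : CouplingDiagram) (p : Point) :
    connected D₂ D₁ p (thread D₂ D₁ p) := by
  rcases p with a | a
  · exact Relation.EqvGen.rel _ _ (Link.upper a)
  · exact Relation.EqvGen.rel _ _ (Link.lower a)

theorem connected_glue (D₂ D₁ : CouplingDiagram) (p : Point) :
    connected D₂ D₁ p (glue p) := by
  rcases p with a | a
  · by_cases ha : (a : ℤ) < 0
    · have : glue (Sum.inl a) = Sum.inr a.opp := by simp [glue_inl, ha]
      rw [this]
      exact Relation.EqvGen.rel _ _ (Link.ident a a.opp (by simp [NZInt.opp, ha])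
        (by simp [NZInt.opp]))
    · have : glue (Sum.inl a) = Sum.inl a := by simp [glue_inl, ha]
      rw [this]
  · by_cases ha : 0 < (a : ℤ)
    · have : glue (Sum.inr a) = Sum.inl a.opp := by simp [glue_inr, ha]
      rw [this]
      exact (connected D₂ D₁).symm (Relation.EqvGen.rel _ _ (Link.ident a.opp a ha rfl))
    · have : glue (Sum.inr a) = Sum.inr a := by simp [glue_inr, ha]
      rw [this]

/-- A set of points that is closed under both involutions is a union of components. -/
theorem mem_iff_of_connected {D₂ D₁ : CouplingDiagram} {S : Set Point}
    (ht : ∀ p ∈ S, thread D₂ D₁ p ∈ S) (hg : ∀ p ∈ S, glue p ∈ S) {p q : Point}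
    (h : connected D₂ D₁ p q) : p ∈ S ↔ q ∈ S := by
  induction h with
  | rel p q h =>
    have key : q = thread D₂ D₁ p ∨ q = glue p := by
      cases h with
      | upper a => exact Or.inl rfl
      | lower a => exact Or.inl rfl
      | ident a b hb hab =>
        right
        have ha : (a : ℤ) < 0 := by omega
        have : b = a.opp := Subtype.ext (by simp [NZInt.opp, hab])
        simp [glue_inl, ha, this]
    rcases key with rfl | rfl
    · exact ⟨ht p, fun h => by simpa [thread_thread] using ht _ h⟩
    · exact ⟨hg p, fun h => by simpa [glue_glue] using hg _ h⟩
  | refl p => exact Iff.rfl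
  | symm p q _ ih => exact ih.symm
  | trans p q r _ _ ih₁ ih₂ => exact ih₁.trans ih₂

/-- An outer point whose component is finite is connected to exactly one other outer point. -/
theorem existsUnique_of_finite {D₂ D₁ : CouplingDiagram} (S : Set Point) (hS : S.Finite)
    (ht : ∀ p ∈ S, thread D₂ D₁ p ∈ S) (hg : ∀ p ∈ S, glue p ∈ S) (a : NZInt)
    (ha : outer a ∈ S) :
    ∃! b, b ≠ a ∧ connected D₂ D₁ (outer a) (outer b) := by
  set x := outer a with hx
  set A := thread D₂ D₁ with hA
  set B := glue with hB
  have hAA : A * A = 1 := Equiv.ext fun p => thread_thread D₂ D₁ p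
  have hBB : B * B = 1 := Equiv.ext fun p => glue_glue p
  have hAi : A⁻¹ = A := inv_eq_of_mul_eq_one_left hAA
  have hBi : B⁻¹ = B := inv_eq_of_mul_eq_one_left hBB
  have hBx : B x = x := glue_outer a
  set P : Equiv.Perm Point := B * A with hP
  have hPi : P⁻¹ = A * B := by rw [hP, mul_inv_rev, hAi, hBi]
  have hconj : B * P * B⁻¹ = P⁻¹ := by
    rw [hPi, hBi, hP, ← mul_assoc, hBB, one_mul]
  have hBP : ∀ i : ℤ, B ((P ^ i) x) = (P ^ (-i)) x := by
    intro i
    have h1 : B * P ^ i * B⁻¹ = P ^ (-i) := by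
      rw [← conj_zpow, hconj, inv_zpow, zpow_neg]
    have h2 : B * P ^ i = P ^ (-i) * B := by rw [← h1]; group
    calc B ((P ^ i) x) = (B * P ^ i) x := rfl
      _ = (P ^ (-i)) (B x) := by rw [h2]; rfl
      _ = _ := by rw [hBx]
  have hAP : ∀ i : ℤ, A ((P ^ i) x) = (P ^ (-(i + 1))) x := by
    intro i
    rw [← hBP (i + 1)]
    have : A * P ^ i = B * P ^ (i + 1) := by
      rw [add_comm, zpow_add, zpow_one, hP, ← mul_assoc, ← mul_assoc, hBB, one_mul]
    exact congrArg (fun f : Equiv.Perm Point => f x) this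
  have hmemS : ∀ i : ℕ, (P ^ i) x ∈ S := by
    intro i
    induction i with
    | zero => simpa using ha
    | succ i ih =>
      rw [pow_succ']
      exact hg _ (ht _ ih)
  have hconn : ∀ i : ℕ, connected D₂ D₁ x ((P ^ i) x) := by
    intro i
    induction i with
    | zero => exact (connected D₂ D₁).refl _
    | succ i ih =>
      rw [pow_succ']
      exact (connected D₂ D₁).trans ih ((connected D₂ D₁).trans
        (connected_thread D₂ D₁ _) (connected_glue D₂ D₁ _))
  obtain ⟨r, hr0, hr⟩ : ∃ r : ℕ, 0 < r ∧ ∀ i : ℤ, (P ^ i) x = x ↔ (r : ℤ) ∣ i := by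
    refine ⟨MulAction.period P x, ?_, fun i =>
      MulAction.zpow_smul_eq_iff_period_dvd (g := P) (a := x)⟩
    obtain ⟨i, -, j, -, hij, h⟩ := Set.infinite_univ.exists_lt_map_eq_of_mapsTo
      (f := fun i : ℕ => (P ^ i) x) (fun i _ => hmemS i) hS
    refine MulAction.period_pos_of_fixed (n := j - i) (by omega) ?_
    have h1 : (P ^ i) ((P ^ (j - i)) x) = (P ^ i) x := by
      rw [← Equiv.Perm.mul_apply, ← pow_add, Nat.add_sub_cancel' hij.le]
      exact h.symm
    exact (P ^ i).injective h1
  have hr' : ∀ i j : ℤ, (P ^ i) x = (P ^ j) x ↔ (r : ℤ) ∣ i - j := by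
    intro i j
    rw [← hr, sub_eq_neg_add, zpow_add, Equiv.Perm.mul_apply, zpow_neg, Equiv.Perm.inv_eq_iff_eq]
  have heven : Even r := by
    by_contra hodd
    obtain ⟨s, rfl⟩ := Nat.not_even_iff_odd.mp hodd
    refine thread_ne D₂ D₁ ((P ^ (s : ℤ)) x) ?_
    rw [← hA, hAP, hr']
    exact ⟨-1, by push_cast; ring⟩
  obtain ⟨s, rfl⟩ := heven
  have hBs : B ((P ^ s) x) = (P ^ s) x := by
    have := hBP s
    rw [zpow_natCast] at this
    rw [this, ← zpow_natCast, hr']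
    exact ⟨-1, by push_cast; ring⟩
  obtain ⟨b, hb⟩ := exists_outer_of_glue hBs
  refine ⟨b, ⟨?_, hb ▸ hconn s⟩, ?_⟩
  · rintro rfl
    have h1 := (hr s).1 (by rw [zpow_natCast]; exact hb)
    have := Int.le_of_dvd (by omega) h1
    omega
  · rintro c ⟨hca, hc⟩
    have hmem := (mem_iff_of_connected (S := {p | ∃ i : ℤ, p = (P ^ i) x}) (D₂ := D₂) (D₁ := D₁)
      (by rintro p ⟨i, rfl⟩; exact ⟨_, hAP i⟩) (by rintro p ⟨i, rfl⟩; exact ⟨_, hBP i⟩) hc).1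
      ⟨0, by simp⟩
    obtain ⟨i, hi⟩ := hmem
    have h1 : (P ^ (-i)) x = (P ^ i) x := by rw [← hBP i, ← hi]; exact glue_outer c
    rw [hr'] at h1
    obtain ⟨k, hk⟩ := h1
    have hik : i = s * (-k) := by push_cast at hk; linarith
    rcases Int.even_or_odd (-k) with ⟨l, hl⟩ | ⟨l, hl⟩
    · exfalso
      apply hca
      apply outer_injective
      rw [hi, ← hx, hr]
      exact ⟨l, by rw [hik, hl]; push_cast; ring⟩
    · apply outer_injective
      rw [hi, ← hb, ← zpow_natCast, hr']
      exact ⟨l, by rw [hik, hl]; push_cast; ring⟩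

/-- A type can be raised. -/
theorem isOfType_add {D : CouplingDiagram} {n m : ℕ+} (h : D.IsOfType n m) {n' m' : ℕ+} (k : ℕ)
    (hn : (n' : ℤ) = n + k) (hm : (m' : ℤ) = m + k) : D.IsOfType n' m' := by
  intro i a ha
  rw [h (k + i) a (by rw [ha, hn]; push_cast; ring), hm]
  push_cast
  ring

/-- Two `SJ` diagrams have types that match in the middle and are as large as one wants. -/
theorem exists_types (D₂ D₁ : SJDiagram) (K : ℕ) : ∃ n m l : ℕ+, K ≤ (n : ℕ) ∧ K ≤ (l : ℕ) ∧
    D₁.IsOfType n m ∧ D₂.IsOfType m l := by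
  obtain ⟨n, m, h₁⟩ := D₁.exists_type
  obtain ⟨m', l, h₂⟩ := D₂.exists_type
  refine ⟨⟨n + (m' + K), by positivity⟩, ⟨m + (m' + K), by positivity⟩,
    ⟨l + (m + K), by positivity⟩, ?_, ?_, isOfType_add h₁ (m' + K) ?_ ?_,
    isOfType_add h₂ (m + K) ?_ ?_⟩
  all_goals simp only [PNat.mk_coe]; push_cast; omega

/-- The points below given types. -/
def box (n m l : ℕ+) : Set Point :=
  {p | match p with
    | Sum.inl a => (a : ℤ) < n ∧ -(m : ℤ) < a
    | Sum.inr a => (a : ℤ) < m ∧ -(l : ℤ) < a}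

theorem box_finite (n m l : ℕ+) : (box n m l).Finite := by
  have hf : ∀ u v : ℤ, {a : NZInt | (a : ℤ) < u ∧ v < a}.Finite := fun u v =>
    ((Set.finite_Ioo v u).preimage (f := fun a : NZInt => (a : ℤ))
      Subtype.val_injective.injOn).subset fun a h => ⟨h.2, h.1⟩
  refine (((hf n (-m)).image Sum.inl).union ((hf m (-l)).image Sum.inr)).subset ?_
  rintro (a | a) h
  · exact Or.inl ⟨a, h, rfl⟩
  · exact Or.inr ⟨a, h, rfl⟩

/-- The mate of a point below a type is below that type. -/
theorem mate_lt {D : CouplingDiagram} {n m : ℕ+} (h : D.IsOfType n m) {a : NZInt}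
    (ha : (a : ℤ) < n ∧ -(m : ℤ) < a) :
    (D.mate a : ℤ) < n ∧ -(m : ℤ) < D.mate a := by
  constructor
  · by_contra hc
    have := h (D.mate a - n : ℤ).toNat (D.mate a) (by omega)
    rw [D.mate_mate] at this
    omega
  · by_contra hc
    set k := (-(m : ℤ) - D.mate a).toNat with hk
    have hb : (n : ℤ) + k ≠ 0 := by have := n.pos; omega
    have h1 := h k ⟨n + k, hb⟩ rfl
    have h2 : D.mate ⟨n + k, hb⟩ = D.mate a := Subtype.ext (by rw [h1]; omega)
    have h3 := congrArg D.mate h2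
    rw [D.mate_mate, D.mate_mate] at h3
    rw [← h3] at ha
    simp only at ha
    omega

theorem thread_mem_box {D₂ D₁ : CouplingDiagram} {n m l : ℕ+} (h₁ : D₁.IsOfType n m)
    (h₂ : D₂.IsOfType m l) (p : Point) (hp : p ∈ box n m l) : thread D₂ D₁ p ∈ box n m l := by
  rcases p with a | a
  · exact mate_lt h₁ hp
  · exact mate_lt h₂ hp

theorem glue_mem_box {n m l : ℕ+} (p : Point) (hp : p ∈ box n m l) : glue p ∈ box n m l := by
  have := n.pos
  have := l.pos
  rcases p with a | a
  · by_cases ha : (a : ℤ) < 0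
    · have : glue (Sum.inl a) = Sum.inr a.opp := by simp [glue_inl, ha]
      rw [this]
      simp only [box, Set.mem_ofPred_eq, NZInt.opp] at hp ⊢
      omega
    · have : glue (Sum.inl a) = Sum.inl a := by simp [glue_inl, ha]
      rwa [this]
  · by_cases ha : 0 < (a : ℤ)
    · have : glue (Sum.inr a) = Sum.inl a.opp := by simp [glue_inr, ha]
      rw [this]
      simp only [box, Set.mem_ofPred_eq, NZInt.opp] at hp ⊢
      omega
    · have : glue (Sum.inr a) = Sum.inr a := by simp [glue_inr, ha]
      rwa [this]

/-- Every outer point is connected to exactly one other outer point. -/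
theorem existsUnique_mate (D₂ D₁ : SJDiagram) (a : NZInt) :
    ∃! b, b ≠ a ∧ connected D₂.toCouplingDiagram D₁.toCouplingDiagram (outer a) (outer b) := by
  obtain ⟨n, m, l, hn, hl, h₁, h₂⟩ := exists_types D₂ D₁ ((a : ℤ).natAbs + 1)
  refine existsUnique_of_finite (box n m l) (box_finite n m l) (thread_mem_box h₁ h₂)
    glue_mem_box a ?_
  have := m.pos
  by_cases h : 0 < (a : ℤ)
  · simp only [outer, h, if_true, box, Set.mem_ofPred_eq]
    omega
  · simp only [outer, h, if_false, box, Set.mem_ofPred_eq]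
    omega

/-- There are finitely many circular components, so that their `Set.ncard` is their number. -/
theorem circularComponents_finite (D₂ D₁ : SJDiagram) :
    (circularComponents D₂.toCouplingDiagram D₁.toCouplingDiagram).Finite := by
  obtain ⟨n, m, l, -, -, h₁, h₂⟩ := exists_types D₂ D₁ 0
  refine ((box_finite n m l).image (Quotient.mk _)).subset ?_
  intro c hc
  induction c using Quotient.inductionOn with
  | h p =>
  refine ⟨p, ?_, rfl⟩
  have no : ∀ a, ¬ connected D₂.toCouplingDiagram D₁.toCouplingDiagram p (outer a) :=
    fun a h => hc a (Quotient.sound h)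
  have hmid : ∀ a b : NZInt, (a : ℤ) = -b → 0 < (b : ℤ) →
      connected D₂.toCouplingDiagram D₁.toCouplingDiagram p (Sum.inr b) → (b : ℤ) < m := by
    intro a b hab hb hp
    by_contra hcon
    have h3 := h₂ (b - m : ℤ).toNat b (by omega)
    apply no (D₂.mate b)
    have : outer (D₂.mate b) = Sum.inr (D₂.mate b) := by
      have := l.pos
      have h4 : ¬ 0 < (D₂.mate b : ℤ) := by omega
      simp [outer, h4]
    rw [this]
    exact Setoid.trans' _ hp (Relation.EqvGen.rel _ _ (Link.lower b))
  have hlpos := l.pos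
  have hnpos := n.pos
  have refl' := Setoid.refl' (connected D₂.toCouplingDiagram D₁.toCouplingDiagram)
  rcases p with a | a
  · have ha : (a : ℤ) < 0 := by
      by_contra h
      have h0 := a.2
      have h' : 0 < (a : ℤ) := by omega
      apply no a
      simp [outer, h']
    have := hmid a a.opp (by simp [NZInt.opp]) (by simp [NZInt.opp, ha])
      (Relation.EqvGen.rel _ _
        (Link.ident a a.opp (by simp [NZInt.opp, ha]) (by simp [NZInt.opp])))
    simp only [NZInt.opp] at this
    simp only [box, Set.mem_ofPred_eq]
    omega
  · have ha : 0 < (a : ℤ) := by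
      by_contra h
      apply no a
      simp [outer, h]
    have := hmid a.opp a rfl ha (refl' _)
    simp only [box, Set.mem_ofPred_eq]
    omega

end Gluing

namespace SJDiagram

open Gluing

/-- The other end of the thread of the composite that starts in `a`. -/
noncomputable def compMate (D₂ D₁ : SJDiagram) (a : NZInt) : NZInt :=
  (existsUnique_mate D₂ D₁ a).choose

theorem compMate_ne (D₂ D₁ : SJDiagram) (a : NZInt) : compMate D₂ D₁ a ≠ a :=
  (existsUnique_mate D₂ D₁ a).choose_spec.1.1

theorem connected_compMate (D₂ D₁ : SJDiagram) (a : NZInt) :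
    connected D₂.toCouplingDiagram D₁.toCouplingDiagram (outer a) (outer (compMate D₂ D₁ a)) :=
  (existsUnique_mate D₂ D₁ a).choose_spec.1.2

theorem eq_compMate {D₂ D₁ : SJDiagram} {a b : NZInt} (hne : b ≠ a)
    (h : connected D₂.toCouplingDiagram D₁.toCouplingDiagram (outer a) (outer b)) :
    b = compMate D₂ D₁ a :=
  (existsUnique_mate D₂ D₁ a).choose_spec.2 b ⟨hne, h⟩

/-- The composite `D₂ ∘ D₁`: its threads are the pairs of distinct points of the top line of `D₁`
and the bottom line of `D₂` that are connected when `D₁` is drawn above `D₂`. -/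
noncomputable def comp (D₂ D₁ : SJDiagram) : SJDiagram where
  mate := compMate D₂ D₁
  mate_mate a := (eq_compMate (compMate_ne D₂ D₁ a).symm
    (Setoid.symm' _ (connected_compMate D₂ D₁ a))).symm
  mate_ne := compMate_ne D₂ D₁
  exists_type := by
    obtain ⟨n, m, l, -, -, h₁, h₂⟩ := exists_types D₂ D₁ 0
    refine ⟨n, l, fun k a ha => ?_⟩
    have hn := n.pos
    have hm := m.pos
    have hl := l.pos
    have h3 := h₁ k a ha
    have hb : (m : ℤ) + k ≠ 0 := by omega
    have h4 := h₂ k ⟨m + k, hb⟩ rfl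
    change (compMate D₂ D₁ a : ℤ) = _
    rw [← h4]
    congr 1
    symm
    apply eq_compMate
    · intro h
      rw [h] at h4
      omega
    · have e1 : outer a = Sum.inl a := by
        have : 0 < (a : ℤ) := by omega
        simp [outer, this]
      have e2 : outer (D₂.mate ⟨m + k, hb⟩) = Sum.inr (D₂.mate ⟨m + k, hb⟩) := by
        have : ¬ 0 < (D₂.mate ⟨m + k, hb⟩ : ℤ) := by omega
        simp [outer, this]
      rw [e1, e2]
      exact Setoid.trans' _ (Relation.EqvGen.rel _ _ (Link.upper a))
        (Setoid.trans' _ (Relation.EqvGen.rel _ _ (Link.ident _ ⟨m + k, hb⟩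
          (by simp only; omega) h3)) (Relation.EqvGen.rel _ _ (Link.lower _)))

/-- The number of circular components that arise in the composition `D₂ ∘ D₁`. -/
noncomputable def loops (D₂ D₁ : SJDiagram) : ℕ :=
  (circularComponents D₂.toCouplingDiagram D₁.toCouplingDiagram).ncard

/-- The unit `SJ` diagram `I`, with the threads `{n, -n}`. -/
def unit : SJDiagram where
  mate := NZInt.opp
  mate_mate a := by simp [NZInt.opp]
  mate_ne a h := by
    have h1 := congrArg Subtype.val h
    have := a.2
    simp only [NZInt.opp] at h1
    omega
  exists_type := ⟨1, 1, fun k a ha => by simp [NZInt.opp, ha]⟩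

/-- The cup `SJ` diagram `V_k`: the cup `{k, k + 1}`, the threads `{n, -n}` for `n < k`, and the
threads `{n + 2, -n}` for `k ≤ n`. -/
def cup (k : ℕ+) : SJDiagram where
  mate a := ⟨if (a : ℤ) = k then k + 1 else if (a : ℤ) = k + 1 then k
      else if (k : ℤ) + 1 < a then 2 - a else if (a : ℤ) ≤ -k then 2 - a else -a, by
    have := a.2
    have := k.pos
    split_ifs <;> omega⟩
  mate_mate a := by
    have := a.2
    have := k.pos
    apply Subtype.ext
    simp only
    split_ifs <;> omega
  mate_ne a h := by
    have h1 := congrArg Subtype.val h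
    have := a.2
    have := k.pos
    simp only at h1
    split_ifs at h1 <;> omega
  exists_type := by
    refine ⟨k + 2, k, fun i a ha => ?_⟩
    have := k.pos
    have h2 : ((k + 2 : ℕ+) : ℤ) = k + 2 := by push_cast; rfl
    simp only
    split_ifs <;> omega

/-- The cap `SJ` diagram `Λ_k`: the cap `{-k, -(k + 1)}`, the threads `{n, -n}` for `n < k`, and
the threads `{n, -(n + 2)}` for `k ≤ n`. -/
def cap (k : ℕ+) : SJDiagram where
  mate a := ⟨if (a : ℤ) = -k then -(k + 1) else if (a : ℤ) = -(k + 1) then -k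
      else if (a : ℤ) < -(k + 1) then -2 - a else if (k : ℤ) ≤ a then -2 - a else -a, by
    have := a.2
    have := k.pos
    split_ifs <;> omega⟩
  mate_mate a := by
    have := a.2
    have := k.pos
    apply Subtype.ext
    simp only
    split_ifs <;> omega
  mate_ne a h := by
    have h1 := congrArg Subtype.val h
    have := a.2
    have := k.pos
    simp only at h1
    split_ifs at h1 <;> omega
  exists_type := by
    refine ⟨k, k + 2, fun i a ha => ?_⟩
    have := k.pos
    have h2 : ((k + 2 : ℕ+) : ℤ) = k + 2 := by push_cast; rfl
    simp only
    split_ifs <;> omega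

/-- The crossing `SJ` diagram `X_k`: the threads `{k, -(k + 1)}` and `{k + 1, -k}`, and the threads
`{n, -n}` for the other `n`. -/
def crossing (k : ℕ+) : SJDiagram where
  mate a := ⟨if (a : ℤ) = k then -(k + 1) else if (a : ℤ) = k + 1 then -k
      else if (a : ℤ) = -k then k + 1 else if (a : ℤ) = -(k + 1) then k else -a, by
    have := a.2
    have := k.pos
    split_ifs <;> omega⟩
  mate_mate a := by
    have := a.2
    have := k.pos
    apply Subtype.ext
    simp only
    split_ifs <;> omega
  mate_ne a h := by
    have h1 := congrArg Subtype.val h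
    have := a.2
    have := k.pos
    simp only at h1
    split_ifs at h1 <;> omega
  exists_type := by
    refine ⟨k + 2, k + 2, fun i a ha => ?_⟩
    have := k.pos
    have h2 : ((k + 2 : ℕ+) : ℤ) = k + 2 := by push_cast; rfl
    simp only
    split_ifs <;> omega

noncomputable instance : Mul SJDiagram := ⟨comp⟩

instance : One SJDiagram := ⟨unit⟩

end SJDiagram

/-- Composition of `SK` diagrams,
`(D₂, n₂) ∘ (D₁, n₁) = (D₂ ∘ D₁, n₁ + n₂ + number of new circular components)`. -/
noncomputable instance : Mul SKDiagram :=
  ⟨fun E₂ E₁ => ⟨E₂.diagram * E₁.diagram,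
    E₁.circles + E₂.circles + SJDiagram.loops E₂.diagram E₁.diagram⟩⟩

/-- The unit `SK` diagram `(I, 0)`. -/
instance : One SKDiagram := ⟨⟨1, 0⟩⟩

/-! ### Terms and the two presented monoids -/

/-- The symbols from which terms are built: the unit term, the cup terms, the cap terms and the
crossing terms. -/
inductive SKSymbol : Type
  | one : SKSymbol
  | cup (k : ℕ+) : SKSymbol
  | cap (k : ℕ+) : SKSymbol
  | cross (k : ℕ+) : SKSymbol

/-- Terms. -/
inductive SKTerm : Type
  | sym (s : SKSymbol) : SKTerm
  | mul (t u : SKTerm) : SKTerm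

namespace SKTerm

/-- The unit term. -/
abbrev one : SKTerm := sym SKSymbol.one

/-- Cup terms. -/
abbrev cup (k : ℕ+) : SKTerm := sym (SKSymbol.cup k)

/-- Cap terms. -/
abbrev cap (k : ℕ+) : SKTerm := sym (SKSymbol.cap k)

/-- Crossing terms. -/
abbrev cross (k : ℕ+) : SKTerm := sym (SKSymbol.cross k)

instance : Mul SKTerm := ⟨mul⟩

/-- The sequence of symbols of a term, that is, the term written without parentheses. -/
def word : SKTerm → List SKSymbol
  | sym s => [s]
  | mul t u => t.word ++ u.word

end SKTerm

open SKTerm in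
/-- The defining equations of the monoid `SKω`, besides the monoid equations. -/
inductive SKAxiom : SKTerm → SKTerm → Prop
  | cup_cup (j k : ℕ+) (h : j ≤ k) : SKAxiom (cup k * cup j) (cup j * cup (k + 2))
  | cap_cap (j k : ℕ+) (h : j ≤ k) : SKAxiom (cap j * cap k) (cap (k + 2) * cap j)
  | cup_cap₁ (j k : ℕ+) (h : j ≤ k) : SKAxiom (cup (k + 2) * cap j) (cap j * cup k)
  | cap_cup₁ (j k : ℕ+) (h : j ≤ k) : SKAxiom (cup j * cap (k + 2)) (cap k * cup j)
  | cup_cap (i : ℕ+) : SKAxiom (cup i * cap (i + 1)) one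
  | cross (j k : ℕ+) (h : j ≤ k) : SKAxiom (cross (k + 2) * cross j) (cross j * cross (k + 2))
  | cross₂ (i : ℕ+) : SKAxiom (cross i * cross i) one
  | cross₃ (i : ℕ+) : SKAxiom (cross (i + 1) * cross i * cross (i + 1))
      (cross i * cross (i + 1) * cross i)
  | cross_cup₁ (j k : ℕ+) (h : j ≤ k) : SKAxiom (cup (k + 2) * cross j) (cross j * cup (k + 2))
  | cross_cup₂ (j k : ℕ+) (h : j ≤ k) : SKAxiom (cup j * cross (k + 2)) (cross k * cup j)
  | cross_cup₃ (i : ℕ+) : SKAxiom (cup i * cross i) (cup i)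
  | cross_cup₄ (i : ℕ+) : SKAxiom (cup (i + 1) * cross i) (cup i * cross (i + 1))
  | cross_cap₁ (j k : ℕ+) (h : j ≤ k) : SKAxiom (cross j * cap (k + 2)) (cap (k + 2) * cross j)
  | cross_cap₂ (j k : ℕ+) (h : j ≤ k) : SKAxiom (cross (k + 2) * cap j) (cap j * cross k)
  | cross_cap₃ (i : ℕ+) : SKAxiom (cross i * cap i) (cap i)
  | cross_cap₄ (i : ℕ+) : SKAxiom (cross i * cap (i + 1)) (cross (i + 1) * cap i)

open SKTerm in
/-- The defining equations of the monoid `SJω`, besides the monoid equations: those of `SKω`, and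
the equation that makes the circle equal to the unit. -/
inductive SJAxiom : SKTerm → SKTerm → Prop
  | ofSK (t u : SKTerm) (h : SKAxiom t u) : SJAxiom t u
  | circle (k : ℕ+) : SJAxiom (cup k * cap k) one

/-- Equality of terms in the monoid presented by the equations `R`. -/
inductive TermEq (R : SKTerm → SKTerm → Prop) : SKTerm → SKTerm → Prop
  | ax (t u : SKTerm) (h : R t u) : TermEq R t u
  | one_mul (t : SKTerm) : TermEq R (SKTerm.one * t) t
  | mul_one (t : SKTerm) : TermEq R (t * SKTerm.one) t
  | assoc (t u v : SKTerm) : TermEq R (t * (u * v)) ((t * u) * v)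
  | refl (t : SKTerm) : TermEq R t t
  | symm (t u : SKTerm) (h : TermEq R t u) : TermEq R u t
  | trans (t u v : SKTerm) (h₁ : TermEq R t u) (h₂ : TermEq R u v) : TermEq R t v
  | mul (t t' u u' : SKTerm) (h₁ : TermEq R t t') (h₂ : TermEq R u u') :
      TermEq R (t * u) (t' * u')

/-- Equality in the monoid presented by `R`, as an equivalence relation on terms. -/
def termSetoid (R : SKTerm → SKTerm → Prop) : Setoid SKTerm :=
  ⟨TermEq R, TermEq.refl, fun {_ _} => TermEq.symm _ _, fun {_ _ _} => TermEq.trans _ _ _⟩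

/-- The monoid presented by the equations `R`. -/
def TermMonoid (R : SKTerm → SKTerm → Prop) : Type := Quotient (termSetoid R)

/-- The element of the presented monoid given by a term. -/
def TermMonoid.mk (R : SKTerm → SKTerm → Prop) (t : SKTerm) : TermMonoid R :=
  Quotient.mk (termSetoid R) t

instance (R : SKTerm → SKTerm → Prop) : Monoid (TermMonoid R) where
  mul := Quotient.map₂ (· * ·) fun _ _ h₁ _ _ h₂ => TermEq.mul _ _ _ _ h₁ h₂
  one := TermMonoid.mk R SKTerm.one
  mul_assoc := by
    rintro ⟨t⟩ ⟨u⟩ ⟨v⟩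
    exact Quotient.sound (TermEq.symm _ _ (TermEq.assoc t u v))
  one_mul := by
    rintro ⟨t⟩
    exact Quotient.sound (TermEq.one_mul t)
  mul_one := by
    rintro ⟨t⟩
    exact Quotient.sound (TermEq.mul_one t)

/-- The monoid `SKω`. -/
abbrev SKOmega : Type := TermMonoid SKAxiom

/-- The monoid `SJω`. -/
abbrev SJOmega : Type := TermMonoid SJAxiom

/-! ### The interpretation of terms in diagrams -/

/-- The `SJ` diagram of a symbol. -/
def SKSymbol.diagram : SKSymbol → SJDiagram
  | SKSymbol.one => 1
  | SKSymbol.cup k => SJDiagram.cup k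
  | SKSymbol.cap k => SJDiagram.cap k
  | SKSymbol.cross k => SJDiagram.crossing k

/-- The map `ι` from terms to `SJ` diagrams. -/
noncomputable def SKTerm.iota : SKTerm → SJDiagram
  | SKTerm.sym s => s.diagram
  | SKTerm.mul t u => t.iota * u.iota

/-- The map `κ` from terms to `SK` diagrams. -/
noncomputable def SKTerm.kappa : SKTerm → SKDiagram
  | SKTerm.sym s => ⟨s.diagram, 0⟩
  | SKTerm.mul t u => t.kappa * u.kappa

/-! ### Normal forms -/

namespace SKSymbol

/-- The block-cup `cup j · cross (j + 1) ⋯ cross (j + n)`. -/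
def blockCupAux (j : ℕ+) : ℕ → List SKSymbol
  | 0 => [cup j]
  | n + 1 => blockCupAux j n ++ [cross (j + n.succPNat)]

/-- The block-cap `cross (j + n) ⋯ cross (j + 1) · cap j`. -/
def blockCapAux (j : ℕ+) : ℕ → List SKSymbol
  | 0 => [cap j]
  | n + 1 => cross (j + n.succPNat) :: blockCapAux j n

/-- The block-crossing `cross (j + n) ⋯ cross (j + 1) · cross j`. -/
def blockCrossAux (j : ℕ+) : ℕ → List SKSymbol
  | 0 => [cross j]
  | n + 1 => cross (j + n.succPNat) :: blockCrossAux j n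

/-- The block-cup with indices `j, i`, for `j ≤ i`. -/
def blockCup (j i : ℕ+) : List SKSymbol := blockCupAux j ((i : ℕ) - j)

/-- The block-cap with indices `i, j`, for `j ≤ i`. -/
def blockCap (i j : ℕ+) : List SKSymbol := blockCapAux j ((i : ℕ) - j)

/-- The block-crossing `[i, j]`, for `j ≤ i`. -/
def blockCross (i j : ℕ+) : List SKSymbol := blockCrossAux j ((i : ℕ) - j)

/-- The circle `cup k · cap k`. -/
def circle (k : ℕ+) : List SKSymbol := [cup k, cap k]

end SKSymbol

/-- The term `t`, written without parentheses, is the normal form with `l` circles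
`c^l ⌈i_p, j_p⌉ ⋯ ⌈i_1, j_1⌉ 1 [k_1, l_1] ⋯ [k_q, l_q] ⌊m_1, n_1⌋ ⋯ ⌊m_r, n_r⌋`, where
`j_1 < ⋯ < j_p`, `k_1 < ⋯ < k_q`, `m_1 < ⋯ < m_r`. The circle `c` is written as `cup k · cap k`.
The lists are those of the pairs `(i_p, j_p), …, (i_1, j_1)` and `(k_1, l_1), …, (k_q, l_q)` and
`(m_1, n_1), …, (m_r, n_r)`, in the order in which they occur. -/
def SKTerm.IsNormalWith (k : ℕ+) (l : ℕ) (t : SKTerm) : Prop :=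
  ∃ caps crosses cups : List (ℕ+ × ℕ+),
    (∀ x ∈ caps, x.2 ≤ x.1) ∧ (∀ x ∈ crosses, x.2 ≤ x.1) ∧ (∀ x ∈ cups, x.1 ≤ x.2) ∧
    caps.Pairwise (fun x y => y.2 < x.2) ∧
    crosses.Pairwise (fun x y => x.1 < y.1) ∧
    cups.Pairwise (fun x y => x.1 < y.1) ∧
    t.word = (List.replicate l (SKSymbol.circle k)).flatten
      ++ (caps.map fun x => SKSymbol.blockCap x.1 x.2).flatten
      ++ [SKSymbol.one]
      ++ (crosses.map fun x => SKSymbol.blockCross x.1 x.2).flatten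
      ++ (cups.map fun x => SKSymbol.blockCup x.1 x.2).flatten

/-- Terms in normal form, where the circle is written as `cup k · cap k`. -/
def SKTerm.IsNormal (k : ℕ+) (t : SKTerm) : Prop := ∃ l, t.IsNormalWith k l

/-- Terms in `J`-normal form: those in normal form without circles at the beginning, so that the
choice of `k` does not matter. -/
def SKTerm.IsJNormal (t : SKTerm) : Prop := t.IsNormalWith 1 0

/-! ### Colorings of diagrams -/

/-! Color the points of both lines with two colors, constantly along threads. A diagram `D` then
becomes a relation `D.Rel x y` between colorings of its top line and of its bottom line, and this
relation loses nothing: two points are the ends of a thread exactly when no admissible coloring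
separates them (`mate_eq_of_rel`). One inclusion between relations already forces equality of
diagrams (`eq_of_rel_imp`). Composition of diagrams is composition of relations (`rel_mul`), and
when the outer colors are admissible for the composite, the number of middle colorings is `2` to the
number of circular components (`card_middle`). Associativity thus comes from relations, the count of
circles from counting pairs of colorings in two ways, and soundness from identities between maps on
indices.

Existence of normal forms is algebra in an arbitrary monoid with a `SymmetricSelfAdjunction`.
Crossings are sorted as in the symmetric group (`CrossNormal.mul_s`), cup-blocks are sorted by
insertion while crossings are expelled to the left (`cupBlock_mul_cupNormal`), caps are treated in
the opposite monoid, circles are central, and a cup to the left of caps is moved through them or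
disappears (`isMixed_cupBlock_mul_n`, `isFactored_mul`).

Uniqueness reads the normal form off its diagram. Caps and crossings create no thread between top
points, so the top threads come from the cup-blocks; the one with the largest left end is the last
block, which can be cancelled (`eq_of_mul_cups_eq`). Reflection does the same for cap-blocks, and
the permutation that remains determines the crossing-blocks (`eq_of_crossBlocks_eq`). The exponent
of the circle is the number of circles, since the rest of a normal form creates none
(`circles_of_normalWord`). Soundness, existence and uniqueness together give completeness.

Generation is an induction on the number of points before the diagram becomes vertical
(`mem_generated`): crossings bring a thread into a standard position where it can be removed.
Prescribed circle counts are then reached through the exponent of the circle in a normal form. -/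

/-- The `i`-th point of the top line, counted from `0`. -/
def NZInt.top (i : ℕ) : NZInt := ⟨i + 1, by omega⟩

/-- The `i`-th point of the bottom line, counted from `0`. -/
def NZInt.bot (i : ℕ) : NZInt := ⟨-(i + 1), by omega⟩

theorem NZInt.eq_top_or_eq_bot (a : NZInt) : (∃ i, a = NZInt.top i) ∨ ∃ i, a = NZInt.bot i := by
  have := a.2
  by_cases h : 0 < (a : ℤ)
  · exact Or.inl ⟨((a : ℤ) - 1).toNat, Subtype.ext (by simp only [NZInt.top]; omega)⟩
  · exact Or.inr ⟨(-(a : ℤ) - 1).toNat, Subtype.ext (by simp only [NZInt.bot]; omega)⟩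

theorem NZInt.top_inj {i j : ℕ} : NZInt.top i = NZInt.top j ↔ i = j := by
  simp [NZInt.top]

theorem NZInt.top_ne_bot (i j : ℕ) : NZInt.top i ≠ NZInt.bot j := by
  intro h
  have := congrArg Subtype.val h
  simp only [NZInt.top, NZInt.bot] at this
  omega

/-- The coloring of both lines with the colors `x` on the top line and `y` on the bottom line. -/
def joinCol (x y : ℕ → Bool) (a : NZInt) : Bool :=
  if 0 < (a : ℤ) then x ((a : ℤ) - 1).toNat else y (-(a : ℤ) - 1).toNat

@[simp] theorem joinCol_top (x y : ℕ → Bool) (i : ℕ) : joinCol x y (NZInt.top i) = x i := by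
  have h : 0 < (i : ℤ) + 1 := by omega
  simp [joinCol, NZInt.top, h]

@[simp] theorem joinCol_bot (x y : ℕ → Bool) (i : ℕ) : joinCol x y (NZInt.bot i) = y i := by
  have h : ¬ 0 < -((i : ℤ) + 1) := by omega
  simp only [joinCol, NZInt.bot, h, if_false]
  congr 1
  omega

theorem joinCol_comp (f : NZInt → Bool) :
    joinCol (fun i => f (NZInt.top i)) (fun i => f (NZInt.bot i)) = f := by
  funext a
  rcases a.eq_top_or_eq_bot with ⟨i, rfl⟩ | ⟨i, rfl⟩ <;> simp

namespace SJDiagram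

open Gluing

/-- The colors `x` of the top line and `y` of the bottom line are constant on threads. -/
def Rel (D : SJDiagram) (x y : ℕ → Bool) : Prop :=
  ∀ a, joinCol x y (D.mate a) = joinCol x y a

theorem rel_const (D : SJDiagram) (c : Bool) : D.Rel (fun _ => c) (fun _ => c) := by
  have h : ∀ a, joinCol (fun _ => c) (fun _ => c) a = c := fun a => by simp [joinCol]
  intro a
  rw [h, h]

/-- Points that have the same color in all colorings are the ends of a thread. -/
theorem mate_eq_of_rel (D : SJDiagram) {a b : NZInt} (hab : b ≠ a)
    (h : ∀ x y, D.Rel x y → joinCol x y a = joinCol x y b) : D.mate a = b := by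
  -- The test coloring is `true` exactly on the thread of `a`; it is constant on threads, so a point
  -- `b ≠ a` that always shares the color of `a` is the mate of `a`.
  have h1 := h (fun i => decide (NZInt.top i = a ∨ NZInt.top i = D.mate a))
    (fun i => decide (NZInt.bot i = a ∨ NZInt.bot i = D.mate a))
  have h2 := joinCol_comp (fun p => decide (p = a ∨ p = D.mate a))
  unfold Rel at h1
  rw [h2] at h1
  have h3 := h1 (fun p => by
    have : D.mate p = a ↔ p = D.mate a := ⟨fun h => by rw [← h, D.mate_mate],
      fun h => by rw [h, D.mate_mate]⟩
    have h' : D.mate p = D.mate a ↔ p = a := ⟨fun h => by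
      rw [← D.mate_mate p, h, D.mate_mate], fun h => by rw [h]⟩
    simp only [this, h', or_comm])
  simp [hab] at h3
  exact h3.symm

/-- A diagram is determined by its colorings. -/
theorem eq_of_rel_imp {D D' : SJDiagram} (h : ∀ x y, D.Rel x y → D'.Rel x y) : D = D' := by
  have : D.mate = D'.mate := by
    funext a
    -- Every coloring admissible for `D` is constant on the threads of `D'`, so `D'.mate a` is never
    -- separated from `a` and must be `D.mate a`. Hence one inclusion suffices.
    exact mate_eq_of_rel D (D'.mate_ne a) fun x y hxy => (h x y hxy a).symm
  exact SJDiagram.ext this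

theorem rel_one {x y : ℕ → Bool} : (1 : SJDiagram).Rel x y ↔ x = y := by
  constructor
  · intro h
    funext i
    have h1 := h (NZInt.top i)
    have : (1 : SJDiagram).mate (NZInt.top i) = NZInt.bot i := rfl
    rw [this] at h1
    simpa using h1.symm
  · rintro rfl a
    rcases a.eq_top_or_eq_bot with ⟨i, rfl⟩ | ⟨i, rfl⟩
    · have : (1 : SJDiagram).mate (NZInt.top i) = NZInt.bot i := rfl
      simp [this]
    · have : (1 : SJDiagram).mate (NZInt.bot i) = NZInt.top i :=
        Subtype.ext (neg_neg _)
      simp [this]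

/-! ### Colorings of composites -/

/-- The coloring of the picture by the colors of its three lines. -/
def pictureCol (x z y : ℕ → Bool) : Point → Bool := Sum.elim (joinCol x z) (joinCol z y)

theorem pictureCol_outer (x z y : ℕ → Bool) (a : NZInt) :
    pictureCol x z y (outer a) = joinCol x y a := by
  by_cases h : 0 < (a : ℤ) <;> simp [outer, pictureCol, joinCol, h]

/-- Threads preserve colors by hypothesis, and two identified points have the same color because
both middle lines are colored by `z`. -/
theorem pictureCol_connected {D₂ D₁ : SJDiagram} {x z y : ℕ → Bool} (h₁ : D₁.Rel x z)
    (h₂ : D₂.Rel z y) {p q : Point}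
    (h : connected D₂.toCouplingDiagram D₁.toCouplingDiagram p q) :
    pictureCol x z y p = pictureCol x z y q := by
  induction h with
  | rel p q h =>
    cases h with
    | upper a => exact (h₁ a).symm
    | lower a => exact (h₂ a).symm
    | ident a b hb hab =>
      rcases b.eq_top_or_eq_bot with ⟨i, rfl⟩ | ⟨i, rfl⟩
      · have : a = NZInt.bot i := Subtype.ext hab
        subst this
        simp [pictureCol]
      · simp only [NZInt.bot] at hb
        omega
  | refl p => rfl
  | symm p q _ ih => exact ih.symm
  | trans p q r _ _ ih₁ ih₂ => exact ih₁.trans ih₂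

/-- The colorings of the middle line correspond to the colorings of the components that extend
the given colors of the outer points. -/
def middleEquiv (D₂ D₁ : SJDiagram) (x y : ℕ → Bool) :
    {z : ℕ → Bool // D₁.Rel x z ∧ D₂.Rel z y} ≃
      {F : Quotient (connected D₂.toCouplingDiagram D₁.toCouplingDiagram) → Bool //
        ∀ a, F (Quotient.mk _ (outer a)) = joinCol x y a} where
  toFun z := ⟨Quotient.lift (pictureCol x z y) fun _ _ h => pictureCol_connected z.2.1 z.2.2 h,
    fun a => pictureCol_outer x z y a⟩
  invFun F := by
    -- The middle coloring is read at the bottom points of `D₁`. With it, the colors of both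
    -- diagrams are the values of `F` on components: on the outer lines by the condition on `F`, on
    -- the top line of `D₂` by the identification of the middle lines.
    have hl : joinCol x (fun i => F.1 (Quotient.mk _ (Sum.inl (NZInt.bot i)))) =
        fun a => F.1 (Quotient.mk _ (Sum.inl a)) := by
      funext a
      rcases a.eq_top_or_eq_bot with ⟨i, rfl⟩ | ⟨i, rfl⟩
      · have := F.2 (NZInt.top i)
        have h : outer (NZInt.top i) = Sum.inl (NZInt.top i) :=
          if_pos (by simp only [NZInt.top]; omega)
        rw [h] at this
        simpa using this.symm
      · simp
    have hr : joinCol (fun i => F.1 (Quotient.mk _ (Sum.inl (NZInt.bot i)))) y =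
        fun a => F.1 (Quotient.mk _ (Sum.inr a)) := by
      funext a
      rcases a.eq_top_or_eq_bot with ⟨i, rfl⟩ | ⟨i, rfl⟩
      · rw [joinCol_top]
        refine congrArg F.1 (Quotient.sound (Relation.EqvGen.rel _ _ (Link.ident _ _ ?_ rfl)))
        simp only [NZInt.top]
        omega
      · have := F.2 (NZInt.bot i)
        have h : outer (NZInt.bot i) = Sum.inr (NZInt.bot i) :=
          if_neg (by simp only [NZInt.bot]; omega)
        rw [h] at this
        simpa using this.symm
    refine ⟨fun i => F.1 (Quotient.mk _ (Sum.inl (NZInt.bot i))), fun a => ?_, fun a => ?_⟩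
    · rw [hl]
      exact congrArg F.1 (Quotient.sound (Setoid.symm' _ (Relation.EqvGen.rel _ _ (Link.upper a))))
    · rw [hr]
      exact congrArg F.1 (Quotient.sound (Setoid.symm' _ (Relation.EqvGen.rel _ _ (Link.lower a))))
  left_inv z := by
    apply Subtype.ext
    funext i
    simp [pictureCol]
  right_inv F := by
    apply Subtype.ext
    funext c
    induction c using Quotient.inductionOn with
    | h p =>
    rcases p with a | a
    · rcases a.eq_top_or_eq_bot with ⟨i, rfl⟩ | ⟨i, rfl⟩
      · have := F.2 (NZInt.top i)
        have h : outer (NZInt.top i) = Sum.inl (NZInt.top i) :=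
          if_pos (by simp only [NZInt.top]; omega)
        rw [h] at this
        simp [pictureCol, this]
      · simp [pictureCol]
    · rcases a.eq_top_or_eq_bot with ⟨i, rfl⟩ | ⟨i, rfl⟩
      · simp only [pictureCol, Quotient.lift_mk, Sum.elim_inr, joinCol_top]
        refine congrArg F.1 (Quotient.sound (Relation.EqvGen.rel _ _ (Link.ident _ _ ?_ rfl)))
        simp only [NZInt.top]
        omega
      · have := F.2 (NZInt.bot i)
        have h : outer (NZInt.bot i) = Sum.inr (NZInt.bot i) :=
          if_neg (by simp only [NZInt.bot]; omega)
        rw [h] at this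
        simp [pictureCol, this]

open Classical in
/-- Functions with prescribed values on a range correspond to functions on its complement. -/
noncomputable def _root_.extensionEquiv {A Q : Type*} (f : A → Q) (g : A → Bool)
    (hg : ∀ a b, f a = f b → g a = g b) :
    {F : Q → Bool // ∀ a, F (f a) = g a} ≃ ({c : Q | ∀ a, c ≠ f a} → Bool) where
  toFun F c := F.1 c
  invFun G := ⟨fun c => if h : ∃ a, c = f a then g h.choose
      else G ⟨c, fun a ha => h ⟨a, ha⟩⟩, fun a => by
    have h : ∃ b, f a = f b := ⟨a, rfl⟩
    simp only [dif_pos h]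
    exact hg _ _ h.choose_spec.symm⟩
  left_inv F := by
    apply Subtype.ext
    funext c
    by_cases h : ∃ a, c = f a
    · simp only [dif_pos h]
      rw [← F.2, ← h.choose_spec]
    · simp only [dif_neg h]
  right_inv G := by
    funext c
    have h : ¬ ∃ a, (c : Q) = f a := fun ⟨a, ha⟩ => c.2 a ha
    simp only [dif_neg h]

theorem joinCol_eq_of_connected {D₂ D₁ : SJDiagram} {x y : ℕ → Bool} (h : (D₂ * D₁).Rel x y)
    (a b : NZInt) (hab : connected D₂.toCouplingDiagram D₁.toCouplingDiagram (outer a) (outer b)) :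
    joinCol x y a = joinCol x y b := by
  by_cases hne : b = a
  · rw [hne]
  · rw [eq_compMate hne hab]
    exact (h a).symm

/-- The number of colorings of the middle line determines the number of circular components. -/
theorem card_middle {D₂ D₁ : SJDiagram} {x y : ℕ → Bool} (h : (D₂ * D₁).Rel x y) :
    Nat.card {z : ℕ → Bool // D₁.Rel x z ∧ D₂.Rel z y} = 2 ^ loops D₂ D₁ := by
  have := (circularComponents_finite D₂ D₁).to_subtype
  -- The value is prescribed, consistently by `h`, on components that reach an outer point, and it
  -- is free on each circular component: one factor `2` for each.
  rw [Nat.card_congr ((middleEquiv D₂ D₁ x y).trans (extensionEquiv _ (joinCol x y) fun a b hab =>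
    joinCol_eq_of_connected h a b (Quotient.exact hab)))]
  exact (Nat.card_fun (α := circularComponents D₂.toCouplingDiagram D₁.toCouplingDiagram)
    (β := Bool)).trans (by simp [loops, Set.ncard])

/-- A power of two is not zero, so `card_middle` provides a middle coloring. Conversely, a middle
coloring colors the whole picture, and connected outer points receive equal colors. -/
theorem rel_mul {D₂ D₁ : SJDiagram} {x y : ℕ → Bool} :
    (D₂ * D₁).Rel x y ↔ ∃ z, D₁.Rel x z ∧ D₂.Rel z y := by
  constructor
  · intro h
    have h1 := card_middle h
    have h2 : Nat.card {z : ℕ → Bool // D₁.Rel x z ∧ D₂.Rel z y} ≠ 0 := by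
      rw [h1]; positivity
    obtain ⟨z⟩ := (Nat.card_ne_zero.1 h2).1
    exact ⟨z.1, z.2⟩
  · rintro ⟨z, h₁, h₂⟩ a
    rw [← pictureCol_outer x z y, ← pictureCol_outer x z y a]
    exact (pictureCol_connected h₁ h₂ (connected_compMate D₂ D₁ a)).symm

/-- `Nat.card` is `0` on infinite types, so the nonzero value in `card_middle` contains finiteness;
if the outer colors are not admissible for the composite, there is no middle coloring at all. -/
theorem finite_middle (D₂ D₁ : SJDiagram) (x y : ℕ → Bool) :
    Finite {z : ℕ → Bool // D₁.Rel x z ∧ D₂.Rel z y} := by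
  by_cases h : (D₂ * D₁).Rel x y
  · exact (Nat.card_ne_zero.1 (by rw [card_middle h]; positivity)).2
  · have : IsEmpty {z : ℕ → Bool // D₁.Rel x z ∧ D₂.Rel z y} :=
      ⟨fun z => h (rel_mul.2 ⟨z.1, z.2⟩)⟩
    infer_instance

/-! ### The monoids of diagrams -/

theorem diagram_mul_assoc (D₃ D₂ D₁ : SJDiagram) : D₃ * D₂ * D₁ = D₃ * (D₂ * D₁) := by
  refine eq_of_rel_imp fun x y h => ?_
  obtain ⟨z, h₁, h⟩ := rel_mul.1 h
  obtain ⟨w, h₂, h₃⟩ := rel_mul.1 h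
  exact rel_mul.2 ⟨w, rel_mul.2 ⟨z, h₁, h₂⟩, h₃⟩

theorem diagram_one_mul (D : SJDiagram) : 1 * D = D := by
  refine eq_of_rel_imp fun x y h => ?_
  obtain ⟨z, h₁, h⟩ := rel_mul.1 h
  rwa [← rel_one.1 h]

theorem diagram_mul_one (D : SJDiagram) : D * 1 = D := by
  refine eq_of_rel_imp fun x y h => ?_
  obtain ⟨z, h, h₁⟩ := rel_mul.1 h
  rwa [rel_one.1 h]

/-- Both ways of counting the circular components of a picture of three diagrams agree. -/
theorem loops_add_loops (D₃ D₂ D₁ : SJDiagram) :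
    loops D₂ D₁ + loops D₃ (D₂ * D₁) = loops D₃ D₂ + loops (D₃ * D₂) D₁ := by
  -- Pairs `(z, w)` of colorings of the two inner lines, with `false` on both outer lines, are
  -- counted twice: grouped by `w` and grouped by `z`. Each grouping gives a product of two powers
  -- of `2`, and the exponents are compared.
  set o : ℕ → Bool := fun _ => false
  let e₁ : (Σ w : {w : ℕ → Bool // (D₂ * D₁).Rel o w ∧ D₃.Rel w o},
      {z : ℕ → Bool // D₁.Rel o z ∧ D₂.Rel z w}) ≃
      (Σ z : {z : ℕ → Bool // D₁.Rel o z ∧ (D₃ * D₂).Rel z o},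
        {w : ℕ → Bool // D₂.Rel z w ∧ D₃.Rel w o}) :=
    { toFun := fun p => ⟨⟨p.2.1, p.2.2.1, rel_mul.2 ⟨p.1.1, p.2.2.2, p.1.2.2⟩⟩,
        ⟨p.1.1, p.2.2.2, p.1.2.2⟩⟩
      invFun := fun p => ⟨⟨p.2.1, rel_mul.2 ⟨p.1.1, p.1.2.1, p.2.2.1⟩, p.2.2.2⟩,
        ⟨p.1.1, p.1.2.1, p.2.2.1⟩⟩
      left_inv := fun p => rfl
      right_inv := fun p => rfl }
  have h := Nat.card_congr e₁
  have i₁ := finite_middle D₃ (D₂ * D₁) o o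
  have i₂ := finite_middle (D₃ * D₂) D₁ o o
  have i₃ := fun w => finite_middle D₂ D₁ o w
  have i₄ := fun z => finite_middle D₃ D₂ z o
  have f₁ := Fintype.ofFinite {w : ℕ → Bool // (D₂ * D₁).Rel o w ∧ D₃.Rel w o}
  have f₂ := Fintype.ofFinite {z : ℕ → Bool // D₁.Rel o z ∧ (D₃ * D₂).Rel z o}
  rw [Nat.card_sigma, Nat.card_sigma, Finset.sum_congr rfl fun w _ => card_middle w.2.1,
    Finset.sum_congr rfl fun z _ => card_middle z.2.2, Finset.sum_const, Finset.sum_const,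
    Finset.card_univ, Finset.card_univ, ← Nat.card_eq_fintype_card, ← Nat.card_eq_fintype_card,
    card_middle (rel_const _ _), card_middle (rel_const _ _), smul_eq_mul, smul_eq_mul,
    ← pow_add, ← pow_add] at h
  have := Nat.pow_right_injective le_rfl h
  omega

/-- A criterion for the absence of circular components. -/
theorem loops_eq_zero {D₂ D₁ : SJDiagram}
    (h : ∀ z, D₁.Rel (fun _ => false) z → D₂.Rel z (fun _ => false) → z = fun _ => false) :
    loops D₂ D₁ = 0 := by
  have h1 := card_middle (D₂ := D₂) (D₁ := D₁) (rel_const _ false)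
  have : Subsingleton {z : ℕ → Bool // D₁.Rel (fun _ => false) z ∧ D₂.Rel z (fun _ => false)} :=
    ⟨fun a b => Subtype.ext ((h a a.2.1 a.2.2).trans (h b b.2.1 b.2.2).symm)⟩
  have h2 := Finite.card_le_one_iff_subsingleton.2 this
  rw [h1] at h2
  by_contra h0
  have := Nat.one_lt_two_pow h0
  omega

/-! ### Diagrams whose composition creates no circles -/

/-- The colors of the top line determine those of the bottom line. -/
def Functional (D : SJDiagram) : Prop := ∀ x y y', D.Rel x y → D.Rel x y' → y = y'

/-- The colors of the bottom line determine those of the top line. -/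
def Cofunctional (D : SJDiagram) : Prop := ∀ x x' y, D.Rel x y → D.Rel x' y → x = x'

theorem Functional.mul {D₂ D₁ : SJDiagram} (h₂ : D₂.Functional) (h₁ : D₁.Functional) :
    (D₂ * D₁).Functional := by
  intro x y y' h h'
  obtain ⟨z, hz, hy⟩ := rel_mul.1 h
  obtain ⟨z', hz', hy'⟩ := rel_mul.1 h'
  rw [h₁ _ _ _ hz hz'] at hy
  exact h₂ _ _ _ hy hy'

theorem Cofunctional.mul {D₂ D₁ : SJDiagram} (h₂ : D₂.Cofunctional) (h₁ : D₁.Cofunctional) :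
    (D₂ * D₁).Cofunctional := by
  intro x x' y h h'
  obtain ⟨z, hz, hy⟩ := rel_mul.1 h
  obtain ⟨z', hz', hy'⟩ := rel_mul.1 h'
  rw [h₂ _ _ _ hy hy'] at hz
  exact h₁ _ _ _ hz hz'

/-- A circular component would allow a second middle coloring with the same outer colors, but here
the colors of the top line force the middle line. -/
theorem Functional.loops_eq_zero {D₁ : SJDiagram} (h : D₁.Functional) (D₂ : SJDiagram) :
    loops D₂ D₁ = 0 :=
  SJDiagram.loops_eq_zero fun _ hz _ => h _ _ _ hz (rel_const _ _)

theorem Cofunctional.loops_eq_zero {D₂ : SJDiagram} (h : D₂.Cofunctional) (D₁ : SJDiagram) :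
    loops D₂ D₁ = 0 :=
  SJDiagram.loops_eq_zero fun _ _ hz => h _ _ _ hz (rel_const _ _)

theorem functional_one : (1 : SJDiagram).Functional := fun x y y' h h' => by
  rw [← rel_one.1 h, ← rel_one.1 h']

theorem cofunctional_one : (1 : SJDiagram).Cofunctional := fun x y y' h h' => by
  rw [rel_one.1 h, rel_one.1 h']

end SJDiagram

/-- The monoid of `SJ` diagrams. -/
@[reducible] noncomputable def SJDiagram.monoid : Monoid SJDiagram where
  mul_assoc := SJDiagram.diagram_mul_assoc
  one_mul := SJDiagram.diagram_one_mul
  mul_one := SJDiagram.diagram_mul_one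

namespace SKDiagram

theorem diagram_mul (E₂ E₁ : SKDiagram) : (E₂ * E₁).diagram = E₂.diagram * E₁.diagram := rfl

theorem circles_mul (E₂ E₁ : SKDiagram) : (E₂ * E₁).circles =
    E₁.circles + E₂.circles + SJDiagram.loops E₂.diagram E₁.diagram := rfl

theorem diagram_one : (1 : SKDiagram).diagram = 1 := rfl

theorem circles_one : (1 : SKDiagram).circles = 0 := rfl

end SKDiagram

/-- The monoid of `SK` diagrams. -/
@[reducible] noncomputable def SKDiagram.monoid : Monoid SKDiagram where
  mul_assoc E₃ E₂ E₁ := by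
    refine SKDiagram.ext (SJDiagram.diagram_mul_assoc _ _ _) ?_
    have := SJDiagram.loops_add_loops E₃.diagram E₂.diagram E₁.diagram
    simp only [SKDiagram.circles_mul, SKDiagram.diagram_mul]
    omega
  one_mul E := by
    refine SKDiagram.ext (SJDiagram.diagram_one_mul _) ?_
    rw [SKDiagram.circles_mul, SKDiagram.circles_one, SKDiagram.diagram_one,
      SJDiagram.cofunctional_one.loops_eq_zero]
    omega
  mul_one E := by
    refine SKDiagram.ext (SJDiagram.diagram_mul_one _) ?_
    rw [SKDiagram.circles_mul, SKDiagram.circles_one, SKDiagram.diagram_one,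
      SJDiagram.functional_one.loops_eq_zero]
    omega

namespace SJDiagram

/-! ### Colorings of the generating diagrams -/

/-- The increasing map whose range misses `k` and `k + 1`. -/
def skip (k n : ℕ) : ℕ := if n < k then n else n + 2

/-- The transposition of `k` and `k + 1`. -/
def flipAt (k n : ℕ) : ℕ := if n = k then k + 1 else if n = k + 1 then k else n

theorem skip_of_lt {k n : ℕ} (h : n < k) : skip k n = n := if_pos h

theorem skip_of_le {k n : ℕ} (h : k ≤ n) : skip k n = n + 2 := if_neg h.not_gt

/-- The truncated subtraction is exact: the last case has `k + 2 ≤ n`. -/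
theorem cup_mate_top {k n : ℕ} : (cup k.succPNat).mate (NZInt.top n) =
    if n = k then NZInt.top (k + 1) else if n = k + 1 then NZInt.top k
    else if n < k then NZInt.bot n else NZInt.bot (n - 2) := by
  split_ifs <;> apply Subtype.ext <;> simp only [cup, NZInt.top, NZInt.bot, Nat.succPNat_coe] <;>
    push_cast <;> split_ifs <;> omega

theorem cup_mate_bot {k n : ℕ} : (cup k.succPNat).mate (NZInt.bot n) =
    NZInt.top (skip k n) := by
  apply Subtype.ext
  simp only [cup, NZInt.top, NZInt.bot, Nat.succPNat_coe, skip]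
  split_ifs <;> push_cast at * <;> omega

theorem cap_mate_bot {k n : ℕ} : (cap k.succPNat).mate (NZInt.bot n) =
    if n = k then NZInt.bot (k + 1) else if n = k + 1 then NZInt.bot k
    else if n < k then NZInt.top n else NZInt.top (n - 2) := by
  split_ifs <;> apply Subtype.ext <;> simp only [cap, NZInt.top, NZInt.bot, Nat.succPNat_coe] <;>
    push_cast <;> split_ifs <;> omega

theorem cap_mate_top {k n : ℕ} : (cap k.succPNat).mate (NZInt.top n) =
    NZInt.bot (skip k n) := by
  apply Subtype.ext
  simp only [cap, NZInt.top, NZInt.bot, Nat.succPNat_coe, skip]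
  split_ifs <;> push_cast at * <;> omega

theorem crossing_mate_top {k n : ℕ} : (crossing k.succPNat).mate (NZInt.top n) =
    NZInt.bot (flipAt k n) := by
  apply Subtype.ext
  simp only [crossing, NZInt.top, NZInt.bot, Nat.succPNat_coe, flipAt]
  split_ifs <;> push_cast at * <;> omega

theorem crossing_mate_bot {k n : ℕ} : (crossing k.succPNat).mate (NZInt.bot n) =
    NZInt.top (flipAt k n) := by
  apply Subtype.ext
  simp only [crossing, NZInt.top, NZInt.bot, Nat.succPNat_coe, flipAt]
  split_ifs <;> push_cast at * <;> omega

theorem flipAt_flipAt (k n : ℕ) : flipAt k (flipAt k n) = n := by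
  simp only [flipAt]
  split_ifs <;> omega

/-- The relation between the colors of the lines of a cup diagram. -/
theorem rel_cup {k : ℕ} {x y : ℕ → Bool} :
    (cup k.succPNat).Rel x y ↔ x k = x (k + 1) ∧ ∀ n, y n = x (skip k n) := by
  constructor
  · intro h
    refine ⟨?_, fun n => ?_⟩
    · have := h (NZInt.top k)
      rw [cup_mate_top, if_pos rfl] at this
      simpa using this.symm
    · have := h (NZInt.bot n)
      rw [cup_mate_bot] at this
      simpa using this.symm
  · rintro ⟨h1, h2⟩ a
    rcases a.eq_top_or_eq_bot with ⟨n, rfl⟩ | ⟨n, rfl⟩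
    · rw [cup_mate_top]
      split_ifs with h3 h4 h5
      · simp [h3, h1]
      · simp [h4, h1]
      · simp [h2, skip, h5]
      · have h6 : ¬ n - 2 < k := by omega
        have h7 : n - 2 + 2 = n := by omega
        simp [h2, skip, h6, h7]
    · rw [cup_mate_bot]
      simp [h2]

/-- The relation between the colors of the lines of a cap diagram. -/
theorem rel_cap {k : ℕ} {x y : ℕ → Bool} :
    (cap k.succPNat).Rel x y ↔ y k = y (k + 1) ∧ ∀ n, x n = y (skip k n) := by
  constructor
  · intro h
    refine ⟨?_, fun n => ?_⟩
    · have := h (NZInt.bot k)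
      rw [cap_mate_bot, if_pos rfl] at this
      simpa using this.symm
    · have := h (NZInt.top n)
      rw [cap_mate_top] at this
      simpa using this.symm
  · rintro ⟨h1, h2⟩ a
    rcases a.eq_top_or_eq_bot with ⟨n, rfl⟩ | ⟨n, rfl⟩
    · rw [cap_mate_top]
      simp [h2]
    · rw [cap_mate_bot]
      split_ifs with h3 h4 h5
      · simp [h3, h1]
      · simp [h4, h1]
      · simp [h2, skip, h5]
      · have h6 : ¬ n - 2 < k := by omega
        have h7 : n - 2 + 2 = n := by omega
        simp [h2, skip, h6, h7]

/-- The relation between the colors of the lines of a crossing diagram. -/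
theorem rel_crossing {k : ℕ} {x y : ℕ → Bool} :
    (crossing k.succPNat).Rel x y ↔ ∀ n, y n = x (flipAt k n) := by
  constructor
  · intro h n
    have := h (NZInt.bot n)
    rw [crossing_mate_bot] at this
    simpa using this.symm
  · intro h a
    rcases a.eq_top_or_eq_bot with ⟨n, rfl⟩ | ⟨n, rfl⟩
    · rw [crossing_mate_top]
      simp [h, flipAt_flipAt]
    · rw [crossing_mate_bot]
      simp [h]

theorem functional_cup (k : ℕ) : (cup k.succPNat).Functional := fun x y y' h h' => by
  funext n
  rw [(rel_cup.1 h).2, (rel_cup.1 h').2]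

theorem cofunctional_cap (k : ℕ) : (cap k.succPNat).Cofunctional := fun x y y' h h' => by
  funext n
  rw [(rel_cap.1 h).2, (rel_cap.1 h').2]

theorem functional_crossing (k : ℕ) : (crossing k.succPNat).Functional := fun x y y' h h' => by
  funext n
  rw [rel_crossing.1 h, rel_crossing.1 h']

/-- A transposition is its own inverse, so the relation can also be read upwards. This form suits
the equations with caps, where the bottom line determines the top line. -/
theorem rel_crossing' {k : ℕ} {x y : ℕ → Bool} :
    (crossing k.succPNat).Rel x y ↔ ∀ n, x n = y (flipAt k n) := by
  rw [rel_crossing]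
  constructor <;> intro h n <;> rw [h, flipAt_flipAt]

theorem cofunctional_crossing (k : ℕ) : (crossing k.succPNat).Cofunctional :=
  fun x y y' h h' => by
    funext n
    rw [rel_crossing'.1 h, rel_crossing'.1 h']

/-! ### The defining equations in the monoid of `SJ` diagrams -/

theorem rel_mul₃ {D₃ D₂ D₁ : SJDiagram} {x y : ℕ → Bool} (h : (D₃ * D₂ * D₁).Rel x y) :
    ∃ z w, D₁.Rel x z ∧ D₂.Rel z w ∧ D₃.Rel w y := by
  obtain ⟨z, h₁, h⟩ := rel_mul.1 h
  obtain ⟨w, h₂, h₃⟩ := rel_mul.1 h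
  exact ⟨z, w, h₁, h₂, h₃⟩

/-- The pattern of all the equations below: one implication suffices, the middle colors on a
right-hand side that is a product are forced by one of its factors, and an identity between the
index maps `skip` and `flipAt` remains. -/
theorem cup_mul_cup {j k : ℕ} (h : j ≤ k) : cup k.succPNat * cup j.succPNat =
    cup j.succPNat * cup (k + 2).succPNat := by
  refine eq_of_rel_imp fun x y hxy => ?_
  obtain ⟨z, h₁, h₂⟩ := rel_mul.1 hxy
  rw [rel_cup] at h₁ h₂
  refine rel_mul.2 ⟨fun n => x (skip (k + 2) n), rel_cup.2 ⟨?_, fun n => rfl⟩,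
    rel_cup.2 ⟨?_, fun n => ?_⟩⟩
  · have := h₂.1
    rwa [h₁.2, h₁.2, skip_of_le h, skip_of_le (by omega)] at this
  · rw [skip_of_lt (by omega), skip_of_lt (by omega)]
    exact h₁.1
  · rw [h₂.2, h₁.2]
    congr 1
    simp only [skip]
    split_ifs <;> omega

theorem cap_mul_cap {j k : ℕ} (h : j ≤ k) : cap j.succPNat * cap k.succPNat =
    cap (k + 2).succPNat * cap j.succPNat := by
  refine eq_of_rel_imp fun x y hxy => ?_
  obtain ⟨z, h₂, h₁⟩ := rel_mul.1 hxy
  rw [rel_cap] at h₁ h₂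
  refine rel_mul.2 ⟨fun n => y (skip (k + 2) n), rel_cap.2 ⟨?_, fun n => ?_⟩,
    rel_cap.2 ⟨?_, fun n => rfl⟩⟩
  · rw [skip_of_lt (by omega), skip_of_lt (by omega)]
    exact h₁.1
  · rw [h₂.2, h₁.2]
    congr 1
    simp only [skip]
    split_ifs <;> omega
  · have := h₂.1
    rwa [h₁.2, h₁.2, skip_of_le h, skip_of_le (by omega)] at this

theorem cup_mul_cap₁ {j k : ℕ} (h : j ≤ k) : cup (k + 2).succPNat * cap j.succPNat =
    cap j.succPNat * cup k.succPNat := by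
  refine eq_of_rel_imp fun x y hxy => ?_
  obtain ⟨z, h₁, h₂⟩ := rel_mul.1 hxy
  rw [rel_cap] at h₁
  rw [rel_cup] at h₂
  refine rel_mul.2 ⟨fun n => x (skip k n), rel_cup.2 ⟨?_, fun n => rfl⟩,
    rel_cap.2 ⟨?_, fun n => ?_⟩⟩
  · rw [h₁.2, h₁.2, skip_of_le h, skip_of_le (by omega)]
    exact h₂.1
  · rw [h₂.2, h₂.2, skip_of_lt (by omega), skip_of_lt (by omega)]
    exact h₁.1
  · rw [h₁.2, h₂.2]
    congr 1
    simp only [skip]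
    split_ifs <;> omega

theorem cup_mul_cap₂ {j k : ℕ} (h : j ≤ k) : cup j.succPNat * cap (k + 2).succPNat =
    cap k.succPNat * cup j.succPNat := by
  refine eq_of_rel_imp fun x y hxy => ?_
  obtain ⟨z, h₁, h₂⟩ := rel_mul.1 hxy
  rw [rel_cap] at h₁
  rw [rel_cup] at h₂
  refine rel_mul.2 ⟨fun n => x (skip j n), rel_cup.2 ⟨?_, fun n => rfl⟩,
    rel_cap.2 ⟨?_, fun n => ?_⟩⟩
  · rw [h₁.2, h₁.2, skip_of_lt (by omega), skip_of_lt (by omega)]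
    exact h₂.1
  · rw [h₂.2, h₂.2, skip_of_le h, skip_of_le (by omega)]
    exact h₁.1
  · rw [h₁.2, h₂.2]
    congr 1
    simp only [skip]
    split_ifs <;> omega

/-- The maps `skip i` and `skip (i + 1)` differ only at `i`, and there the cup and the cap give `i`,
`i + 1` and `i + 2` the same color: a zigzag is straightened. -/
theorem cup_mul_cap_succ (i : ℕ) : cup i.succPNat * cap (i + 1).succPNat = 1 := by
  refine eq_of_rel_imp fun x y hxy => ?_
  obtain ⟨z, h₁, h₂⟩ := rel_mul.1 hxy
  rw [rel_cap] at h₁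
  rw [rel_cup] at h₂
  rw [rel_one]
  funext n
  rw [h₁.2, h₂.2]
  rcases lt_trichotomy n i with h | rfl | h
  · rw [skip_of_lt (by omega), skip_of_lt h]
  · rw [skip_of_lt (by omega), skip_of_le le_rfl, h₂.1, h₁.1]
  · rw [skip_of_le (by omega), skip_of_le (by omega)]

theorem crossing_mul_crossing {j k : ℕ} (h : j ≤ k) :
    crossing (k + 2).succPNat * crossing j.succPNat =
    crossing j.succPNat * crossing (k + 2).succPNat := by
  refine eq_of_rel_imp fun x y hxy => ?_
  obtain ⟨z, h₁, h₂⟩ := rel_mul.1 hxy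
  rw [rel_crossing] at h₁ h₂
  refine rel_mul.2 ⟨fun n => x (flipAt (k + 2) n), rel_crossing.2 fun n => rfl,
    rel_crossing.2 fun n => ?_⟩
  rw [h₂, h₁]
  congr 1
  simp only [flipAt]
  split_ifs <;> omega

theorem crossing_mul_self (i : ℕ) : crossing i.succPNat * crossing i.succPNat = 1 := by
  refine eq_of_rel_imp fun x y hxy => ?_
  obtain ⟨z, h₁, h₂⟩ := rel_mul.1 hxy
  rw [rel_crossing] at h₁ h₂
  rw [rel_one]
  funext n
  rw [h₂, h₁, flipAt_flipAt]

theorem crossing_braid (i : ℕ) :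
    crossing (i + 1).succPNat * crossing i.succPNat * crossing (i + 1).succPNat =
    crossing i.succPNat * crossing (i + 1).succPNat * crossing i.succPNat := by
  refine eq_of_rel_imp fun x y hxy => ?_
  obtain ⟨z, w, h₁, h₂, h₃⟩ := rel_mul₃ hxy
  rw [rel_crossing] at h₁ h₂ h₃
  refine rel_mul.2 ⟨fun n => x (flipAt i n), rel_crossing.2 fun n => rfl,
    rel_mul.2 ⟨fun n => x (flipAt i (flipAt (i + 1) n)), rel_crossing.2 fun n => rfl,
      rel_crossing.2 fun n => ?_⟩⟩
  rw [h₃, h₂, h₁]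
  congr 1
  simp only [flipAt]
  split_ifs <;> omega

theorem cup_mul_crossing₁ {j k : ℕ} (h : j ≤ k) : cup (k + 2).succPNat * crossing j.succPNat =
    crossing j.succPNat * cup (k + 2).succPNat := by
  refine eq_of_rel_imp fun x y hxy => ?_
  obtain ⟨z, h₁, h₂⟩ := rel_mul.1 hxy
  rw [rel_crossing] at h₁
  rw [rel_cup] at h₂
  refine rel_mul.2 ⟨fun n => x (skip (k + 2) n), rel_cup.2 ⟨?_, fun n => rfl⟩,
    rel_crossing.2 fun n => ?_⟩
  · have := h₂.1
    rw [h₁, h₁] at this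
    convert this using 2 <;> simp only [flipAt] <;> split_ifs <;> omega
  · rw [h₂.2, h₁]
    congr 1
    simp only [flipAt, skip]
    split_ifs <;> omega

theorem cup_mul_crossing₂ {j k : ℕ} (h : j ≤ k) : cup j.succPNat * crossing (k + 2).succPNat =
    crossing k.succPNat * cup j.succPNat := by
  refine eq_of_rel_imp fun x y hxy => ?_
  obtain ⟨z, h₁, h₂⟩ := rel_mul.1 hxy
  rw [rel_crossing] at h₁
  rw [rel_cup] at h₂
  refine rel_mul.2 ⟨fun n => x (skip j n), rel_cup.2 ⟨?_, fun n => rfl⟩,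
    rel_crossing.2 fun n => ?_⟩
  · have := h₂.1
    rw [h₁, h₁] at this
    convert this using 2 <;> simp only [flipAt] <;> split_ifs <;> omega
  · rw [h₂.2, h₁]
    congr 1
    simp only [flipAt, skip]
    split_ifs <;> omega

theorem cup_mul_crossing_self (i : ℕ) : cup i.succPNat * crossing i.succPNat =
    cup i.succPNat := by
  refine eq_of_rel_imp fun x y hxy => ?_
  obtain ⟨z, h₁, h₂⟩ := rel_mul.1 hxy
  rw [rel_crossing] at h₁
  rw [rel_cup] at h₂ ⊢
  refine ⟨?_, fun n => ?_⟩
  · have := h₂.1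
    rw [h₁, h₁] at this
    convert this.symm using 2 <;> simp only [flipAt] <;> split_ifs <;> omega
  · rw [h₂.2, h₁]
    congr 1
    simp only [flipAt, skip]
    split_ifs <;> omega

theorem cup_succ_mul_crossing (i : ℕ) : cup (i + 1).succPNat * crossing i.succPNat =
    cup i.succPNat * crossing (i + 1).succPNat := by
  refine eq_of_rel_imp fun x y hxy => ?_
  obtain ⟨z, h₁, h₂⟩ := rel_mul.1 hxy
  rw [rel_crossing] at h₁
  rw [rel_cup] at h₂
  refine rel_mul.2 ⟨fun n => x (flipAt (i + 1) n), rel_crossing.2 fun n => rfl,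
    rel_cup.2 ⟨?_, fun n => ?_⟩⟩
  · have := h₂.1
    rw [h₁, h₁] at this
    convert this using 2 <;> simp only [flipAt] <;> split_ifs <;> omega
  · rw [h₂.2, h₁]
    congr 1
    simp only [flipAt, skip]
    split_ifs <;> omega

theorem crossing_mul_cap₁ {j k : ℕ} (h : j ≤ k) : crossing j.succPNat * cap (k + 2).succPNat =
    cap (k + 2).succPNat * crossing j.succPNat := by
  refine eq_of_rel_imp fun x y hxy => ?_
  obtain ⟨z, h₂, h₁⟩ := rel_mul.1 hxy
  rw [rel_crossing'] at h₁
  rw [rel_cap] at h₂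
  refine rel_mul.2 ⟨fun n => y (skip (k + 2) n), rel_crossing'.2 fun n => ?_,
    rel_cap.2 ⟨?_, fun n => rfl⟩⟩
  · rw [h₂.2, h₁]
    congr 1
    simp only [flipAt, skip]
    split_ifs <;> omega
  · have := h₂.1
    rw [h₁, h₁] at this
    convert this using 2 <;> simp only [flipAt] <;> split_ifs <;> omega

theorem crossing_mul_cap₂ {j k : ℕ} (h : j ≤ k) : crossing (k + 2).succPNat * cap j.succPNat =
    cap j.succPNat * crossing k.succPNat := by
  refine eq_of_rel_imp fun x y hxy => ?_
  obtain ⟨z, h₂, h₁⟩ := rel_mul.1 hxy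
  rw [rel_crossing'] at h₁
  rw [rel_cap] at h₂
  refine rel_mul.2 ⟨fun n => y (skip j n), rel_crossing'.2 fun n => ?_,
    rel_cap.2 ⟨?_, fun n => rfl⟩⟩
  · rw [h₂.2, h₁]
    congr 1
    simp only [flipAt, skip]
    split_ifs <;> omega
  · have := h₂.1
    rw [h₁, h₁] at this
    convert this using 2 <;> simp only [flipAt] <;> split_ifs <;> omega

theorem crossing_mul_cap_self (i : ℕ) : crossing i.succPNat * cap i.succPNat =
    cap i.succPNat := by
  refine eq_of_rel_imp fun x y hxy => ?_
  obtain ⟨z, h₂, h₁⟩ := rel_mul.1 hxy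
  rw [rel_crossing'] at h₁
  rw [rel_cap] at h₂ ⊢
  refine ⟨?_, fun n => ?_⟩
  · have := h₂.1
    rw [h₁, h₁] at this
    convert this.symm using 2 <;> simp only [flipAt] <;> split_ifs <;> omega
  · rw [h₂.2, h₁]
    congr 1
    simp only [flipAt, skip]
    split_ifs <;> omega

theorem crossing_mul_cap_succ (i : ℕ) : crossing i.succPNat * cap (i + 1).succPNat =
    crossing (i + 1).succPNat * cap i.succPNat := by
  refine eq_of_rel_imp fun x y hxy => ?_
  obtain ⟨z, h₂, h₁⟩ := rel_mul.1 hxy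
  rw [rel_crossing'] at h₁
  rw [rel_cap] at h₂
  refine rel_mul.2 ⟨fun n => y (flipAt (i + 1) n), rel_cap.2 ⟨?_, fun n => ?_⟩,
    rel_crossing'.2 fun n => rfl⟩
  · have := h₂.1
    rw [h₁, h₁] at this
    convert this using 2 <;> simp only [flipAt] <;> split_ifs <;> omega
  · rw [h₂.2, h₁]
    congr 1
    simp only [flipAt, skip]
    split_ifs <;> omega

theorem cup_mul_cap_self (i : ℕ) : cup i.succPNat * cap i.succPNat = 1 := by
  refine eq_of_rel_imp fun x y hxy => ?_
  obtain ⟨z, h₁, h₂⟩ := rel_mul.1 hxy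
  rw [rel_one]
  funext n
  rw [(rel_cap.1 h₁).2, (rel_cup.1 h₂).2]

/-! ### Circular components of the defining equations -/

/-- With `false` outside, a middle coloring is `false` off `{j, j + 1}` and off `{i, i + 1}`. These
pairs share at most one point, and the cup links such a point to one outside the pair of the cap. -/
theorem loops_cup_cap_of_ne {i j : ℕ} (h : i ≠ j) : loops (cup i.succPNat) (cap j.succPNat) = 0 := by
  refine loops_eq_zero fun z h₁ h₂ => ?_
  rw [rel_cap] at h₁
  rw [rel_cup] at h₂
  have hj : ∀ n, n ≠ j → n ≠ j + 1 → z n = false := by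
    intro n h3 h4
    by_cases h5 : n < j
    · rw [h₁.2 n, skip_of_lt h5]
    · have := h₁.2 (n - 2)
      rw [skip_of_le (by omega), Nat.sub_add_cancel (by omega)] at this
      exact this.symm
  have hi : ∀ n, n ≠ i → n ≠ i + 1 → z n = false := by
    intro n h3 h4
    by_cases h5 : n < i
    · rw [h₂.2 n, skip_of_lt h5]
    · have := h₂.2 (n - 2)
      rw [skip_of_le (by omega), Nat.sub_add_cancel (by omega)] at this
      exact this.symm
  funext n
  by_cases h3 : n ≠ j ∧ n ≠ j + 1
  · exact hj n h3.1 h3.2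
  by_cases h4 : n ≠ i ∧ n ≠ i + 1
  · exact hi n h4.1 h4.2
  obtain rfl | rfl : n = i ∨ n = i + 1 := by omega
  · rw [h₂.1]
    exact hj _ (by omega) (by omega)
  · rw [← h₂.1]
    exact hj _ (by omega) (by omega)

/-- With `false` outside, only the common color of `i` and `i + 1` on the middle line is free; two
middle colorings mean one circular component. -/
theorem loops_cup_cap_self (i : ℕ) : loops (cup i.succPNat) (cap i.succPNat) = 1 := by
  have h := card_middle (D₂ := cup i.succPNat) (D₁ := cap i.succPNat) (rel_const _ false)
  let e : {z : ℕ → Bool // (cap i.succPNat).Rel (fun _ => false) z ∧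
      (cup i.succPNat).Rel z (fun _ => false)} ≃ Bool :=
    { toFun := fun z => z.1 i
      invFun := fun b => ⟨fun n => if n = i ∨ n = i + 1 then b else false, by
        have h1 : ∀ n, skip i n ≠ i ∧ skip i n ≠ i + 1 := fun n => by
          simp only [skip]
          split_ifs <;> omega
        constructor
        · rw [rel_cap]
          simp [h1]
        · rw [rel_cup]
          simp [h1]⟩
      left_inv := fun z => by
        obtain ⟨z, h1, h2⟩ := z
        rw [rel_cup] at h2
        apply Subtype.ext
        funext n
        simp only
        split_ifs with h3
        · rcases h3 with rfl | rfl
          · rfl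
          · exact h2.1
        · by_cases h5 : n < i
          · rw [h2.2 n, skip_of_lt h5]
          · have := h2.2 (n - 2)
            rwa [skip_of_le (by omega), Nat.sub_add_cancel (by omega)] at this
      right_inv := fun b => by simp }
  rw [Nat.card_congr e, Nat.card_eq_fintype_card, Fintype.card_bool] at h
  exact (Nat.pow_right_injective le_rfl (by simpa using h)).symm

end SJDiagram

/-! ### Normal forms in monoids with symmetric self-adjunctions -/

/-- The equations of the monoid `SKω` for families `u` (cups), `n` (caps), `s` (crossings). -/
structure SymmetricSelfAdjunction {M : Type*} [Monoid M] (u n s : ℕ → M) : Prop where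
  uu : ∀ {j k}, j ≤ k → u k * u j = u j * u (k + 2)
  nn : ∀ {j k}, j ≤ k → n j * n k = n (k + 2) * n j
  un₁ : ∀ {j k}, j ≤ k → u (k + 2) * n j = n j * u k
  un₂ : ∀ {j k}, j ≤ k → u j * n (k + 2) = n k * u j
  un_succ : ∀ i, u i * n (i + 1) = 1
  -- This is not a defining equation but a consequence of the others. It is included because passing
  -- to the opposite monoid exchanges it with `un_succ`.
  succ_un : ∀ i, u (i + 1) * n i = 1
  ss : ∀ {j k}, j ≤ k → s (k + 2) * s j = s j * s (k + 2)
  s_sq : ∀ i, s i * s i = 1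
  braid : ∀ i, s (i + 1) * s i * s (i + 1) = s i * s (i + 1) * s i
  us₁ : ∀ {j k}, j ≤ k → u (k + 2) * s j = s j * u (k + 2)
  us₂ : ∀ {j k}, j ≤ k → u j * s (k + 2) = s k * u j
  us : ∀ i, u i * s i = u i
  us_succ : ∀ i, u (i + 1) * s i = u i * s (i + 1)
  sn₁ : ∀ {j k}, j ≤ k → s j * n (k + 2) = n (k + 2) * s j
  sn₂ : ∀ {j k}, j ≤ k → s (k + 2) * n j = n j * s k
  sn : ∀ i, s i * n i = n i
  sn_succ : ∀ i, s i * n (i + 1) = s (i + 1) * n i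

/-! ### Blocks and sorted products of blocks -/

section Blocks

variable {M : Type*} [Monoid M]

/-- The product `u m * s (m + 1) * ⋯ * s (m + d)`. -/
def cupBlock (u s : ℕ → M) (m : ℕ) : ℕ → M
  | 0 => u m
  | d + 1 => cupBlock u s m d * s (m + d + 1)

/-- The product `s (m + d) * ⋯ * s (m + 1) * n m`. -/
def capBlock (n s : ℕ → M) (m : ℕ) : ℕ → M
  | 0 => n m
  | d + 1 => s (m + d + 1) * capBlock n s m d

/-- The product `s (l + d) * ⋯ * s (l + 1) * s l`. -/
def crossBlock (s : ℕ → M) (l : ℕ) : ℕ → M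
  | 0 => s l
  | d + 1 => s (l + d + 1) * crossBlock s l d

/-- Products of cup-blocks with increasing left indices, all at least `a`. -/
inductive CupNormal (u s : ℕ → M) : ℕ → M → Prop
  | nil (a : ℕ) : CupNormal u s a 1
  | cons {a m : ℕ} {x : M} (d : ℕ) (ha : a ≤ m) (hx : CupNormal u s (m + 1) x) :
      CupNormal u s a (cupBlock u s m d * x)

/-- Products of crossing-blocks with increasing left indices, all less than `b`. -/
inductive CrossNormal (s : ℕ → M) : ℕ → M → Prop
  | nil (b : ℕ) : CrossNormal s b 1
  | snoc {b l d : ℕ} {x : M} (hb : l + d < b) (hx : CrossNormal s (l + d) x) :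
      CrossNormal s b (x * crossBlock s l d)

/-- The submonoid generated by the crossings with index at least `a`. -/
def crossingsFrom (s : ℕ → M) (a : ℕ) : Submonoid M := Submonoid.closure (s '' Set.Ici a)

theorem mem_crossingsFrom {s : ℕ → M} {a j : ℕ} (h : a ≤ j) : s j ∈ crossingsFrom s a :=
  Submonoid.subset_closure ⟨j, h, rfl⟩

theorem crossingsFrom_mono {s : ℕ → M} {a b : ℕ} (h : a ≤ b) :
    crossingsFrom s b ≤ crossingsFrom s a :=
  Submonoid.closure_mono (Set.image_mono (Set.Ici_subset_Ici.2 h))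

theorem CrossNormal.mono {s : ℕ → M} {b b' : ℕ} {x : M} (hx : CrossNormal s b x) (h : b ≤ b') :
    CrossNormal s b' x := by
  cases hx with
  | nil => exact nil _
  | snoc hb hx => exact snoc (hb.trans_le h) hx

theorem CupNormal.exists_list {u s : ℕ → M} {a : ℕ} {x : M} (hx : CupNormal u s a x) :
    ∃ L : List (ℕ × ℕ), L.Pairwise (fun p q => p.1 < q.1) ∧ (∀ p ∈ L, a ≤ p.1) ∧
      x = (L.map fun p => cupBlock u s p.1 p.2).prod := by
  induction hx with
  | nil a => exact ⟨[], by simp⟩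
  | @cons a m x d ha hx ih =>
    obtain ⟨L, h1, h2, rfl⟩ := ih
    refine ⟨(m, d) :: L, List.pairwise_cons.2 ⟨fun p hp => h2 p hp, h1⟩, ?_, by simp⟩
    intro p hp
    rcases List.mem_cons.1 hp with rfl | hp
    · exact ha
    · have := h2 p hp
      omega

theorem CrossNormal.exists_list {s : ℕ → M} {b : ℕ} {x : M} (hx : CrossNormal s b x) :
    ∃ L : List (ℕ × ℕ), L.Pairwise (fun p q => p.1 + p.2 < q.1 + q.2) ∧
      (∀ p ∈ L, p.1 + p.2 < b) ∧ x = (L.map fun p => crossBlock s p.1 p.2).prod := by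
  induction hx with
  | nil b => exact ⟨[], by simp⟩
  | @snoc b l d x hb hx ih =>
    obtain ⟨L, h1, h2, rfl⟩ := ih
    refine ⟨L ++ [(l, d)], List.pairwise_append.2 ⟨h1, by simp, ?_⟩, ?_, by simp⟩
    · intro p hp q hq
      rw [List.mem_singleton.1 hq]
      exact h2 p hp
    · intro p hp
      rcases List.mem_append.1 hp with hp | hp
      · exact (h2 p hp).trans hb
      · rw [List.mem_singleton.1 hp]
        exact hb

open MulOpposite in
theorem op_capBlock (n s : ℕ → M) (m d : ℕ) :
    op (capBlock n s m d) = cupBlock (fun i => op (n i)) (fun i => op (s i)) m d := by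
  induction d with
  | zero => rfl
  | succ d ih => rw [capBlock, cupBlock, op_mul, ih]

end Blocks

namespace SymmetricSelfAdjunction

variable {M : Type*} [Monoid M] {u n s : ℕ → M}

open MulOpposite in
/-- The opposite monoid carries the symmetric self-adjunction with cups and caps exchanged. -/
theorem opposite (h : SymmetricSelfAdjunction u n s) :
    SymmetricSelfAdjunction (fun i => op (n i)) (fun i => op (u i)) (fun i => op (s i)) where
  uu hjk := by simp only [← op_mul, h.nn hjk]
  nn hjk := by simp only [← op_mul, h.uu hjk]
  un₁ hjk := by simp only [← op_mul, h.un₂ hjk]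
  un₂ hjk := by simp only [← op_mul, h.un₁ hjk]
  un_succ i := by simp only [← op_mul, h.succ_un i, op_one]
  succ_un i := by simp only [← op_mul, h.un_succ i, op_one]
  ss hjk := by simp only [← op_mul, h.ss hjk]
  s_sq i := by simp only [← op_mul, h.s_sq i, op_one]
  braid i := by simp only [← op_mul, ← mul_assoc, h.braid i]
  us₁ hjk := by simp only [← op_mul, h.sn₁ hjk]
  us₂ hjk := by simp only [← op_mul, h.sn₂ hjk]
  us i := by simp only [← op_mul, h.sn i]
  us_succ i := by simp only [← op_mul, h.sn_succ i]
  sn₁ hjk := by simp only [← op_mul, h.us₁ hjk]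
  sn₂ hjk := by simp only [← op_mul, h.us₂ hjk]
  sn i := by simp only [← op_mul, h.us i]
  sn_succ i := by simp only [← op_mul, h.us_succ i]

theorem s_comm (h : SymmetricSelfAdjunction u n s) {i j : ℕ} (hij : i + 2 ≤ j) :
    s j * s i = s i * s j := by
  obtain ⟨k, rfl⟩ := Nat.exists_eq_add_of_le' hij
  exact h.ss (j := i) (k := k + i) (by omega)

/-! #### Crossings -/

theorem crossBlock_mul_of_lt (h : SymmetricSelfAdjunction u n s) {l j : ℕ} (hj : j + 1 < l)
    (d : ℕ) : crossBlock s l d * s j = s j * crossBlock s l d := by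
  induction d with
  | zero => exact h.s_comm hj
  | succ d ih =>
    rw [crossBlock, mul_assoc, ih, ← mul_assoc, h.s_comm (by omega), mul_assoc]

theorem crossBlock_succ_mul (l d : ℕ) :
    crossBlock s (l + 1) d * s l = crossBlock s l (d + 1) := by
  induction d with
  | zero => rfl
  | succ d ih =>
    rw [crossBlock, mul_assoc, ih, crossBlock, crossBlock]
    congr 2
    omega

/-- The crossing commutes with the factors of index below `j`, becomes `s j` by the braid equation
at `s (j + 1) * s j`, and commutes with the remaining factors. -/
theorem crossBlock_mul_of_gt (h : SymmetricSelfAdjunction u n s) {l j d : ℕ} (hj : l ≤ j)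
    (hd : j < l + d) : crossBlock s l d * s (j + 1) = s j * crossBlock s l d := by
  induction d generalizing j with
  | zero => omega
  | succ d ih =>
    rcases Nat.lt_succ_iff_lt_or_eq.1 (show j < l + d + 1 by omega) with hlt | rfl
    · rw [crossBlock, mul_assoc, ih hj hlt, ← mul_assoc, h.s_comm (by omega), mul_assoc]
    · rw [crossBlock]
      cases d with
      | zero =>
        rw [crossBlock, Nat.add_zero]
        rw [← mul_assoc]
        exact h.braid l
      | succ d =>
        have hc : crossBlock s l d * s (l + d + 1 + 1) = s (l + d + 1 + 1) * crossBlock s l d := by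
          clear ih hj hd
          have : ∀ e j, l + e + 2 ≤ j → crossBlock s l e * s j = s j * crossBlock s l e := by
            intro e
            induction e with
            | zero => exact fun j hj => (h.s_comm hj).symm
            | succ e ih =>
              intro j hj
              rw [crossBlock, mul_assoc, ih j (by omega), ← mul_assoc,
                ← h.s_comm (show l + e + 1 + 2 ≤ j by omega), mul_assoc]
          exact this d _ le_rfl
        rw [crossBlock, ← add_assoc, mul_assoc, mul_assoc, hc, ← mul_assoc, ← mul_assoc, h.braid]
        simp only [mul_assoc]

/-- As for normal forms in symmetric groups, the new crossing opens a new block, lengthens or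
shortens the last block at its lower end, or passes through that block into the product on its left.
When it passes, its index stays below `l + d`, the bound for that product. -/
theorem CrossNormal.mul_s (h : SymmetricSelfAdjunction u n s) {b : ℕ} {x : M}
    (hx : CrossNormal s b x) {j : ℕ} (hj : j < b) : CrossNormal s b (x * s j) := by
  induction hx generalizing j with
  | nil b => exact CrossNormal.snoc (l := j) (d := 0) hj (CrossNormal.nil _)
  | @snoc b l d x hb hx ih =>
    rcases lt_or_ge (l + d) j with h1 | h1
    · exact CrossNormal.snoc (l := j) (d := 0) hj (CrossNormal.snoc h1 hx)
    rcases lt_trichotomy j l with h2 | rfl | h2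
    · rcases Nat.lt_or_ge (j + 1) l with h3 | h3
      · rw [mul_assoc, crossBlock_mul_of_lt h h3, ← mul_assoc]
        exact CrossNormal.snoc hb (ih (by omega))
      · obtain rfl : l = j + 1 := by omega
        rw [mul_assoc, crossBlock_succ_mul]
        exact CrossNormal.snoc (by omega) (by convert hx using 1; omega)
    · rw [mul_assoc]
      cases d with
      | zero =>
        rw [crossBlock, h.s_sq, mul_one]
        exact hx.mono hb.le
      | succ d =>
        rw [← crossBlock_succ_mul, mul_assoc, h.s_sq, mul_one]
        exact CrossNormal.snoc (by omega) (by convert hx using 1; omega)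
    · obtain ⟨j, rfl⟩ : ∃ i, j = i + 1 := ⟨j - 1, by omega⟩
      rw [mul_assoc, crossBlock_mul_of_gt h (by omega) (by omega), ← mul_assoc]
      exact CrossNormal.snoc hb (ih (by omega))

theorem exists_crossNormal (h : SymmetricSelfAdjunction u n s) {p : M}
    (hp : p ∈ crossingsFrom s 0) : ∃ b, CrossNormal s b p := by
  induction hp using Submonoid.closure_induction_right with
  | one => exact ⟨0, CrossNormal.nil 0⟩
  | mul_right p _ y hy ih =>
    obtain ⟨j, -, rfl⟩ := hy
    obtain ⟨b, hb⟩ := ih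
    exact ⟨max b (j + 1), CrossNormal.mul_s h (hb.mono (le_max_left _ _)) (by omega)⟩

/-! #### Cups -/

/-- The picture behind this group of lemmas: a cup-block is a cup with ends `m` and `m + d + 1`. A
crossing passes it unchanged if it lies to the left of both ends, with index lowered by one if it
lies between them, and by two if it lies to the right of both. A crossing that involves exactly one
end moves this end by one place; one that exchanges both ends is absorbed. -/
theorem cupBlock_mul_of_lt (h : SymmetricSelfAdjunction u n s) {m j : ℕ} (hj : j + 1 < m)
    (d : ℕ) : cupBlock u s m d * s j = s j * cupBlock u s m d := by
  induction d with
  | zero =>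
    obtain ⟨k, rfl⟩ := Nat.exists_eq_add_of_le' (show j + 2 ≤ m from hj)
    exact h.us₁ (j := j) (k := k + j) (by omega)
  | succ d ih =>
    rw [cupBlock, mul_assoc, h.s_comm (by omega), ← mul_assoc, ih, mul_assoc]

theorem cupBlock_succ_mul (h : SymmetricSelfAdjunction u n s) (m d : ℕ) :
    cupBlock u s (m + 1) d * s m = cupBlock u s m (d + 1) := by
  induction d with
  | zero => exact h.us_succ m
  | succ d ih =>
    rw [cupBlock, mul_assoc, h.s_comm (by omega), ← mul_assoc, ih, cupBlock.eq_2 _ _ _ (d + 1)]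
    congr 2
    omega

theorem cupBlock_mul_of_gt (h : SymmetricSelfAdjunction u n s) {m d j : ℕ} (hj : m + d ≤ j) :
    cupBlock u s m d * s (j + 2) = s j * cupBlock u s m d := by
  induction d with
  | zero => exact h.us₂ hj
  | succ d ih =>
    rw [cupBlock, mul_assoc, ← h.s_comm (by omega), ← mul_assoc, ih (by omega), mul_assoc]

/-- When the last two crossings of the block are involved, the braid equation turns `s (j + 1) * s
(j + 2) * s (j + 1)` into `s (j + 2) * s (j + 1) * s (j + 2)`, whose first factor leaves the shorter
block as `s j` by `cupBlock_mul_of_gt`. Later crossings of a longer block commute with `s (j + 1)`.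
-/
theorem cupBlock_mul_of_mem (h : SymmetricSelfAdjunction u n s) {m d j : ℕ} (hj : m ≤ j)
    (hd : j + 1 < m + d) : cupBlock u s m d * s (j + 1) = s j * cupBlock u s m d := by
  induction d with
  | zero => omega
  | succ d ih =>
    rcases Nat.lt_or_ge (j + 1) (m + d) with hlt | hge
    · rw [cupBlock, mul_assoc, h.s_comm (by omega), ← mul_assoc, ih hlt, mul_assoc]
    · obtain ⟨e, rfl⟩ : ∃ e, d = e + 1 := ⟨d - 1, by omega⟩
      obtain rfl : j = m + e := by omega
      rw [cupBlock, cupBlock, mul_assoc, mul_assoc, ← add_assoc m e 1, ← mul_assoc (s _),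
        ← h.braid, ← mul_assoc, ← mul_assoc, h.cupBlock_mul_of_gt le_rfl]
      simp only [mul_assoc]

theorem cupBlock_mul_last (h : SymmetricSelfAdjunction u n s) (m d : ℕ) :
    cupBlock u s m (d + 1) * s (m + d + 1) = cupBlock u s m d := by
  rw [cupBlock, mul_assoc, h.s_sq, mul_one]

theorem cupBlock_succ_mul_first (h : SymmetricSelfAdjunction u n s) (m d : ℕ) :
    cupBlock u s m (d + 1) * s m = cupBlock u s (m + 1) d := by
  rw [← h.cupBlock_succ_mul, mul_assoc, h.s_sq, mul_one]

/-- A crossing strictly to the right of the left end `m` can change only the right end. This is what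
keeps sorted products sorted when crossings are moved out of them. -/
theorem cupBlock_mul_s_left (h : SymmetricSelfAdjunction u n s) {m j : ℕ} (hj : m < j) (d : ℕ) :
    ∃ p ∈ crossingsFrom s m, ∃ e, cupBlock u s m d * s j = p * cupBlock u s m e := by
  rcases lt_trichotomy j (m + d) with h1 | rfl | h1
  · obtain ⟨j, rfl⟩ : ∃ i, j = i + 1 := ⟨j - 1, by omega⟩
    exact ⟨s j, mem_crossingsFrom (by omega), d, h.cupBlock_mul_of_mem (by omega) h1⟩
  · obtain ⟨d, rfl⟩ : ∃ e, d = e + 1 := ⟨d - 1, by omega⟩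
    exact ⟨1, one_mem _, d, by rw [one_mul, ← add_assoc, h.cupBlock_mul_last]⟩
  · rcases Nat.lt_or_ge (m + d + 1) j with h2 | h2
    · obtain ⟨j, rfl⟩ : ∃ i, j = i + 2 := ⟨j - 2, by omega⟩
      exact ⟨s j, mem_crossingsFrom (by omega), d, h.cupBlock_mul_of_gt (by omega)⟩
    · obtain rfl : j = m + d + 1 := by omega
      exact ⟨1, one_mem _, d + 1, by rw [one_mul, cupBlock]⟩

theorem cupBlock_mul_s (h : SymmetricSelfAdjunction u n s) {a m j : ℕ} (hm : a ≤ m) (hj : a ≤ j)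
    (d : ℕ) : ∃ p ∈ crossingsFrom s a, ∃ m' e, a ≤ m' ∧
      cupBlock u s m d * s j = p * cupBlock u s m' e := by
  rcases lt_trichotomy j m with h1 | rfl | h1
  · rcases Nat.lt_or_ge (j + 1) m with h2 | h2
    · exact ⟨s j, mem_crossingsFrom hj, m, d, hm, h.cupBlock_mul_of_lt h2 d⟩
    · obtain rfl : m = j + 1 := by omega
      exact ⟨1, one_mem _, j, d + 1, hj, by rw [one_mul, h.cupBlock_succ_mul]⟩
  · cases d with
    | zero => exact ⟨1, one_mem _, j, 0, hj, by rw [one_mul, cupBlock, h.us]⟩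
    | succ d =>
      exact ⟨1, one_mem _, j + 1, d, by omega, by rw [one_mul, h.cupBlock_succ_mul_first]⟩
  · obtain ⟨p, hp, e, he⟩ := h.cupBlock_mul_s_left h1 d
    exact ⟨p, crossingsFrom_mono hm hp, m, e, hm, he⟩

theorem cupBlock_mul_crossings_left (h : SymmetricSelfAdjunction u n s) {m : ℕ} {q : M}
    (hq : q ∈ crossingsFrom s (m + 1)) (d : ℕ) :
    ∃ p ∈ crossingsFrom s m, ∃ e, cupBlock u s m d * q = p * cupBlock u s m e := by
  induction hq using Submonoid.closure_induction_right with
  | one => exact ⟨1, one_mem _, d, by rw [one_mul, mul_one]⟩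
  | mul_right q _ y hy ih =>
    obtain ⟨j, hj, rfl⟩ := hy
    obtain ⟨p, hp, e, he⟩ := ih
    obtain ⟨p', hp', e', he'⟩ := h.cupBlock_mul_s_left (show m < j from hj) e
    exact ⟨p * p', mul_mem hp hp', e', by rw [← mul_assoc, he, mul_assoc, he', mul_assoc]⟩

theorem cupBlock_mul_crossings (h : SymmetricSelfAdjunction u n s) {a m : ℕ} (hm : a ≤ m) {q : M}
    (hq : q ∈ crossingsFrom s a) (d : ℕ) :
    ∃ p ∈ crossingsFrom s a, ∃ m' e, a ≤ m' ∧
      cupBlock u s m d * q = p * cupBlock u s m' e := by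
  induction hq using Submonoid.closure_induction_right with
  | one => exact ⟨1, one_mem _, m, d, hm, by rw [one_mul, mul_one]⟩
  | mul_right q _ y hy ih =>
    obtain ⟨j, hj, rfl⟩ := hy
    obtain ⟨p, hp, m₁, e, hm₁, he⟩ := ih
    obtain ⟨p', hp', m', e', hm', he'⟩ := h.cupBlock_mul_s hm₁ (show a ≤ j from hj) e
    exact ⟨p * p', mul_mem hp hp', m', e', hm', by rw [← mul_assoc, he, mul_assoc, he', mul_assoc]⟩

theorem cupBlock_mul_u (h : SymmetricSelfAdjunction u n s) {m m₁ : ℕ} (hm : m₁ ≤ m) (d : ℕ) :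
    cupBlock u s m d * u m₁ = u m₁ * cupBlock u s (m + 2) d := by
  induction d with
  | zero => exact h.uu hm
  | succ d ih =>
    rw [cupBlock, mul_assoc, ← h.us₂ (show m₁ ≤ m + d + 1 by omega), ← mul_assoc, ih, cupBlock,
      mul_assoc]
    congr 3
    omega

/-- Two cup-blocks in the wrong order can be exchanged. -/
theorem cupBlock_mul_cupBlock (h : SymmetricSelfAdjunction u n s) {m m₁ : ℕ} (hm : m₁ ≤ m)
    (d d₁ : ℕ) : ∃ p ∈ crossingsFrom s m₁, ∃ e m' e', m₁ + 1 ≤ m' ∧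
      cupBlock u s m d * cupBlock u s m₁ d₁ =
        p * cupBlock u s m₁ e * cupBlock u s m' e' := by
  induction d₁ with
  | zero => exact ⟨1, one_mem _, 0, m + 2, d, by omega, by
      rw [one_mul]; exact h.cupBlock_mul_u hm d⟩
  | succ d₁ ih =>
    -- Induction on the length of the right block. Its new last crossing passes the block at `m'`;
    -- what is expelled has indices at least `m₁ + 1` and so passes the block at `m₁` without moving
    -- its left end.
    obtain ⟨p, hp, e, m', e', hm', he⟩ := ih
    obtain ⟨p₁, hp₁, m₂, e₂, hm₂, he₂⟩ :=
      h.cupBlock_mul_s hm' (show m₁ + 1 ≤ m₁ + d₁ + 1 by omega) e'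
    obtain ⟨p₃, hp₃, e₃, he₃⟩ := h.cupBlock_mul_crossings_left hp₁ e
    refine ⟨p * p₃, mul_mem hp hp₃, e₃, m₂, e₂, hm₂, ?_⟩
    rw [cupBlock, ← mul_assoc, he, mul_assoc, he₂, mul_assoc, ← mul_assoc _ p₁, he₃]
    simp only [mul_assoc]

/-- Insertion sort. A block that is out of order is exchanged with the first one, the block
resulting on the right is inserted into the tail, and the crossings expelled from the tail pass the
first block with its left end fixed. -/
theorem cupBlock_mul_cupNormal (h : SymmetricSelfAdjunction u n s) {a : ℕ} {x : M}
    (hx : CupNormal u s a x) {m : ℕ} (hm : a ≤ m) (d : ℕ) :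
    ∃ p ∈ crossingsFrom s a, ∃ y, CupNormal u s a y ∧ cupBlock u s m d * x = p * y := by
  induction hx generalizing m d with
  | nil a =>
    exact ⟨1, one_mem _, _, CupNormal.cons d hm (CupNormal.nil _), by rw [one_mul]⟩
  | @cons a m₁ x d₁ ha hx ih =>
    rcases Nat.lt_or_ge m m₁ with h1 | h1
    · exact ⟨1, one_mem _, _, CupNormal.cons d hm (CupNormal.cons d₁ h1 hx), by rw [one_mul]⟩
    · obtain ⟨p, hp, e, m', e', hm', he⟩ := h.cupBlock_mul_cupBlock h1 d d₁
      obtain ⟨p₁, hp₁, y, hy, h2⟩ := ih hm' e'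
      obtain ⟨p₂, hp₂, e₂, he₂⟩ := h.cupBlock_mul_crossings_left hp₁ e
      refine ⟨p * p₂, crossingsFrom_mono ha (mul_mem hp hp₂), _, CupNormal.cons e₂ ha hy, ?_⟩
      rw [← mul_assoc, he, mul_assoc, h2, mul_assoc, ← mul_assoc _ p₁, he₂]
      simp only [mul_assoc]

/-- Products of crossings and cups are products of crossings followed by sorted cup-blocks. -/
theorem exists_cupNormal (h : SymmetricSelfAdjunction u n s) {w : M}
    (hw : w ∈ Submonoid.closure (Set.range u ∪ Set.range s)) :
    ∃ p ∈ crossingsFrom s 0, ∃ y, CupNormal u s 0 y ∧ w = p * y := by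
  induction hw using Submonoid.closure_induction_left with
  | one => exact ⟨1, one_mem _, 1, CupNormal.nil 0, by rw [one_mul]⟩
  | mul_left x hx w _ ih =>
    obtain ⟨p, hp, y, hy, rfl⟩ := ih
    rcases hx with ⟨j, rfl⟩ | ⟨j, rfl⟩
    · obtain ⟨p₁, hp₁, m, e, hm, he⟩ := h.cupBlock_mul_crossings (Nat.zero_le _) hp 0
      obtain ⟨p₂, hp₂, z, hz, h2⟩ := h.cupBlock_mul_cupNormal hy hm e
      refine ⟨p₁ * p₂, mul_mem hp₁ hp₂, z, hz, ?_⟩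
      rw [cupBlock] at he
      rw [← mul_assoc, he, mul_assoc, h2, mul_assoc]
    · exact ⟨s j * p, mul_mem (mem_crossingsFrom (Nat.zero_le _)) hp, y, hy, by rw [mul_assoc]⟩

open MulOpposite in
/-- Products of crossings and caps are sorted cap-blocks followed by crossings. -/
theorem exists_capNormal (h : SymmetricSelfAdjunction u n s) {v : M}
    (hv : v ∈ Submonoid.closure (Set.range n ∪ Set.range s)) :
    ∃ p ∈ crossingsFrom s 0, ∃ L : List (ℕ × ℕ), L.Pairwise (fun p q => q.1 < p.1) ∧
      v = (L.map fun p => capBlock n s p.1 p.2).prod * p := by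
  have hv' : op v ∈ Submonoid.closure
      (Set.range (fun i => op (n i)) ∪ Set.range fun i => op (s i)) := by
    induction hv using Submonoid.closure_induction_left with
    | one => exact one_mem _
    | mul_left x hx w _ ih =>
      rw [op_mul]
      refine mul_mem ih (Submonoid.subset_closure ?_)
      rcases hx with ⟨j, rfl⟩ | ⟨j, rfl⟩
      · exact Or.inl ⟨j, rfl⟩
      · exact Or.inr ⟨j, rfl⟩
  -- In the opposite monoid the caps are cups. Reading the result backwards reverses the list of
  -- blocks.
  obtain ⟨p, hp, y, hy, he⟩ := h.opposite.exists_cupNormal hv'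
  obtain ⟨L, hL, -, rfl⟩ := hy.exists_list
  refine ⟨unop p, ?_, L.reverse, List.pairwise_reverse.2 hL, ?_⟩
  · clear he
    induction hp using Submonoid.closure_induction_left with
    | one => exact one_mem _
    | mul_left x hx w _ ih =>
      obtain ⟨j, -, rfl⟩ := hx
      exact mul_mem ih (mem_crossingsFrom (Nat.zero_le _))
  · apply op_injective
    rw [he, op_mul, op_unop, op_list_prod]
    simp only [List.map_reverse, List.reverse_reverse, List.map_map, Function.comp_def,
      op_capBlock]

/-! #### Circles -/

/-- Insert `s k * s k = 1` between the cup and the cap; `us_succ` and `sn_succ` lower both indices,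
and the two copies of `s (k + 1)` cancel. -/
theorem circle_succ (h : SymmetricSelfAdjunction u n s) (k : ℕ) :
    u (k + 1) * n (k + 1) = u k * n k := by
  have h1 : u (k + 1) * n (k + 1) = u (k + 1) * s k * (s k * n (k + 1)) := by
    rw [mul_assoc, ← mul_assoc (s k), h.s_sq, one_mul]
  rw [h1, h.us_succ, h.sn_succ, mul_assoc, ← mul_assoc (s _), h.s_sq, one_mul]

theorem circle_eq (h : SymmetricSelfAdjunction u n s) (k : ℕ) : u k * n k = u 0 * n 0 := by
  induction k with
  | zero => rfl
  | succ k ih => rw [h.circle_succ, ih]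

/-- By `circle_eq` the index of a circle is free, so it can be chosen such that the commutation
equations carry the circle past a generator of index `j`. The same holds for cups and caps. -/
theorem circle_commute_s (h : SymmetricSelfAdjunction u n s) (j : ℕ) :
    Commute (u 0 * n 0) (s j) := by
  change u 0 * n 0 * s j = s j * (u 0 * n 0)
  rw [← h.circle_eq (j + 2), mul_assoc, ← h.sn₁ le_rfl, ← mul_assoc, h.us₁ le_rfl, mul_assoc]

theorem circle_commute_u (h : SymmetricSelfAdjunction u n s) (j : ℕ) :
    Commute (u 0 * n 0) (u j) := by
  change u 0 * n 0 * u j = u j * (u 0 * n 0)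
  rw [← h.circle_eq j, mul_assoc, ← h.un₂ le_rfl, ← mul_assoc, h.uu le_rfl, mul_assoc,
    h.circle_eq (j + 2), h.circle_eq j]

theorem circle_commute_n (h : SymmetricSelfAdjunction u n s) (j : ℕ) :
    Commute (u 0 * n 0) (n j) := by
  change u 0 * n 0 * n j = n j * (u 0 * n 0)
  rw [← h.circle_eq (j + 2), mul_assoc, ← h.nn le_rfl, ← mul_assoc, h.un₁ le_rfl, mul_assoc,
    h.circle_eq (j + 2), h.circle_eq j]

theorem circle_pow_commute (h : SymmetricSelfAdjunction u n s) {x : M}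
    (hx : x ∈ Submonoid.closure (Set.range u ∪ Set.range n ∪ Set.range s)) (l : ℕ) :
    Commute ((u 0 * n 0) ^ l) x := by
  apply Commute.pow_left
  induction hx using Submonoid.closure_induction_left with
  | one => exact Commute.one_right _
  | mul_left x hx w _ ih =>
    refine Commute.mul_right ?_ ih
    rcases hx with (⟨j, rfl⟩ | ⟨j, rfl⟩) | ⟨j, rfl⟩
    · exact h.circle_commute_u j
    · exact h.circle_commute_n j
    · exact h.circle_commute_s j

/-! #### Cups against caps -/

/-- A product of circles, followed by caps and crossings, followed by at most one cup-block, and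
that only when there are no circles. -/
def IsMixed (u n s : ℕ → M) (z : M) : Prop :=
  ∃ v ∈ Submonoid.closure (Set.range n ∪ Set.range s),
    (∃ l : ℕ, z = (u 0 * n 0) ^ l * v) ∨ ∃ m d, z = v * cupBlock u s m d

theorem s_mem (n s : ℕ → M) (j : ℕ) : s j ∈ Submonoid.closure (Set.range n ∪ Set.range s) :=
  Submonoid.subset_closure (Or.inr ⟨j, rfl⟩)

theorem n_mem (n s : ℕ → M) (j : ℕ) : n j ∈ Submonoid.closure (Set.range n ∪ Set.range s) :=
  Submonoid.subset_closure (Or.inl ⟨j, rfl⟩)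

theorem crossingsFrom_le (n s : ℕ → M) (a : ℕ) :
    crossingsFrom s a ≤ Submonoid.closure (Set.range n ∪ Set.range s) := by
  refine Submonoid.closure_mono ?_
  rintro _ ⟨j, -, rfl⟩
  exact Or.inr ⟨j, rfl⟩

theorem IsMixed.mul_s (h : SymmetricSelfAdjunction u n s) {z : M} (hz : IsMixed u n s z) (j : ℕ) :
    IsMixed u n s (z * s j) := by
  obtain ⟨v, hv, ⟨l, rfl⟩ | ⟨m, d, rfl⟩⟩ := hz
  · exact ⟨v * s j, mul_mem hv (s_mem n s j), Or.inl ⟨l, by rw [mul_assoc]⟩⟩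
  · obtain ⟨p, hp, m', e, -, he⟩ := h.cupBlock_mul_s (Nat.zero_le _) (Nat.zero_le _) d
    exact ⟨v * p, mul_mem hv (crossingsFrom_le n s 0 hp), Or.inr ⟨m', e, by
      rw [mul_assoc, he, mul_assoc]⟩⟩

theorem IsMixed.s_mul (h : SymmetricSelfAdjunction u n s) {z : M} (hz : IsMixed u n s z) (j : ℕ) :
    IsMixed u n s (s j * z) := by
  obtain ⟨v, hv, ⟨l, rfl⟩ | ⟨m, d, rfl⟩⟩ := hz
  · exact ⟨s j * v, mul_mem (s_mem n s j) hv, Or.inl ⟨l, by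
      rw [← mul_assoc, ← mul_assoc, ((h.circle_commute_s j).pow_left l).eq]⟩⟩
  · exact ⟨s j * v, mul_mem (s_mem n s j) hv, Or.inr ⟨m, d, by rw [mul_assoc]⟩⟩

theorem isMixed_one : IsMixed u n s 1 := ⟨1, one_mem _, Or.inl ⟨0, by simp⟩⟩

/-- For a single cup, the cap is far away and passes, is adjacent and cancels, or closes a circle.
For a longer block, the last crossing is absorbed by the cap, is carried to its right, cancels
against the preceding crossing, or leaves the block on the left; each time the cap meets a shorter
block, or a zigzag is straightened. -/
theorem isMixed_cupBlock_mul_n (h : SymmetricSelfAdjunction u n s) (m d j : ℕ) :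
    IsMixed u n s (cupBlock u s m d * n j) := by
  induction d using Nat.strong_induction_on generalizing j with
  | _ d ih =>
  cases d with
  | zero =>
    rw [cupBlock]
    rcases lt_trichotomy j m with h1 | rfl | h1
    · rcases Nat.lt_or_ge (j + 1) m with h2 | h2
      · obtain ⟨m, rfl⟩ : ∃ i, m = i + 2 := ⟨m - 2, by omega⟩
        rw [h.un₁ (by omega)]
        exact ⟨n j, n_mem n s j, Or.inr ⟨m, 0, rfl⟩⟩
      · obtain rfl : m = j + 1 := by omega
        rw [h.succ_un]
        exact isMixed_one
    · exact ⟨1, one_mem _, Or.inl ⟨1, by rw [h.circle_eq j]; simp⟩⟩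
    · rcases Nat.lt_or_ge (m + 1) j with h2 | h2
      · obtain ⟨j, rfl⟩ : ∃ i, j = i + 2 := ⟨j - 2, by omega⟩
        rw [h.un₂ (by omega)]
        exact ⟨n j, n_mem n s j, Or.inr ⟨m, 0, rfl⟩⟩
      · obtain rfl : j = m + 1 := by omega
        rw [h.un_succ]
        exact isMixed_one
  | succ d =>
    rw [cupBlock, mul_assoc]
    have ih' := ih d (by omega)
    rcases Nat.lt_or_ge j (m + d + 1) with h1 | h1
    · rcases Nat.lt_or_ge j (m + d) with h2 | h2
      · obtain ⟨k, hk⟩ : ∃ k, m + d + 1 = k + 2 := ⟨m + d - 1, by omega⟩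
        rw [hk, h.sn₂ (by omega), ← mul_assoc]
        exact (ih' j).mul_s h _
      · obtain rfl : j = m + d := by omega
        rw [← h.sn_succ, ← mul_assoc]
        cases d with
        | zero =>
          rw [cupBlock, Nat.add_zero, h.us, h.un_succ]
          exact isMixed_one
        | succ d =>
          -- Two crossings disappear at once, hence the strong induction.
          rw [← add_assoc, h.cupBlock_mul_last]
          exact ih d (by omega) _
    · rcases Nat.lt_or_ge (m + d + 2) j with h2 | h2
      · obtain ⟨k, rfl⟩ : ∃ k, j = k + 2 := ⟨j - 2, by omega⟩
        rw [h.sn₁ (by omega), ← mul_assoc]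
        exact (ih' _).mul_s h _
      · obtain h3 | h3 : j = m + d + 1 ∨ j = m + d + 2 := by omega
        · rw [h3, h.sn]
          exact ih' _
        -- The crossing now exchanges points beyond the right end of the shorter block, so it leaves
        -- on the left with index lowered by two.
        · rw [h3, h.sn_succ (m + d + 1), ← mul_assoc, h.cupBlock_mul_of_gt le_rfl, mul_assoc]
          exact (ih' _).s_mul h _

/-- A product of circles, followed by caps and crossings, followed by crossings and cups. -/
def IsFactored (u n s : ℕ → M) (z : M) : Prop :=
  ∃ l : ℕ, ∃ v ∈ Submonoid.closure (Set.range n ∪ Set.range s),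
    ∃ w ∈ Submonoid.closure (Set.range u ∪ Set.range s), z = (u 0 * n 0) ^ l * v * w

theorem IsFactored.mul_right {z w : M} (hz : IsFactored u n s z)
    (hw : w ∈ Submonoid.closure (Set.range u ∪ Set.range s)) : IsFactored u n s (z * w) := by
  obtain ⟨l, v, hv, w', hw', rfl⟩ := hz
  exact ⟨l, v, hv, w' * w, mul_mem hw' hw, by simp only [mul_assoc]⟩

theorem mem_of_caps {v : M} (hv : v ∈ Submonoid.closure (Set.range n ∪ Set.range s)) :
    v ∈ Submonoid.closure (Set.range u ∪ Set.range n ∪ Set.range s) :=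
  Submonoid.closure_mono (Set.union_subset_union_left _ Set.subset_union_right) hv

theorem mem_of_cups {v : M} (hv : v ∈ Submonoid.closure (Set.range u ∪ Set.range s)) :
    v ∈ Submonoid.closure (Set.range u ∪ Set.range n ∪ Set.range s) :=
  Submonoid.closure_mono (Set.union_subset_union_left _ Set.subset_union_left) hv

theorem IsFactored.mul_left (h : SymmetricSelfAdjunction u n s) {z v : M}
    (hz : IsFactored u n s z) (hv : v ∈ Submonoid.closure (Set.range n ∪ Set.range s)) :
    IsFactored u n s (v * z) := by
  obtain ⟨l, v', hv', w, hw, rfl⟩ := hz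
  refine ⟨l, v * v', mul_mem hv hv', w, hw, ?_⟩
  simp only [← mul_assoc]
  rw [(h.circle_pow_commute (mem_of_caps hv) l).eq]

theorem IsFactored.circle_mul {z : M} (hz : IsFactored u n s z) (k : ℕ) :
    IsFactored u n s ((u 0 * n 0) ^ k * z) := by
  obtain ⟨l, v, hv, w, hw, rfl⟩ := hz
  exact ⟨k + l, v, hv, w, hw, by rw [pow_add]; simp only [mul_assoc]⟩

theorem isFactored_of_mem {v : M} (hv : v ∈ Submonoid.closure (Set.range n ∪ Set.range s)) :
    IsFactored u n s v := ⟨0, v, hv, 1, one_mem _, by simp⟩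

/-- Past each factor of `v` the block either survives as a single block, so that the induction
continues, or dissolves into circles, caps and crossings, so that nothing is left to move. This is
why `IsMixed` admits at most one cup-block. -/
theorem isFactored_cupBlock_mul (h : SymmetricSelfAdjunction u n s) {v : M}
    (hv : v ∈ Submonoid.closure (Set.range n ∪ Set.range s)) (m d : ℕ) :
    IsFactored u n s (cupBlock u s m d * v) := by
  induction hv using Submonoid.closure_induction_left generalizing m d with
  | one =>
    refine ⟨0, 1, one_mem _, cupBlock u s m d, ?_, by simp⟩
    induction d with
    | zero => exact Submonoid.subset_closure (Or.inl ⟨m, rfl⟩)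
    | succ d ih => exact mul_mem ih (Submonoid.subset_closure (Or.inr ⟨_, rfl⟩))
  | mul_left x hx v hv ih =>
    rw [← mul_assoc]
    rcases hx with ⟨j, rfl⟩ | ⟨j, rfl⟩
    · obtain ⟨v', hv', ⟨l, he⟩ | ⟨m', d', he⟩⟩ := h.isMixed_cupBlock_mul_n m d j
      · rw [he, mul_assoc]
        exact (isFactored_of_mem (mul_mem hv' hv)).circle_mul l
      · rw [he, mul_assoc]
        exact (ih m' d').mul_left h hv'
    · obtain ⟨p, hp, m', e, -, he⟩ := h.cupBlock_mul_s (Nat.zero_le _) (Nat.zero_le _) d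
      rw [he, mul_assoc]
      exact (ih m' e).mul_left h (crossingsFrom_le n s 0 hp)

/-- The rightmost cup of `w` is moved through `v`. The caps and crossings that come out on its left
are moved past the rest of `w` by induction, the cups stay on the right, and circles are central. A
rightmost crossing is simply counted into `v`. -/
theorem isFactored_mul (h : SymmetricSelfAdjunction u n s) {w : M}
    (hw : w ∈ Submonoid.closure (Set.range u ∪ Set.range s)) {v : M}
    (hv : v ∈ Submonoid.closure (Set.range n ∪ Set.range s)) : IsFactored u n s (w * v) := by
  induction hw using Submonoid.closure_induction_right generalizing v with
  | one => rw [one_mul]; exact isFactored_of_mem hv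
  | mul_right w hw x hx ih =>
    rw [mul_assoc]
    rcases hx with ⟨j, rfl⟩ | ⟨j, rfl⟩
    · obtain ⟨l, v', hv', w', hw', he⟩ := h.isFactored_cupBlock_mul hv j 0
      rw [cupBlock] at he
      rw [he, mul_assoc, ← mul_assoc, ← (h.circle_pow_commute (mem_of_cups hw) l).eq, mul_assoc,
        ← mul_assoc w]
      exact ((ih hv').mul_right hw').circle_mul l
    · exact ih (mul_mem (s_mem n s j) hv)

theorem isFactored (h : SymmetricSelfAdjunction u n s) {z : M}
    (hz : z ∈ Submonoid.closure (Set.range u ∪ Set.range n ∪ Set.range s)) :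
    IsFactored u n s z := by
  induction hz using Submonoid.closure_induction_right with
  | one => exact isFactored_of_mem (one_mem _)
  | mul_right z _ x hx ih =>
    rcases hx with (⟨j, rfl⟩ | ⟨j, rfl⟩) | ⟨j, rfl⟩
    · exact ih.mul_right (Submonoid.subset_closure (Or.inl ⟨j, rfl⟩))
    · obtain ⟨l, v, hv, w, hw, rfl⟩ := ih
      rw [mul_assoc, mul_assoc]
      exact ((h.isFactored_mul hw (n_mem n s j)).mul_left h hv).circle_mul l
    · exact ih.mul_right (Submonoid.subset_closure (Or.inr ⟨j, rfl⟩))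

/-- Every element of the monoid has a normal form. -/
theorem exists_normalForm (h : SymmetricSelfAdjunction u n s) {z : M}
    (hz : z ∈ Submonoid.closure (Set.range u ∪ Set.range n ∪ Set.range s)) :
    ∃ (l : ℕ) (caps crosses cups : List (ℕ × ℕ)), caps.Pairwise (fun p q => q.1 < p.1) ∧
      crosses.Pairwise (fun p q => p.1 + p.2 < q.1 + q.2) ∧
      cups.Pairwise (fun p q => p.1 < q.1) ∧
      z = (u 0 * n 0) ^ l * (caps.map fun p => capBlock n s p.1 p.2).prod *
        (crosses.map fun p => crossBlock s p.1 p.2).prod *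
        (cups.map fun p => cupBlock u s p.1 p.2).prod := by
  obtain ⟨l, v, hv, w, hw, rfl⟩ := h.isFactored hz
  obtain ⟨p, hp, caps, hcaps, rfl⟩ := h.exists_capNormal hv
  obtain ⟨q, hq, y, hy, rfl⟩ := h.exists_cupNormal hw
  obtain ⟨cups, hcups, -, rfl⟩ := hy.exists_list
  -- The crossings left over by the caps and by the cups meet in the middle and are sorted together.
  obtain ⟨b, hb⟩ := h.exists_crossNormal (mul_mem hp hq)
  obtain ⟨crosses, hcrosses, -, he⟩ := hb.exists_list
  refine ⟨l, caps, crosses, cups, hcaps, hcrosses, hcups, ?_⟩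
  rw [← he]
  simp only [mul_assoc]

end SymmetricSelfAdjunction

namespace SJDiagram

/-! ### Uniqueness of normal forms -/

section Uniqueness

attribute [local instance] SJDiagram.monoid

/-- The cup diagrams, counted from `0`. -/
abbrev cups (k : ℕ) : SJDiagram := cup k.succPNat

/-- The cap diagrams, counted from `0`. -/
abbrev caps (k : ℕ) : SJDiagram := cap k.succPNat

/-- The crossing diagrams, counted from `0`. -/
abbrev crossings (k : ℕ) : SJDiagram := crossing k.succPNat

/-! ### Cup-blocks and the threads between top points -/

/-- The increasing map whose range misses `m` and `m + d + 1`. -/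
def skipTwo (m d n : ℕ) : ℕ := if n < m then n else if n < m + d then n + 1 else n + 2

/-- The colors `z` of the points other than `m` and `m + d + 1`, which get the color `c`. -/
def fillTwo (m d : ℕ) (c : Bool) (z : ℕ → Bool) (n : ℕ) : Bool :=
  if n = m ∨ n = m + d + 1 then c else if n < m then z n else if n < m + d + 1 then z (n - 1)
  else z (n - 2)

/-- Each crossing in the block moves the right end of the cup one place further and keeps all points
off the cup in order. -/
theorem rel_cupBlock {m d : ℕ} {x y : ℕ → Bool} : (cupBlock cups crossings m d).Rel x y ↔
    x m = x (m + d + 1) ∧ ∀ n, y n = x (skipTwo m d n) := by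
  induction d generalizing x y with
  | zero =>
    refine rel_cup.trans (and_congr Iff.rfl (forall_congr' fun n => ?_))
    have : skipTwo m 0 n = skip m n := by
      simp only [skip, skipTwo]
      split_ifs <;> omega
    rw [this]
  | succ d ih =>
    have hs : ∀ n, flipAt (m + d + 1) (skipTwo m d n) = skipTwo m (d + 1) n := by
      intro n
      simp only [flipAt, skipTwo]
      split_ifs <;> omega
    have h1 : flipAt (m + d + 1) m = m := by
      simp only [flipAt]
      split_ifs <;> omega
    have h2 : flipAt (m + d + 1) (m + d + 1) = m + (d + 1) + 1 := by
      simp only [flipAt]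
      split_ifs <;> omega
    refine rel_mul.trans ⟨?_, fun h => ⟨fun n => x (flipAt (m + d + 1) n),
      rel_crossing.2 fun n => rfl, ih.2 ⟨?_, fun n => ?_⟩⟩⟩
    · rintro ⟨z, hz, hy⟩
      rw [rel_crossing] at hz
      obtain ⟨h3, h4⟩ := ih.1 hy
      refine ⟨?_, fun n => ?_⟩
      · rwa [hz, hz, h1, h2] at h3
      · rw [h4, hz, hs]
    · rw [h1, h2]
      exact h.1
    · rw [hs]
      exact h.2 n

/-- The color of the cup itself is free. Choosing it different from the colors elsewhere is the test
that tells threads apart below. -/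
theorem rel_fillTwo (m d : ℕ) (c : Bool) (z : ℕ → Bool) :
    (cupBlock cups crossings m d).Rel (fillTwo m d c z) z := by
  refine rel_cupBlock.2 ⟨by simp [fillTwo], fun n => ?_⟩
  simp only [fillTwo, skipTwo]
  split_ifs <;> first | omega | rfl

theorem rel_mul_fillTwo {D : SJDiagram} {z y : ℕ → Bool} (h : D.Rel z y) (m d : ℕ) (c : Bool) :
    (D * cupBlock cups crossings m d).Rel (fillTwo m d c z) y :=
  rel_mul.2 ⟨z, rel_fillTwo m d c z, h⟩

/-- Every coloring below a cup-block has one above it, which in turn determines the coloring below;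
so cup-blocks can be cancelled. -/
theorem eq_of_mul_cupBlock_eq {D D' : SJDiagram} {m d : ℕ}
    (h : D * cupBlock cups crossings m d = D' * cupBlock cups crossings m d) : D = D' := by
  refine eq_of_rel_imp fun z y hz => ?_
  have h1 := rel_mul_fillTwo hz m d false
  rw [h] at h1
  obtain ⟨w, hw, hy⟩ := rel_mul.1 h1
  have : w = z := by
    funext n
    rw [(rel_cupBlock.1 hw).2, (rel_cupBlock.1 (rel_fillTwo m d false z)).2]
  rwa [← this]

/-- The threads between points of the top line have a left end before `a`. -/
def TopThreadsBefore (D : SJDiagram) (a : ℕ) : Prop :=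
  ∀ i j, i < j → (∀ x y, D.Rel x y → x i = x j) → i < a

theorem TopThreadsBefore.mono {D : SJDiagram} {a b : ℕ} (h : D.TopThreadsBefore a) (hab : a ≤ b) :
    D.TopThreadsBefore b := fun i j hij hD => (h i j hij hD).trans_le hab

/-- The color `true` on the new cup and `false` elsewhere excludes a thread that shares exactly one
end with the cup. Any other top thread with left end after `m` comes, once the two ends of the cup
are removed, from a top thread of `D` with left end at least `m`. -/
theorem TopThreadsBefore.mul {D : SJDiagram} {m : ℕ} (h : D.TopThreadsBefore m) (d : ℕ) :
    (D * cupBlock cups crossings m d).TopThreadsBefore (m + 1) := by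
  intro i j hij hD
  by_contra hi
  have h1 := hD _ _ (rel_mul_fillTwo (D.rel_const false) m d true)
  by_cases hi' : i = m + d + 1
  · have e1 : ¬ (j = m ∨ j = m + d + 1) := by omega
    simp [fillTwo, hi', e1] at h1
  by_cases hj' : j = m + d + 1
  · have e1 : ¬ (i = m ∨ i = m + d + 1) := by omega
    simp [fillTwo, hj', e1] at h1
  have key := h (if i < m + d + 1 then i - 1 else i - 2) (if j < m + d + 1 then j - 1 else j - 2)
    (by split_ifs <;> omega) (fun z y hz => by
      have h2 := hD _ _ (rel_mul_fillTwo hz m d true)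
      have e1 : ¬ (i = m ∨ i = m + d + 1) := by omega
      have e2 : ¬ (j = m ∨ j = m + d + 1) := by omega
      have e3 : ¬ i < m := by omega
      have e4 : ¬ j < m := by omega
      simp only [fillTwo, e1, e2, e3, e4, if_false] at h2
      split_ifs at h2 ⊢ <;> exact h2)
  split_ifs at key <;> omega

/-! ### Total diagrams and recovery of the cup-blocks -/

/-- Every coloring of the top line extends to a coloring. -/
def Total (D : SJDiagram) : Prop := ∀ x, ∃ y, D.Rel x y

theorem Total.mul {D₂ D₁ : SJDiagram} (h₂ : D₂.Total) (h₁ : D₁.Total) : (D₂ * D₁).Total := by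
  intro x
  obtain ⟨z, hz⟩ := h₁ x
  obtain ⟨y, hy⟩ := h₂ z
  exact ⟨y, rel_mul.2 ⟨z, hz, hy⟩⟩

theorem total_one : (1 : SJDiagram).Total := fun x => ⟨x, rel_one.2 rfl⟩

theorem total_crossings (k : ℕ) : (crossings k).Total := fun _ => ⟨_, rel_crossing.2 fun _ => rfl⟩

/-- The relation of a cap is that of a cup with the lines exchanged, so the filling made for cups is
the coloring needed. -/
theorem total_caps (k : ℕ) : (caps k).Total := fun x =>
  ⟨fillTwo k 0 false x, rel_cap.2 (rel_cup.1 (rel_fillTwo k 0 false x))⟩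

theorem total_list_prod {L : List SJDiagram} (h : ∀ D ∈ L, D.Total) : L.prod.Total := by
  induction L with
  | nil => exact total_one
  | cons D L ih =>
    rw [List.prod_cons]
    exact (h D (by simp)).mul (ih fun D' hD' => h D' (by simp [hD']))

theorem total_capBlock (m d : ℕ) : (capBlock caps crossings m d).Total := by
  induction d with
  | zero => exact total_caps m
  | succ d ih => exact (total_crossings _).mul ih

theorem total_crossBlock (m d : ℕ) : (crossBlock crossings m d).Total := by
  induction d with
  | zero => exact total_crossings m
  | succ d ih => exact (total_crossings _).mul ih

/-- A thread between two top points would forbid the coloring that is `true` at just one of them; a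
total diagram therefore has no such thread. -/
theorem Total.topThreadsBefore {D : SJDiagram} (h : D.Total) : D.TopThreadsBefore 0 := by
  intro i j hij hD
  obtain ⟨y, hy⟩ := h fun n => decide (n = i)
  have := hD _ _ hy
  simp [hij.ne'] at this

theorem topThreadsBefore_mul_prod {D : SJDiagram} (h : D.Total) {L : List (ℕ × ℕ)}
    (hL : L.Pairwise fun p q => p.1 < q.1) {b : ℕ} (hb : ∀ p ∈ L, p.1 < b) :
    (D * (L.map fun p => cupBlock cups crossings p.1 p.2).prod).TopThreadsBefore b := by
  induction L using List.reverseRecOn generalizing b with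
  | nil =>
    rw [List.map_nil, List.prod_nil, mul_one]
    exact h.topThreadsBefore.mono (Nat.zero_le _)
  | append_singleton L p ih =>
    rw [List.map_append, List.prod_append, ← mul_assoc, List.map_singleton, List.prod_singleton]
    rw [List.pairwise_append] at hL
    exact ((ih hL.1 fun q hq => hL.2.2 q hq p (by simp)).mul p.2).mono (hb p (by simp))

/-- As `D` and `D'` are total, top threads come from the blocks only, and the last block is the top
thread with the largest left end. Hence the last blocks have the same left end, and a coloring that
is `true` only on one of them shows that the right ends agree too. The common block is cancelled,
and the induction goes on. -/
theorem eq_of_mul_cups_eq {D D' : SJDiagram} (hD : D.Total) (hD' : D'.Total)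
    {L L' : List (ℕ × ℕ)} (hL : L.Pairwise fun p q => p.1 < q.1)
    (hL' : L'.Pairwise fun p q => p.1 < q.1)
    (h : D * (L.map fun p => cupBlock cups crossings p.1 p.2).prod =
      D' * (L'.map fun p => cupBlock cups crossings p.1 p.2).prod) : L = L' ∧ D = D' := by
  have empty : ∀ {D D' : SJDiagram} {L : List (ℕ × ℕ)} {p : ℕ × ℕ}, D'.Total →
      D * ((L ++ [p]).map fun p => cupBlock cups crossings p.1 p.2).prod ≠ D' := by
    rintro D D' L p hD' rfl
    refine absurd (hD'.topThreadsBefore p.1 (p.1 + p.2 + 1) (by omega) fun x y hxy => ?_) (by omega)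
    rw [List.map_append, List.prod_append, ← mul_assoc, List.map_singleton,
      List.prod_singleton] at hxy
    obtain ⟨z, hz, -⟩ := rel_mul.1 hxy
    exact (rel_cupBlock.1 hz).1
  induction L using List.reverseRecOn generalizing L' with
  | nil =>
    rcases L'.eq_nil_or_concat with rfl | ⟨L', p, rfl⟩
    · simpa using h
    · rw [List.map_nil, List.prod_nil, mul_one, List.concat_eq_append] at h
      exact absurd h.symm (empty hD)
  | append_singleton L p ih =>
    rcases L'.eq_nil_or_concat with rfl | ⟨L', p', rfl⟩
    · rw [List.map_nil, List.prod_nil, mul_one] at h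
      exact absurd h (empty hD')
    rw [List.concat_eq_append] at h hL' ⊢
    rw [List.pairwise_append] at hL hL'
    simp only [List.map_append, List.prod_append, ← mul_assoc, List.map_singleton,
      List.prod_singleton] at h
    have b := (topThreadsBefore_mul_prod hD hL.1 fun q hq => hL.2.2 q hq p (by simp)).mul p.2
    have b' := (topThreadsBefore_mul_prod hD' hL'.1 fun q hq => hL'.2.2 q hq p' (by simp)).mul p'.2
    have t : ∀ (X : SJDiagram) (q : ℕ × ℕ) x y,
        (X * cupBlock cups crossings q.1 q.2).Rel x y → x q.1 = x (q.1 + q.2 + 1) := by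
      intro X q x y hxy
      obtain ⟨z, hz, -⟩ := rel_mul.1 hxy
      exact (rel_cupBlock.1 hz).1
    -- The cup of each last block is a thread on both sides, so each of the two left ends is bounded
    -- by the other.
    have h1 := b' p.1 (p.1 + p.2 + 1) (by omega) fun x y hxy => by
      rw [← h] at hxy
      exact t _ p x y hxy
    have h2 := b p'.1 (p'.1 + p'.2 + 1) (by omega) fun x y hxy => by
      rw [h] at hxy
      exact t _ p' x y hxy
    have h3 : p.1 = p'.1 := by omega
    have h4 : p.2 = p'.2 := by
      by_contra hne
      have h5 := rel_mul_fillTwo (rel_const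
        (D * (L.map fun p => cupBlock cups crossings p.1 p.2).prod) false) p.1 p.2 true
      rw [h] at h5
      have h6 := t _ p' _ _ h5
      rw [← h3] at h6
      have e : ¬ (p.1 + p'.2 + 1 = p.1 ∨ p.1 + p'.2 + 1 = p.1 + p.2 + 1) := by omega
      simp [fillTwo] at h6
      omega
    obtain rfl : p = p' := Prod.ext h3 h4
    obtain ⟨rfl, hDD⟩ := ih hL.1 hL'.1 (eq_of_mul_cupBlock_eq h)
    exact ⟨rfl, hDD⟩

/-! ### Reflection of diagrams -/

/-- The diagram upside down. -/
def upsideDown (D : SJDiagram) : SJDiagram where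
  mate a := (D.mate a.opp).opp
  mate_mate a := by simp [NZInt.opp, D.mate_mate]
  mate_ne a h := D.mate_ne a.opp (Subtype.ext (by
    have := congrArg Subtype.val h
    simp only [NZInt.opp] at this ⊢
    omega))
  exists_type := by
    obtain ⟨n, m, h⟩ := D.exists_type
    refine ⟨m, n, fun k a ha => ?_⟩
    have hn := n.pos
    have h0 : (n : ℤ) + k ≠ 0 := by omega
    have h1 : D.mate ⟨n + k, h0⟩ = a.opp :=
      Subtype.ext (by rw [h k _ rfl]; simp [NZInt.opp, ha])
    simp only [NZInt.opp] at h1 ⊢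
    rw [← h1, D.mate_mate]

theorem rel_upsideDown {D : SJDiagram} {x y : ℕ → Bool} : D.upsideDown.Rel x y ↔ D.Rel y x := by
  have key : ∀ (x y : ℕ → Bool) (a : NZInt), joinCol x y a.opp = joinCol y x a := by
    intro x y a
    rcases a.eq_top_or_eq_bot with ⟨i, rfl⟩ | ⟨i, rfl⟩
    · exact (joinCol_bot x y i).trans (joinCol_top y x i).symm
    · have : (NZInt.bot i).opp = NZInt.top i := Subtype.ext (neg_neg _)
      rw [this, joinCol_bot, joinCol_top]
  have hoo : ∀ a : NZInt, a.opp.opp = a := fun a => Subtype.ext (neg_neg _)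
  constructor
  · intro h a
    have := h a.opp
    change joinCol x y (D.mate a.opp.opp).opp = _ at this
    rwa [key, key, hoo] at this
  · intro h a
    change joinCol x y (D.mate a.opp).opp = _
    rw [key, h, key]

theorem upsideDown_mul (D₂ D₁ : SJDiagram) :
    (D₂ * D₁).upsideDown = D₁.upsideDown * D₂.upsideDown := by
  refine eq_of_rel_imp fun x y h => ?_
  obtain ⟨z, h₁, h₂⟩ := rel_mul.1 (rel_upsideDown.1 h)
  exact rel_mul.2 ⟨z, rel_upsideDown.2 h₂, rel_upsideDown.2 h₁⟩

theorem upsideDown_injective {D D' : SJDiagram} (h : D.upsideDown = D'.upsideDown) : D = D' :=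
  eq_of_rel_imp fun x y hxy => by
    rw [← rel_upsideDown, ← h, rel_upsideDown]
    exact hxy

theorem upsideDown_one : (1 : SJDiagram).upsideDown = 1 :=
  eq_of_rel_imp fun _ _ hxy => rel_one.2 (rel_one.1 (rel_upsideDown.1 hxy)).symm

theorem upsideDown_caps (k : ℕ) : (caps k).upsideDown = cups k :=
  eq_of_rel_imp fun _ _ hxy => rel_cup.2 (rel_cap.1 (rel_upsideDown.1 hxy))

theorem upsideDown_crossings (k : ℕ) : (crossings k).upsideDown = crossings k :=
  eq_of_rel_imp fun _ _ hxy => rel_crossing'.2 (rel_crossing.1 (rel_upsideDown.1 hxy))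

theorem upsideDown_capBlock (m d : ℕ) :
    (capBlock caps crossings m d).upsideDown = cupBlock cups crossings m d := by
  induction d with
  | zero => exact upsideDown_caps m
  | succ d ih => rw [capBlock, upsideDown_mul, ih, upsideDown_crossings, cupBlock]

theorem upsideDown_capBlocks (L : List (ℕ × ℕ)) :
    (L.map fun p => capBlock caps crossings p.1 p.2).prod.upsideDown =
      (L.reverse.map fun p => cupBlock cups crossings p.1 p.2).prod := by
  induction L with
  | nil => exact upsideDown_one
  | cons p L ih => simp [upsideDown_mul, ih, upsideDown_capBlock]

/-! ### Crossing-blocks and their permutations -/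

theorem total_upsideDown_crossBlock (l d : ℕ) : (crossBlock crossings l d).upsideDown.Total := by
  induction d with
  | zero => rw [crossBlock, upsideDown_crossings]; exact total_crossings l
  | succ d ih =>
    rw [crossBlock, upsideDown_mul, upsideDown_crossings]
    exact ih.mul (total_crossings _)

theorem total_upsideDown_crossBlocks (L : List (ℕ × ℕ)) :
    (L.map fun p => crossBlock crossings p.1 p.2).prod.upsideDown.Total := by
  induction L with
  | nil => exact upsideDown_one ▸ total_one
  | cons p L ih =>
    rw [List.map_cons, List.prod_cons, upsideDown_mul]
    exact ih.mul (total_upsideDown_crossBlock _ _)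

theorem total_crossBlocks (L : List (ℕ × ℕ)) :
    (L.map fun p => crossBlock crossings p.1 p.2).prod.Total :=
  total_list_prod fun D hD => by
    obtain ⟨p, -, rfl⟩ := List.mem_map.1 hD
    exact total_crossBlock _ _

/-- Two facts about the permutation are enough to recover the block: where the top point `l` goes,
and that nothing beyond `l + d + 1` moves. -/
theorem rel_crossBlock {l d : ℕ} {x y : ℕ → Bool} (h : (crossBlock crossings l d).Rel x y) :
    y (l + d + 1) = x l ∧ ∀ n, l + d + 1 < n → y n = x n := by
  induction d generalizing y with
  | zero =>
    have h1 := rel_crossing.1 (show (crossing l.succPNat).Rel x y from h)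
    refine ⟨?_, fun n hn => ?_⟩
    · rw [h1]
      simp [flipAt]
    · rw [h1]
      congr 1
      simp only [flipAt]
      split_ifs <;> omega
  | succ d ih =>
    obtain ⟨z, hz, hy⟩ := rel_mul.1 (show
      (crossing (l + d + 1).succPNat * crossBlock crossings l d).Rel x y from h)
    obtain ⟨h1, h2⟩ := ih hz
    rw [rel_crossing] at hy
    refine ⟨?_, fun n hn => ?_⟩
    · rw [hy, ← h1]
      congr 1
      simp only [flipAt]
      split_ifs <;> omega
    · rw [hy, ← h2 n (by omega)]
      congr 1
      simp only [flipAt]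
      split_ifs <;> omega

theorem isUnit_crossBlock (l d : ℕ) : IsUnit (crossBlock crossings l d) := by
  have hs : ∀ k, IsUnit (crossings k) := fun k =>
    ⟨⟨crossings k, crossings k, crossing_mul_self k, crossing_mul_self k⟩, rfl⟩
  induction d with
  | zero => exact hs l
  | succ d ih => exact (hs _).mul ih

theorem rel_crossBlocks {L : List (ℕ × ℕ)} {b : ℕ} (hb : ∀ p ∈ L, p.1 + p.2 + 1 < b)
    {x y : ℕ → Bool} (h : (L.map fun p => crossBlock crossings p.1 p.2).prod.Rel x y) {i : ℕ}
    (hi : b ≤ i) : y i = x i := by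
  induction L generalizing y with
  | nil => rw [rel_one.1 h]
  | cons p L ih =>
    rw [List.map_cons, List.prod_cons] at h
    obtain ⟨z, hz, hy⟩ := rel_mul.1 h
    rw [← ih (fun q hq => hb q (by simp [hq])) hz]
    exact (rel_crossBlock hy).2 i ((hb p (by simp)).trans_le hi)

/-- The last block shows in the diagram of a product of crossing-blocks. -/
theorem last_crossBlock {L : List (ℕ × ℕ)} {p : ℕ × ℕ}
    (hL : ∀ q ∈ L, q.1 + q.2 < p.1 + p.2) {x y : ℕ → Bool}
    (h : ((L ++ [p]).map fun p => crossBlock crossings p.1 p.2).prod.Rel x y) :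
    y (p.1 + p.2 + 1) = x p.1 := by
  rw [List.map_append, List.prod_append, List.map_singleton, List.prod_singleton] at h
  obtain ⟨z, hz, hy⟩ := rel_mul.1 h
  rw [← (rel_crossBlock hz).1]
  exact rel_crossBlocks (fun q hq => by have := hL q hq; omega) hy le_rfl

/-- The last block `p` sends the top point `p.1` to the bottom point `p.1 + p.2 + 1`, and no other
block touches that point. A product whose blocks all have smaller sums fixes it, so the sums of the
last blocks agree; the top point connected to it then gives `p.1`. Crossing-blocks are invertible,
so the last block can be cancelled. -/
theorem eq_of_crossBlocks_eq {L L' : List (ℕ × ℕ)}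
    (hL : L.Pairwise fun p q => p.1 + p.2 < q.1 + q.2)
    (hL' : L'.Pairwise fun p q => p.1 + p.2 < q.1 + q.2)
    (h : (L.map fun p => crossBlock crossings p.1 p.2).prod =
      (L'.map fun p => crossBlock crossings p.1 p.2).prod) : L = L' := by
  have smaller : ∀ {L L' : List (ℕ × ℕ)} {p : ℕ × ℕ},
      (∀ q ∈ L', q.1 + q.2 < p.1 + p.2) → (∀ q ∈ L, q.1 + q.2 < p.1 + p.2) →
      (L.map fun p => crossBlock crossings p.1 p.2).prod ≠
      ((L' ++ [p]).map fun p => crossBlock crossings p.1 p.2).prod := by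
    intro L L' p hL' hL h
    obtain ⟨y, hy⟩ := total_crossBlocks L fun i => decide (i = p.1)
    have h1 := rel_crossBlocks (b := p.1 + p.2 + 1) (fun q hq => by have := hL q hq; omega) hy le_rfl
    rw [h] at hy
    have h2 := last_crossBlock hL' hy
    rw [h1] at h2
    simp at h2
    omega
  induction L using List.reverseRecOn generalizing L' with
  | nil =>
    rcases L'.eq_nil_or_concat with rfl | ⟨L', p', rfl⟩
    · rfl
    · rw [List.concat_eq_append] at h hL'
      rw [List.pairwise_append] at hL'
      exact absurd h (smaller (fun q hq => hL'.2.2 q hq p' (by simp)) (by simp))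
  | append_singleton L p ih =>
    rw [List.pairwise_append] at hL
    have hp : ∀ q ∈ L, q.1 + q.2 < p.1 + p.2 := fun q hq => hL.2.2 q hq p (by simp)
    rcases L'.eq_nil_or_concat with rfl | ⟨L', p', rfl⟩
    · exact absurd h.symm (smaller hp (by simp))
    rw [List.concat_eq_append] at h hL' ⊢
    rw [List.pairwise_append] at hL'
    have hp' : ∀ q ∈ L', q.1 + q.2 < p'.1 + p'.2 := fun q hq => hL'.2.2 q hq p' (by simp)
    have h1 : p.1 + p.2 = p'.1 + p'.2 := by
      rcases lt_trichotomy (p.1 + p.2) (p'.1 + p'.2) with h1 | h1 | h1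
      · refine absurd h (smaller hp' fun q hq => ?_)
        rcases List.mem_append.1 hq with hq | hq
        · exact (hp q hq).trans h1
        · rwa [List.mem_singleton.1 hq]
      · exact h1
      · refine absurd h.symm (smaller hp fun q hq => ?_)
        rcases List.mem_append.1 hq with hq | hq
        · exact (hp' q hq).trans h1
        · rwa [List.mem_singleton.1 hq]
    have h2 : p.1 = p'.1 := by
      obtain ⟨y, hy⟩ := total_crossBlocks (L ++ [p]) fun i => decide (i = p.1)
      have h3 := last_crossBlock hp hy
      rw [h] at hy
      have h4 := last_crossBlock hp' hy
      rw [← h1, h3] at h4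
      simpa [eq_comm] using h4
    obtain rfl : p = p' := Prod.ext h2 (by omega)
    rw [ih hL.1 hL'.1]
    simp only [List.map_append, List.prod_append, List.map_singleton, List.prod_singleton] at h
    exact (isUnit_crossBlock _ _).mul_right_cancel h

/-- The diagram of a normal form without circles determines the normal form. -/
theorem normalForm_unique {A P B A' P' B' : List (ℕ × ℕ)}
    (hA : A.Pairwise fun p q => q.1 < p.1) (hA' : A'.Pairwise fun p q => q.1 < p.1)
    (hP : P.Pairwise fun p q => p.1 + p.2 < q.1 + q.2)
    (hP' : P'.Pairwise fun p q => p.1 + p.2 < q.1 + q.2)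
    (hB : B.Pairwise fun p q => p.1 < q.1) (hB' : B'.Pairwise fun p q => p.1 < q.1)
    (h : (A.map fun p => capBlock caps crossings p.1 p.2).prod *
      (P.map fun p => crossBlock crossings p.1 p.2).prod *
      (B.map fun p => cupBlock cups crossings p.1 p.2).prod =
      (A'.map fun p => capBlock caps crossings p.1 p.2).prod *
      (P'.map fun p => crossBlock crossings p.1 p.2).prod *
      (B'.map fun p => cupBlock cups crossings p.1 p.2).prod) : A = A' ∧ P = P' ∧ B = B' := by
  have tot : ∀ A P : List (ℕ × ℕ), ((A.map fun p => capBlock caps crossings p.1 p.2).prod *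
      (P.map fun p => crossBlock crossings p.1 p.2).prod).Total := fun A P =>
    (total_list_prod fun D hD => by
      obtain ⟨p, -, rfl⟩ := List.mem_map.1 hD
      exact total_capBlock _ _).mul (total_crossBlocks P)
  -- The caps and crossings form a total diagram, so the cups can be peeled off first.
  obtain ⟨hBB, h1⟩ := eq_of_mul_cups_eq (tot A P) (tot A' P') hB hB' h
  -- Upside down, the caps become cups to the right of a total product of crossings, in reversed
  -- order, and are peeled off in the same way.
  have h2 := congrArg upsideDown h1
  rw [upsideDown_mul, upsideDown_mul, upsideDown_capBlocks, upsideDown_capBlocks] at h2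
  obtain ⟨hAA, h3⟩ := eq_of_mul_cups_eq (total_upsideDown_crossBlocks P)
    (total_upsideDown_crossBlocks P') (List.pairwise_reverse.2 hA) (List.pairwise_reverse.2 hA') h2
  exact ⟨List.reverse_injective hAA, eq_of_crossBlocks_eq hP hP' (upsideDown_injective h3), hBB⟩

end Uniqueness

end SJDiagram

namespace SJDiagram

/-! ### Generation -/

section Generation

attribute [local instance] SJDiagram.monoid

/-- The submonoid generated by the cup, cap and crossing diagrams. -/
noncomputable def generated : Submonoid SJDiagram :=
  Submonoid.closure (Set.range cups ∪ Set.range caps ∪ Set.range crossings)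

theorem cups_mem (k : ℕ) : cups k ∈ generated :=
  Submonoid.subset_closure (Or.inl (Or.inl ⟨k, rfl⟩))

theorem caps_mem (k : ℕ) : caps k ∈ generated :=
  Submonoid.subset_closure (Or.inl (Or.inr ⟨k, rfl⟩))

theorem crossings_mem (k : ℕ) : crossings k ∈ generated :=
  Submonoid.subset_closure (Or.inr ⟨k, rfl⟩)

theorem upsideDown_upsideDown (D : SJDiagram) : D.upsideDown.upsideDown = D :=
  eq_of_rel_imp fun _ _ h => rel_upsideDown.1 (rel_upsideDown.1 h)

theorem upsideDown_mem {D : SJDiagram} (h : D ∈ generated) : D.upsideDown ∈ generated := by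
  induction h using Submonoid.closure_induction with
  | mem x hx =>
    rcases hx with (⟨j, rfl⟩ | ⟨j, rfl⟩) | ⟨j, rfl⟩
    · rw [← upsideDown_caps, upsideDown_upsideDown]
      exact caps_mem j
    · rw [upsideDown_caps]
      exact cups_mem j
    · rw [upsideDown_crossings]
      exact crossings_mem j
  | one => rw [upsideDown_one]; exact one_mem _
  | mul x y _ _ hx hy => rw [upsideDown_mul]; exact mul_mem hy hx

/-- From the points `n` and `m` on, counted from `0`, all threads are `{n + k, -(m + k)}`. -/
def EventuallyVertical (D : SJDiagram) (n m : ℕ) : Prop :=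
  ∀ x y, D.Rel x y → ∀ k, x (n + k) = y (m + k)

theorem exists_eventuallyVertical (D : SJDiagram) : ∃ n m, D.EventuallyVertical n m := by
  obtain ⟨n, m, h⟩ := D.exists_type
  refine ⟨n.natPred, m.natPred, fun x y hxy k => ?_⟩
  have hn : ((n.natPred : ℕ) : ℤ) + 1 = n := by exact_mod_cast n.natPred_add_one
  have hm : ((m.natPred : ℕ) : ℤ) + 1 = m := by exact_mod_cast m.natPred_add_one
  have h1 : D.mate (NZInt.top (n.natPred + k)) = NZInt.bot (m.natPred + k) :=
    Subtype.ext ((h k _ (by simp only [NZInt.top]; push_cast; omega)).trans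
      (by simp only [NZInt.bot]; push_cast; omega))
  have h2 := hxy (NZInt.top (n.natPred + k))
  rw [h1] at h2
  simpa using h2.symm

theorem EventuallyVertical.upsideDown {D : SJDiagram} {n m : ℕ} (h : D.EventuallyVertical n m) :
    D.upsideDown.EventuallyVertical m n := fun x y hxy k =>
  (h y x (rel_upsideDown.1 hxy) k).symm

theorem mem_of_mul_crossings_mem {D : SJDiagram} {i : ℕ} (h : D * crossings i ∈ generated) :
    D ∈ generated := by
  have := mul_mem h (crossings_mem i)
  rwa [mul_assoc, crossing_mul_self, mul_one] at this

/-- Crossings put on top bring the ends of the thread together. A cup on the neighbors `i`, `i + 1`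
splits off as `D = D * caps i * cups i`, and `D * caps i` has two fewer points before its vertical
part. The bound on `i + d` keeps the crossings away from that part. -/
theorem mem_of_topThread {n m : ℕ}
    (ih : ∀ D : SJDiagram, D.EventuallyVertical n m → D ∈ generated) (d : ℕ) {D : SJDiagram}
    (hD : D.EventuallyVertical (n + 2) m) {i : ℕ} (hi : i + d ≤ n)
    (ht : ∀ x y, D.Rel x y → x i = x (i + d + 1)) : D ∈ generated := by
  induction d generalizing D with
  | zero =>
    have h1 : D = D * caps i * cups i := eq_of_rel_imp fun x y hxy =>
      rel_mul.2 ⟨fun n => x (skip i n), rel_cup.2 ⟨ht x y hxy, fun n => rfl⟩,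
        rel_mul.2 ⟨x, rel_cap.2 ⟨ht x y hxy, fun n => rfl⟩, hxy⟩⟩
    rw [h1]
    refine mul_mem (ih _ fun z y hzy k => ?_) (cups_mem i)
    obtain ⟨x, hx, hy⟩ := rel_mul.1 hzy
    rw [(rel_cap.1 hx).2, skip_of_le (by omega), ← hD x y hy k]
    congr 1
    omega
  | succ d IH =>
    refine mem_of_mul_crossings_mem (i := i + d + 1) (IH (fun x y hxy k => ?_) (by omega)
      fun x y hxy => ?_)
    · obtain ⟨z, hz, hy⟩ := rel_mul.1 hxy
      rw [← hD z y hy k, rel_crossing.1 hz]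
      congr 1
      simp only [flipAt]
      split_ifs <;> omega
    · obtain ⟨z, hz, hy⟩ := rel_mul.1 hxy
      have := ht z y hy
      rw [rel_crossing.1 hz, rel_crossing.1 hz] at this
      convert this using 2 <;> simp only [flipAt] <;> split_ifs <;> omega

/-- Crossings put on top move the upper end of the thread of the bottom point `m` to the place `n`.
The thread then joins the vertical part, and both bounds drop by one. -/
theorem mem_of_verticalThread {n m : ℕ}
    (ih : ∀ D : SJDiagram, D.EventuallyVertical n m → D ∈ generated) (d : ℕ) {D : SJDiagram}
    (hD : D.EventuallyVertical (n + 1) (m + 1)) {i : ℕ} (hi : i + d = n)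
    (ht : ∀ x y, D.Rel x y → y m = x i) : D ∈ generated := by
  induction d generalizing D i with
  | zero =>
    obtain rfl : i = n := hi
    refine ih _ fun x y hxy k => ?_
    cases k with
    | zero => exact (ht x y hxy).symm
    | succ k =>
      have := hD x y hxy k
      rwa [add_right_comm, add_right_comm m] at this
  | succ d IH =>
    refine mem_of_mul_crossings_mem (i := i) (IH (fun x y hxy k => ?_)
      (show i + 1 + d = n by omega) fun x y hxy => ?_)
    · obtain ⟨z, hz, hy⟩ := rel_mul.1 hxy
      rw [← hD z y hy k, rel_crossing.1 hz]
      congr 1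
      simp only [flipAt]
      split_ifs <;> omega
    · obtain ⟨z, hz, hy⟩ := rel_mul.1 hxy
      rw [ht z y hy, rel_crossing.1 hz]
      simp [flipAt]

/-- The thread of a point of the top line. -/
theorem top_thread (D : SJDiagram) (i : ℕ) :
    (∃ j, j ≠ i ∧ ∀ x y, D.Rel x y → x i = x j) ∨ ∃ j, ∀ x y, D.Rel x y → x i = y j := by
  rcases (D.mate (NZInt.top i)).eq_top_or_eq_bot with ⟨j, hj⟩ | ⟨j, hj⟩
  · refine Or.inl ⟨j, fun h => D.mate_ne _ (h ▸ hj), fun x y hxy => ?_⟩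
    have := hxy (NZInt.top i)
    rw [hj] at this
    simpa using this.symm
  · refine Or.inr ⟨j, fun x y hxy => ?_⟩
    have := hxy (NZInt.top i)
    rw [hj] at this
    simpa using this.symm

theorem EventuallyVertical.mate_top {D : SJDiagram} {n m : ℕ} (h : D.EventuallyVertical n m)
    (k : ℕ) : D.mate (NZInt.top (n + k)) = NZInt.bot (m + k) :=
  mate_eq_of_rel D (NZInt.top_ne_bot _ _).symm fun x y hxy => by simpa using h x y hxy k

/-- Consider the top point `n`, the last one before the vertical part. The points of the vertical
part are matched among themselves, so the other end of its thread lies before that part as well. If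
this end is on the top line, a cup splits off. If it is on the bottom line, the reflected diagram
has the thread at its last bottom point, as `mem_of_verticalThread` requires. -/
theorem mem_of_eventuallyVertical_succ {n m : ℕ}
    (ih : ∀ n' m' (D : SJDiagram), n' + m' < n + 1 + m → D.EventuallyVertical n' m' →
      D ∈ generated) {D : SJDiagram} (hD : D.EventuallyVertical (n + 1) m) : D ∈ generated := by
  rcases D.top_thread n with ⟨j, hj, ht⟩ | ⟨j, ht⟩
  · have hjn : j < n + 1 := by
      by_contra hc
      obtain ⟨k, rfl⟩ := Nat.exists_eq_add_of_le (not_lt.1 hc)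
      have h1 := hD.mate_top k
      rw [mate_eq_of_rel D (b := NZInt.top n) (fun h => hj (NZInt.top_inj.1 h).symm)
        fun x y hxy => by simpa using (ht x y hxy).symm] at h1
      exact NZInt.top_ne_bot _ _ h1
    obtain ⟨n, rfl⟩ : ∃ k, n = k + 1 := ⟨n - 1, by omega⟩
    refine mem_of_topThread (n := n) (m := m) (fun D' hD' => ih _ _ D' (by omega) hD') (n - j)
      hD (i := j) (by omega) fun x y hxy => ?_
    rw [← ht x y hxy]
    congr 1
    omega
  · have hjm : j < m := by
      by_contra hc
      obtain ⟨k, rfl⟩ := Nat.exists_eq_add_of_le (not_lt.1 hc)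
      have h1 := hD.mate_top k
      have h2 := mate_eq_of_rel D (a := NZInt.top n) (NZInt.top_ne_bot _ _).symm
        fun x y hxy => by simpa using ht x y hxy
      rw [← h2] at h1
      have h3 := congrArg D.mate h1
      rw [D.mate_mate, D.mate_mate, NZInt.top_inj] at h3
      omega
    obtain ⟨m, rfl⟩ : ∃ k, m = k + 1 := ⟨m - 1, by omega⟩
    have h1 := mem_of_verticalThread (n := m) (m := n) (D := D.upsideDown) (i := j) (fun D' hD' => by
      rw [← upsideDown_upsideDown D']
      exact upsideDown_mem (ih n m _ (by omega) hD'.upsideDown)) (m - j) hD.upsideDown (by omega)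
      fun x y hxy => ht y x (rel_upsideDown.1 hxy)
    rw [← upsideDown_upsideDown D]
    exact upsideDown_mem h1

/-- The cup, cap and crossing diagrams generate all `SJ` diagrams. -/
theorem mem_generated (D : SJDiagram) : D ∈ generated := by
  obtain ⟨n, m, hD⟩ := D.exists_eventuallyVertical
  obtain ⟨N, hN⟩ : ∃ N, n + m = N := ⟨_, rfl⟩
  induction N using Nat.strong_induction_on generalizing n m D with
  | _ N ih =>
  have ih' : ∀ n' m' (D : SJDiagram), n' + m' < n + m → D.EventuallyVertical n' m' →
      D ∈ generated := fun n' m' D h hD => ih _ (hN ▸ h) D n' m' hD rfl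
  cases n with
  | succ n => exact mem_of_eventuallyVertical_succ ih' hD
  | zero =>
    cases m with
    | succ m =>
      rw [← upsideDown_upsideDown D]
      refine upsideDown_mem (mem_of_eventuallyVertical_succ (n := m) (m := 0)
        (fun n' m' D' h hD' => ?_) hD.upsideDown)
      exact ih' n' m' D' (by omega) hD'
    | zero =>
      have : D = 1 := eq_of_rel_imp fun x y hxy => rel_one.2 (funext fun k => by
        simpa using hD x y hxy k)
      rw [this]
      exact one_mem _

end Generation

end SJDiagram

/-! ### Words -/

theorem Nat.succPNat_add_one (k : ℕ) : k.succPNat + 1 = (k + 1).succPNat := rfl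

theorem PNat.exists_eq_succPNat (k : ℕ+) : ∃ i : ℕ, k = i.succPNat :=
  ⟨k.natPred, (PNat.succPNat_natPred k).symm⟩

theorem SKTerm.word_mul (t u : SKTerm) : (t * u).word = t.word ++ u.word := rfl

theorem SKTerm.exists_word {w : List SKSymbol} (h : w ≠ []) : ∃ t : SKTerm, t.word = w := by
  induction w with
  | nil => exact absurd rfl h
  | cons s w ih =>
    by_cases hw : w = []
    · exact ⟨SKTerm.sym s, by rw [hw]; rfl⟩
    · obtain ⟨t, ht⟩ := ih hw
      exact ⟨SKTerm.sym s * t, by rw [SKTerm.word_mul, ht]; rfl⟩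

namespace SKSymbol

/-- The word of a normal form, whose blocks are given by their smallest indices, counted from `0`,
and their lengths. -/
def normalWord (k : ℕ+) (l : ℕ) (A P B : List (ℕ × ℕ)) : List SKSymbol :=
  (List.replicate l (circle k)).flatten
    ++ (A.map fun p => blockCapAux p.1.succPNat p.2).flatten
    ++ [one]
    ++ (P.map fun p => blockCrossAux p.1.succPNat p.2).flatten
    ++ (B.map fun p => blockCupAux p.1.succPNat p.2).flatten

section Evaluation

variable {M : Type*} [Monoid M] (f : SKSymbol → M)

theorem prod_blockCupAux (m d : ℕ) : ((blockCupAux m.succPNat d).map f).prod =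
    cupBlock (fun i => f (cup i.succPNat)) (fun i => f (cross i.succPNat)) m d := by
  induction d with
  | zero => simp [blockCupAux, cupBlock]
  | succ d ih =>
    -- Both sides are `m + d + 2`: each `succPNat` adds one.
    have : m.succPNat + d.succPNat = (m + d + 1).succPNat :=
      PNat.eq (by simp only [PNat.add_coe, Nat.succPNat_coe]; omega)
    simp [blockCupAux, cupBlock, ih, this]

theorem prod_blockCapAux (m d : ℕ) : ((blockCapAux m.succPNat d).map f).prod =
    capBlock (fun i => f (cap i.succPNat)) (fun i => f (cross i.succPNat)) m d := by
  induction d with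
  | zero => simp [blockCapAux, capBlock]
  | succ d ih =>
    have : m.succPNat + d.succPNat = (m + d + 1).succPNat :=
      PNat.eq (by simp only [PNat.add_coe, Nat.succPNat_coe]; omega)
    simp [blockCapAux, capBlock, ih, this]

theorem prod_blockCrossAux (m d : ℕ) : ((blockCrossAux m.succPNat d).map f).prod =
    crossBlock (fun i => f (cross i.succPNat)) m d := by
  induction d with
  | zero => simp [blockCrossAux, crossBlock]
  | succ d ih =>
    have : m.succPNat + d.succPNat = (m + d + 1).succPNat :=
      PNat.eq (by simp only [PNat.add_coe, Nat.succPNat_coe]; omega)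
    simp [blockCrossAux, crossBlock, ih, this]

theorem prod_flatten_map (L : List (ℕ × ℕ)) (b : ℕ × ℕ → List SKSymbol) :
    ((L.map b).flatten.map f).prod = (L.map fun p => ((b p).map f).prod).prod := by
  induction L with
  | nil => simp
  | cons p L ih =>
    rw [List.map_cons, List.flatten_cons, List.map_append, List.prod_append, ih, List.map_cons,
      List.prod_cons]

theorem prod_circles (k : ℕ+) (l : ℕ) :
    ((List.replicate l (circle k)).flatten.map f).prod = (f (cup k) * f (cap k)) ^ l := by
  induction l with
  | zero => simp
  | succ l ih => rw [List.replicate_succ, List.flatten_cons, List.map_append, List.prod_append, ih,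
      pow_succ']; simp [circle]

theorem prod_normalWord (hf : f one = 1) (k : ℕ+) (l : ℕ) (A P B : List (ℕ × ℕ)) :
    ((normalWord k l A P B).map f).prod = (f (cup k) * f (cap k)) ^ l *
      (A.map fun p => capBlock (fun i => f (cap i.succPNat))
        (fun i => f (cross i.succPNat)) p.1 p.2).prod *
      (P.map fun p => crossBlock (fun i => f (cross i.succPNat)) p.1 p.2).prod *
      (B.map fun p => cupBlock (fun i => f (cup i.succPNat))
        (fun i => f (cross i.succPNat)) p.1 p.2).prod := by
  simp only [normalWord, List.map_append, List.prod_append, prod_circles, prod_flatten_map,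
    prod_blockCapAux, prod_blockCrossAux, prod_blockCupAux, List.map_singleton,
    List.prod_singleton, hf, mul_one]

end Evaluation

theorem normalWord_ne_nil (k : ℕ+) (l : ℕ) (A P B : List (ℕ × ℕ)) :
    normalWord k l A P B ≠ [] := by
  simp [normalWord]

end SKSymbol

open SKSymbol

/-- A block is recorded by its smallest index, counted from `0`, and the difference between its
largest and smallest index. Cups and caps are ordered by smallest indices, crossings by largest
ones, hence the sums in the condition on `P`. -/
theorem SKTerm.isNormalWith_iff {k : ℕ+} {l : ℕ} {t : SKTerm} : t.IsNormalWith k l ↔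
    ∃ A P B : List (ℕ × ℕ), A.Pairwise (fun p q => q.1 < p.1) ∧
      P.Pairwise (fun p q => p.1 + p.2 < q.1 + q.2) ∧ B.Pairwise (fun p q => p.1 < q.1) ∧
      t.word = normalWord k l A P B := by
  have hp : ∀ x : ℕ+, x.natPred + 1 = x := fun x => x.natPred_add_one
  constructor
  · rintro ⟨caps, crosses, cups, h1, h2, h3, h4, h5, h6, h⟩
    refine ⟨caps.map fun x => (x.2.natPred, x.1 - x.2),
      crosses.map fun x => (x.2.natPred, x.1 - x.2),
      cups.map fun x => (x.1.natPred, x.2 - x.1), ?_, ?_, ?_, ?_⟩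
    · exact List.pairwise_map.2 (h4.imp fun {x y} hxy => PNat.natPred_lt_natPred.2 hxy)
    · refine List.pairwise_map.2 (h5.imp_of_mem fun {x y} hx hy hxy => ?_)
      have e1 := h2 x hx
      have e2 := h2 y hy
      have e3 := hp x.2
      have e4 := hp y.2
      rw [← PNat.coe_le_coe] at e1 e2
      rw [← PNat.coe_lt_coe] at hxy
      simp only
      omega
    · exact List.pairwise_map.2 (h6.imp fun {x y} hxy => PNat.natPred_lt_natPred.2 hxy)
    · rw [h]
      simp only [normalWord, List.map_map, Function.comp_def, PNat.succPNat_natPred]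
      rfl
  · rintro ⟨A, P, B, h1, h2, h3, h⟩
    have hle : ∀ p : ℕ × ℕ, p.1.succPNat ≤ (p.1 + p.2).succPNat := fun p =>
      Nat.succPNat_le_succPNat.2 (Nat.le_add_right _ _)
    have hsub : ∀ p : ℕ × ℕ, ((p.1 + p.2).succPNat : ℕ) - (p.1.succPNat : ℕ) = p.2 := fun p => by
      simp only [Nat.succPNat_coe]
      omega
    refine ⟨A.map fun p => ((p.1 + p.2).succPNat, p.1.succPNat),
      P.map fun p => ((p.1 + p.2).succPNat, p.1.succPNat),
      B.map fun p => (p.1.succPNat, (p.1 + p.2).succPNat), ?_, ?_, ?_, ?_, ?_, ?_, ?_⟩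
    · intro x hx
      obtain ⟨p, -, rfl⟩ := List.mem_map.1 hx
      exact hle p
    · intro x hx
      obtain ⟨p, -, rfl⟩ := List.mem_map.1 hx
      exact hle p
    · intro x hx
      obtain ⟨p, -, rfl⟩ := List.mem_map.1 hx
      exact hle p
    · exact List.pairwise_map.2 (h1.imp fun {p q} hpq => Nat.succPNat_lt_succPNat.2 hpq)
    · exact List.pairwise_map.2 (h2.imp fun {p q} hpq => Nat.succPNat_lt_succPNat.2 hpq)
    · exact List.pairwise_map.2 (h3.imp fun {p q} hpq => Nat.succPNat_lt_succPNat.2 hpq)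
    · rw [h]
      simp only [normalWord, List.map_map, Function.comp_def, blockCap, blockCross, blockCup, hsub]

/-! ### Soundness -/

theorem SKTerm.kappa_mul (t u : SKTerm) : (t * u).kappa = t.kappa * u.kappa := rfl

theorem SKTerm.iota_mul (t u : SKTerm) : (t * u).iota = t.iota * u.iota := rfl

theorem SKTerm.diagram_kappa (t : SKTerm) : t.kappa.diagram = t.iota := by
  induction t with
  | sym s => rfl
  | mul t u iht ihu => rw [kappa, iota, SKDiagram.diagram_mul, iht, ihu]

/-- The circles of a product of two generators. -/
theorem SKTerm.circles_sym_mul_sym (s s' : SKSymbol) :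
    (sym s * sym s').kappa.circles = SJDiagram.loops s.diagram s'.diagram := by
  rw [kappa_mul, SKDiagram.circles_mul]
  exact zero_add _

theorem SKTerm.circles_mul_of_functional {t u : SKTerm} (h : u.iota.Functional) :
    (t * u).kappa.circles = u.kappa.circles + t.kappa.circles := by
  rw [kappa_mul, SKDiagram.circles_mul, diagram_kappa, diagram_kappa, h.loops_eq_zero, add_zero]

-- The diagrams agree by the equations already checked. As for circles, none arise when the right
-- factor, which is drawn above, is a cup or a crossing, nor when the left factor is a cap or a
-- crossing. Only a cup times a cap needs `loops_cup_cap_of_ne`.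
open SJDiagram in
theorem SKAxiom.kappa_eq {t u : SKTerm} (h : SKAxiom t u) : t.kappa = u.kappa := by
  have hle : ∀ {j k : ℕ}, j.succPNat ≤ k.succPNat → j ≤ k := Nat.succPNat_le_succPNat.1
  have c : ∀ s : SKSymbol, (SKTerm.sym s).kappa.circles = 0 := fun _ => rfl
  have c₂ := SKTerm.circles_sym_mul_sym
  have fu := fun k D => (functional_cup k).loops_eq_zero D
  have fs := fun k D => (functional_crossing k).loops_eq_zero D
  have gn := fun k D => (cofunctional_cap k).loops_eq_zero D
  have gs := fun k D => (cofunctional_crossing k).loops_eq_zero D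
  cases h with
  | cup_cup j k h =>
    obtain ⟨j, rfl⟩ := j.exists_eq_succPNat
    obtain ⟨k, rfl⟩ := k.exists_eq_succPNat
    refine SKDiagram.ext (cup_mul_cup (hle h)) ?_
    rw [c₂, c₂]
    exact (fu _ _).trans (fu _ _).symm
  | cap_cap j k h =>
    obtain ⟨j, rfl⟩ := j.exists_eq_succPNat
    obtain ⟨k, rfl⟩ := k.exists_eq_succPNat
    refine SKDiagram.ext (cap_mul_cap (hle h)) ?_
    rw [c₂, c₂]
    exact (gn _ _).trans (gn _ _).symm
  | cup_cap₁ j k h =>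
    obtain ⟨j, rfl⟩ := j.exists_eq_succPNat
    obtain ⟨k, rfl⟩ := k.exists_eq_succPNat
    refine SKDiagram.ext (cup_mul_cap₁ (hle h)) ?_
    rw [c₂, c₂]
    exact (loops_cup_cap_of_ne (i := k + 2) (by have := hle h; omega)).trans (gn _ _).symm
  | cap_cup₁ j k h =>
    obtain ⟨j, rfl⟩ := j.exists_eq_succPNat
    obtain ⟨k, rfl⟩ := k.exists_eq_succPNat
    refine SKDiagram.ext (cup_mul_cap₂ (hle h)) ?_
    rw [c₂, c₂]
    exact (loops_cup_cap_of_ne (j := k + 2) (by have := hle h; omega)).trans (gn _ _).symm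
  | cup_cap i =>
    obtain ⟨i, rfl⟩ := i.exists_eq_succPNat
    refine SKDiagram.ext (cup_mul_cap_succ i) ?_
    rw [c₂, c]
    exact loops_cup_cap_of_ne (j := i + 1) (by omega)
  | cross j k h =>
    obtain ⟨j, rfl⟩ := j.exists_eq_succPNat
    obtain ⟨k, rfl⟩ := k.exists_eq_succPNat
    refine SKDiagram.ext (crossing_mul_crossing (hle h)) ?_
    rw [c₂, c₂]
    exact (fs _ _).trans (fs _ _).symm
  | cross₂ i =>
    obtain ⟨i, rfl⟩ := i.exists_eq_succPNat
    refine SKDiagram.ext (crossing_mul_self i) ?_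
    rw [c₂, c]
    exact fs _ _
  | cross₃ i =>
    obtain ⟨i, rfl⟩ := i.exists_eq_succPNat
    refine SKDiagram.ext (crossing_braid i) ?_
    rw [Nat.succPNat_add_one]
    have f : ∀ k : ℕ, (SKTerm.cross k.succPNat).iota.Functional := functional_crossing
    rw [SKTerm.circles_mul_of_functional (f (i + 1)), SKTerm.circles_mul_of_functional (f i),
      SKTerm.circles_mul_of_functional (f i), SKTerm.circles_mul_of_functional (f (i + 1))]
    rfl
  | cross_cup₁ j k h =>
    obtain ⟨j, rfl⟩ := j.exists_eq_succPNat
    obtain ⟨k, rfl⟩ := k.exists_eq_succPNat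
    refine SKDiagram.ext (cup_mul_crossing₁ (hle h)) ?_
    rw [c₂, c₂]
    exact (fs _ _).trans (fu _ _).symm
  | cross_cup₂ j k h =>
    obtain ⟨j, rfl⟩ := j.exists_eq_succPNat
    obtain ⟨k, rfl⟩ := k.exists_eq_succPNat
    refine SKDiagram.ext (cup_mul_crossing₂ (hle h)) ?_
    rw [c₂, c₂]
    exact (fs _ _).trans (fu _ _).symm
  | cross_cup₃ i =>
    obtain ⟨i, rfl⟩ := i.exists_eq_succPNat
    refine SKDiagram.ext (cup_mul_crossing_self i) ?_
    rw [c₂, c]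
    exact fs _ _
  | cross_cup₄ i =>
    obtain ⟨i, rfl⟩ := i.exists_eq_succPNat
    refine SKDiagram.ext (cup_succ_mul_crossing i) ?_
    rw [c₂, c₂]
    exact (fs _ _).trans (fs (i + 1) _).symm
  | cross_cap₁ j k h =>
    obtain ⟨j, rfl⟩ := j.exists_eq_succPNat
    obtain ⟨k, rfl⟩ := k.exists_eq_succPNat
    refine SKDiagram.ext (crossing_mul_cap₁ (hle h)) ?_
    rw [c₂, c₂]
    exact (gs _ _).trans (gn (k + 2) _).symm
  | cross_cap₂ j k h =>
    obtain ⟨j, rfl⟩ := j.exists_eq_succPNat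
    obtain ⟨k, rfl⟩ := k.exists_eq_succPNat
    refine SKDiagram.ext (crossing_mul_cap₂ (hle h)) ?_
    rw [c₂, c₂]
    exact (gs (k + 2) _).trans (gn _ _).symm
  | cross_cap₃ i =>
    obtain ⟨i, rfl⟩ := i.exists_eq_succPNat
    refine SKDiagram.ext (crossing_mul_cap_self i) ?_
    rw [c₂, c]
    exact gs _ _
  | cross_cap₄ i =>
    obtain ⟨i, rfl⟩ := i.exists_eq_succPNat
    refine SKDiagram.ext (crossing_mul_cap_succ i) ?_
    rw [c₂, c₂]
    exact (gs _ _).trans (gs (i + 1) _).symm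

theorem TermEq.kappa_eq {t u : SKTerm} (h : TermEq SKAxiom t u) : t.kappa = u.kappa := by
  induction h with
  | ax t u h => exact h.kappa_eq
  | one_mul t => exact SKDiagram.monoid.one_mul _
  | mul_one t => exact SKDiagram.monoid.mul_one _
  | assoc t u v => exact (SKDiagram.monoid.mul_assoc _ _ _).symm
  | refl t => rfl
  | symm t u _ ih => exact ih.symm
  | trans t u v _ _ ih₁ ih₂ => exact ih₁.trans ih₂
  | mul t t' u u' _ _ ih₁ ih₂ => rw [SKTerm.kappa_mul, SKTerm.kappa_mul, ih₁, ih₂]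

theorem TermEq.iota_eq {t u : SKTerm} (h : TermEq SJAxiom t u) : t.iota = u.iota := by
  induction h with
  | ax t u h =>
    cases h with
    | ofSK t u h => rw [← SKTerm.diagram_kappa, h.kappa_eq, SKTerm.diagram_kappa]
    | circle k =>
      obtain ⟨k, rfl⟩ := k.exists_eq_succPNat
      exact SJDiagram.cup_mul_cap_self k
  | one_mul t => exact SJDiagram.diagram_one_mul _
  | mul_one t => exact SJDiagram.diagram_mul_one _
  | assoc t u v => exact (SJDiagram.diagram_mul_assoc _ _ _).symm
  | refl t => rfl
  | symm t u _ ih => exact ih.symm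
  | trans t u v _ _ ih₁ ih₂ => exact ih₁.trans ih₂
  | mul t t' u u' _ _ ih₁ ih₂ => rw [SKTerm.iota_mul, SKTerm.iota_mul, ih₁, ih₂]

/-! ### Interpretation of normal forms -/

section NormalForms

attribute [local instance] SJDiagram.monoid SKDiagram.monoid

theorem SKTerm.iota_eq_prod (t : SKTerm) : t.iota = (t.word.map SKSymbol.diagram).prod := by
  induction t with
  | sym s => exact (List.prod_singleton).symm
  | mul t u iht ihu =>
    rw [word, List.map_append, List.prod_append, ← iht, ← ihu]
    rfl

theorem SKTerm.kappa_eq_prod (t : SKTerm) :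
    t.kappa = (t.word.map fun s => (⟨s.diagram, 0⟩ : SKDiagram)).prod := by
  induction t with
  | sym s => exact (List.prod_singleton).symm
  | mul t u iht ihu =>
    rw [word, List.map_append, List.prod_append, ← iht, ← ihu]
    rfl

theorem TermMonoid.mk_eq_prod (R : SKTerm → SKTerm → Prop) (t : SKTerm) :
    TermMonoid.mk R t = (t.word.map fun s => TermMonoid.mk R (SKTerm.sym s)).prod := by
  induction t with
  | sym s => exact (List.prod_singleton).symm
  | mul t u iht ihu =>
    rw [SKTerm.word, List.map_append, List.prod_append, ← iht, ← ihu]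
    rfl

theorem iota_of_normalWord {t : SKTerm} {k : ℕ+} {l : ℕ} {A P B : List (ℕ × ℕ)}
    (h : t.word = normalWord k l A P B) : t.iota =
      (A.map fun p => capBlock SJDiagram.caps SJDiagram.crossings p.1 p.2).prod *
      (P.map fun p => crossBlock SJDiagram.crossings p.1 p.2).prod *
      (B.map fun p => cupBlock SJDiagram.cups SJDiagram.crossings p.1 p.2).prod := by
  obtain ⟨k, rfl⟩ := k.exists_eq_succPNat
  have hc : (SKSymbol.cup k.succPNat).diagram * (SKSymbol.cap k.succPNat).diagram = 1 :=
    SJDiagram.cup_mul_cap_self k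
  rw [SKTerm.iota_eq_prod, h, prod_normalWord _ rfl, hc, one_pow, one_mul]
  rfl

/-- The `SK` diagrams without circles in which the top line determines the bottom line. -/
noncomputable def SKDiagram.functional : Submonoid SKDiagram where
  carrier := {E | E.circles = 0 ∧ E.diagram.Functional}
  one_mem' := ⟨rfl, SJDiagram.functional_one⟩
  mul_mem' {E₂ E₁} h₂ h₁ :=
    ⟨by rw [circles_mul, h₁.1, h₂.1, h₁.2.loops_eq_zero], h₂.2.mul h₁.2⟩

/-- The `SK` diagrams without circles in which the bottom line determines the top line. -/
noncomputable def SKDiagram.cofunctional : Submonoid SKDiagram where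
  carrier := {E | E.circles = 0 ∧ E.diagram.Cofunctional}
  one_mem' := ⟨rfl, SJDiagram.cofunctional_one⟩
  mul_mem' {E₂ E₁} h₂ h₁ :=
    ⟨by rw [circles_mul, h₁.1, h₂.1, h₂.2.loops_eq_zero], h₂.2.mul h₁.2⟩

theorem SKDiagram.circle_pow (k l : ℕ) :
    ((⟨SJDiagram.cup k.succPNat, 0⟩ : SKDiagram) * ⟨SJDiagram.cap k.succPNat, 0⟩) ^ l = ⟨1, l⟩ := by
  induction l with
  | zero => rfl
  | succ l ih =>
    rw [pow_succ, ih]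
    refine SKDiagram.ext ?_ ?_
    · exact (SJDiagram.diagram_one_mul _).trans (SJDiagram.cup_mul_cap_self k)
    · rw [circles_mul, SJDiagram.cofunctional_one.loops_eq_zero, circles_mul,
        SJDiagram.loops_cup_cap_self]
      simp only
      omega

/-- Products of caps and crossings have no circles because they are cofunctional, products of cups
and crossings because they are functional. Composing with a functional diagram on top creates none
either, so only the initial circles count. -/
theorem circles_of_normalWord {t : SKTerm} {k : ℕ+} {l : ℕ} {A P B : List (ℕ × ℕ)}
    (h : t.word = normalWord k l A P B) : t.kappa.circles = l := by
  obtain ⟨k, rfl⟩ := k.exists_eq_succPNat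
  rw [SKTerm.kappa_eq_prod, h, prod_normalWord _ rfl]
  change ((((⟨SJDiagram.cup k.succPNat, 0⟩ : SKDiagram) *
    ⟨SJDiagram.cap k.succPNat, 0⟩) ^ l * _ * _ * _).circles = l)
  rw [SKDiagram.circle_pow, mul_assoc (⟨1, l⟩ : SKDiagram)]
  have hA : ∀ m d, capBlock (fun i => (⟨(SKSymbol.cap i.succPNat).diagram, 0⟩ : SKDiagram))
      (fun i => ⟨(SKSymbol.cross i.succPNat).diagram, 0⟩) m d ∈ SKDiagram.cofunctional := by
    intro m d
    induction d with
    | zero => exact ⟨rfl, SJDiagram.cofunctional_cap m⟩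
    | succ d ih =>
      exact SKDiagram.cofunctional.mul_mem ⟨rfl, SJDiagram.cofunctional_crossing (m + d + 1)⟩ ih
  have hP : ∀ m d, crossBlock (fun i => (⟨(SKSymbol.cross i.succPNat).diagram, 0⟩ : SKDiagram))
      m d ∈ SKDiagram.cofunctional := by
    intro m d
    induction d with
    | zero => exact ⟨rfl, SJDiagram.cofunctional_crossing m⟩
    | succ d ih =>
      exact SKDiagram.cofunctional.mul_mem ⟨rfl, SJDiagram.cofunctional_crossing (m + d + 1)⟩ ih
  have hB : ∀ m d, cupBlock (fun i => (⟨(SKSymbol.cup i.succPNat).diagram, 0⟩ : SKDiagram))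
      (fun i => ⟨(SKSymbol.cross i.succPNat).diagram, 0⟩) m d ∈ SKDiagram.functional := by
    intro m d
    induction d with
    | zero => exact ⟨rfl, SJDiagram.functional_cup m⟩
    | succ d ih =>
      exact SKDiagram.functional.mul_mem ih ⟨rfl, SJDiagram.functional_crossing (m + d + 1)⟩
  have mem : ∀ (S : Submonoid SKDiagram) (f : ℕ × ℕ → SKDiagram) (L : List (ℕ × ℕ)),
      (∀ p, f p ∈ S) → (L.map f).prod ∈ S := fun S f L hf => S.list_prod_mem fun E hE => by
    obtain ⟨p, -, rfl⟩ := List.mem_map.1 hE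
    exact hf p
  have h₁ := mul_mem (mem _ _ A fun p => hA p.1 p.2) (mem _ _ P fun p => hP p.1 p.2)
  have h₂ := mem _ _ B fun p => hB p.1 p.2
  rw [SKDiagram.circles_mul, h₂.1, h₂.2.loops_eq_zero, SKDiagram.circles_mul, h₁.1,
    SJDiagram.cofunctional_one.loops_eq_zero]
  simp only
  omega

theorem normalWord_eq_of_iota_eq {t u : SKTerm} {k : ℕ+} {l : ℕ} (ht : t.IsNormalWith k l)
    (hu : u.IsNormalWith k l) (h : t.iota = u.iota) : t.word = u.word := by
  obtain ⟨A, P, B, hA, hP, hB, ht⟩ := SKTerm.isNormalWith_iff.1 ht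
  obtain ⟨A', P', B', hA', hP', hB', hu⟩ := SKTerm.isNormalWith_iff.1 hu
  rw [iota_of_normalWord ht, iota_of_normalWord hu] at h
  obtain ⟨rfl, rfl, rfl⟩ := SJDiagram.normalForm_unique hA hA' hP hP' hB hB' h
  rw [ht, hu]

theorem SKTerm.IsNormalWith.circles {t : SKTerm} {k : ℕ+} {l : ℕ} (ht : t.IsNormalWith k l) :
    t.kappa.circles = l := by
  obtain ⟨A, P, B, -, -, -, ht⟩ := SKTerm.isNormalWith_iff.1 ht
  exact circles_of_normalWord ht

theorem word_eq_of_kappa_eq {t u : SKTerm} {k : ℕ+} (ht : t.IsNormal k) (hu : u.IsNormal k)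
    (h : t.kappa = u.kappa) : t.word = u.word := by
  obtain ⟨l, ht⟩ := ht
  obtain ⟨l', hu⟩ := hu
  have hl : l = l' := by rw [← ht.circles, h, hu.circles]
  subst hl
  refine normalWord_eq_of_iota_eq ht hu ?_
  rw [← SKTerm.diagram_kappa, h, SKTerm.diagram_kappa]

end NormalForms

/-! ### Completeness -/

theorem TermMonoid.eq_iff {R : SKTerm → SKTerm → Prop} {t u : SKTerm} :
    TermMonoid.mk R t = TermMonoid.mk R u ↔ TermEq R t u :=
  ⟨fun h => Quotient.exact h, fun h => Quotient.sound h⟩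

/-- In the presented monoid the class of a term is the product of its symbols, so parentheses do not
matter. -/
theorem termEq_of_word_eq {R : SKTerm → SKTerm → Prop} {t u : SKTerm} (h : t.word = u.word) :
    TermEq R t u := by
  rw [← TermMonoid.eq_iff, TermMonoid.mk_eq_prod, TermMonoid.mk_eq_prod, h]

theorem SKAxiom.mk_eq {t u : SKTerm} (h : SKAxiom t u) :
    TermMonoid.mk SKAxiom t = TermMonoid.mk SKAxiom u :=
  TermMonoid.eq_iff.2 (TermEq.ax _ _ h)

/-- The symmetric self-adjunction in the monoid `SKω`. -/
theorem skOmega_symmetricSelfAdjunction : SymmetricSelfAdjunction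
    (fun k => (TermMonoid.mk SKAxiom (SKTerm.cup k.succPNat) : SKOmega))
    (fun k => TermMonoid.mk SKAxiom (SKTerm.cap k.succPNat))
    (fun k => TermMonoid.mk SKAxiom (SKTerm.cross k.succPNat)) := by
  have le : ∀ {j k : ℕ}, j ≤ k → j.succPNat ≤ k.succPNat := Nat.succPNat_le_succPNat.2
  have sq : ∀ i : ℕ, TermMonoid.mk SKAxiom (SKTerm.cross i.succPNat) *
      TermMonoid.mk SKAxiom (SKTerm.cross i.succPNat) = (1 : SKOmega) := fun i =>
    (SKAxiom.cross₂ i.succPNat).mk_eq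
  have sn : ∀ i : ℕ, TermMonoid.mk SKAxiom (SKTerm.cross i.succPNat) *
      TermMonoid.mk SKAxiom (SKTerm.cap i.succPNat) =
      (TermMonoid.mk SKAxiom (SKTerm.cap i.succPNat) : SKOmega) := fun i =>
    (SKAxiom.cross_cap₃ i.succPNat).mk_eq
  have sn' : ∀ i : ℕ, TermMonoid.mk SKAxiom (SKTerm.cross i.succPNat) *
      TermMonoid.mk SKAxiom (SKTerm.cap (i + 1).succPNat) =
      (TermMonoid.mk SKAxiom (SKTerm.cross (i + 1).succPNat) *
        TermMonoid.mk SKAxiom (SKTerm.cap i.succPNat) : SKOmega) := fun i =>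
    (SKAxiom.cross_cap₄ i.succPNat).mk_eq
  have us : ∀ i : ℕ, TermMonoid.mk SKAxiom (SKTerm.cup (i + 1).succPNat) *
      TermMonoid.mk SKAxiom (SKTerm.cross i.succPNat) =
      (TermMonoid.mk SKAxiom (SKTerm.cup i.succPNat) *
        TermMonoid.mk SKAxiom (SKTerm.cross (i + 1).succPNat) : SKOmega) := fun i =>
    (SKAxiom.cross_cup₄ i.succPNat).mk_eq
  have us' : ∀ i : ℕ, TermMonoid.mk SKAxiom (SKTerm.cup i.succPNat) *
      TermMonoid.mk SKAxiom (SKTerm.cross i.succPNat) =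
      (TermMonoid.mk SKAxiom (SKTerm.cup i.succPNat) : SKOmega) := fun i =>
    (SKAxiom.cross_cup₃ i.succPNat).mk_eq
  have un : ∀ i : ℕ, TermMonoid.mk SKAxiom (SKTerm.cup i.succPNat) *
      TermMonoid.mk SKAxiom (SKTerm.cap (i + 1).succPNat) = (1 : SKOmega) := fun i =>
    (SKAxiom.cup_cap i.succPNat).mk_eq
  exact
  { uu := fun h => (SKAxiom.cup_cup _ _ (le h)).mk_eq
    nn := fun h => (SKAxiom.cap_cap _ _ (le h)).mk_eq
    un₁ := fun h => (SKAxiom.cup_cap₁ _ _ (le h)).mk_eq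
    un₂ := fun h => (SKAxiom.cap_cup₁ _ _ (le h)).mk_eq
    un_succ := un
    -- The chain is `u (i + 1) * n i = u (i + 1) * s i * n i = u i * s (i + 1) * n i = u i * s i * n
    -- (i + 1) = u i * n (i + 1) = 1`.
    succ_un := fun i => by
      rw [← sn i, ← mul_assoc, us, mul_assoc, ← sn', ← mul_assoc, us', un]
    ss := fun h => (SKAxiom.cross _ _ (le h)).mk_eq
    s_sq := sq
    braid := fun i => (SKAxiom.cross₃ i.succPNat).mk_eq
    us₁ := fun h => (SKAxiom.cross_cup₁ _ _ (le h)).mk_eq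
    us₂ := fun h => (SKAxiom.cross_cup₂ _ _ (le h)).mk_eq
    us := us'
    us_succ := us
    sn₁ := fun h => (SKAxiom.cross_cap₁ _ _ (le h)).mk_eq
    sn₂ := fun h => (SKAxiom.cross_cap₂ _ _ (le h)).mk_eq
    sn := sn
    sn_succ := sn' }

theorem skOmega_mem_closure (t : SKTerm) : (TermMonoid.mk SKAxiom t : SKOmega) ∈
    Submonoid.closure
      (Set.range (fun k : ℕ => (TermMonoid.mk SKAxiom (SKTerm.cup k.succPNat) : SKOmega)) ∪
        Set.range (fun k : ℕ => (TermMonoid.mk SKAxiom (SKTerm.cap k.succPNat) : SKOmega)) ∪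
        Set.range (fun k : ℕ => (TermMonoid.mk SKAxiom (SKTerm.cross k.succPNat) : SKOmega))) := by
  induction t with
  | sym s =>
    cases s with
    | one => exact one_mem _
    | cup k =>
      obtain ⟨k, rfl⟩ := k.exists_eq_succPNat
      exact Submonoid.subset_closure (Or.inl (Or.inl ⟨k, rfl⟩))
    | cap k =>
      obtain ⟨k, rfl⟩ := k.exists_eq_succPNat
      exact Submonoid.subset_closure (Or.inl (Or.inr ⟨k, rfl⟩))
    | cross k =>
      obtain ⟨k, rfl⟩ := k.exists_eq_succPNat
      exact Submonoid.subset_closure (Or.inr ⟨k, rfl⟩)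
  | mul t u iht ihu => exact mul_mem iht ihu

/-- Every term is equal in `SKω` to terms with the word of a normal form. -/
theorem exists_normalWord (t : SKTerm) : ∃ (l : ℕ) (A P B : List (ℕ × ℕ)),
    A.Pairwise (fun p q => q.1 < p.1) ∧ P.Pairwise (fun p q => p.1 + p.2 < q.1 + q.2) ∧
    B.Pairwise (fun p q => p.1 < q.1) ∧
    ∀ u : SKTerm, u.word = normalWord 1 l A P B → TermEq SKAxiom t u := by
  obtain ⟨l, A, P, B, hA, hP, hB, h⟩ :=
    skOmega_symmetricSelfAdjunction.exists_normalForm (skOmega_mem_closure t)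
  refine ⟨l, A, P, B, hA, hP, hB, fun u hu => ?_⟩
  rw [← TermMonoid.eq_iff, h, TermMonoid.mk_eq_prod SKAxiom u, hu, prod_normalWord _ rfl]
  rfl

theorem exists_isNormalWith (t : SKTerm) :
    ∃ l, ∃ u : SKTerm, u.IsNormalWith 1 l ∧ TermEq SKAxiom t u := by
  obtain ⟨l, A, P, B, hA, hP, hB, h⟩ := exists_normalWord t
  obtain ⟨u, hu⟩ := SKTerm.exists_word (normalWord_ne_nil 1 l A P B)
  exact ⟨l, u, SKTerm.isNormalWith_iff.2 ⟨A, P, B, hA, hP, hB, hu⟩, h u hu⟩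

/-- Both terms equal normal forms, which by soundness still have the same image under `kappa` and
therefore have the same word. -/
theorem termEq_of_kappa_eq {t u : SKTerm} (h : t.kappa = u.kappa) : TermEq SKAxiom t u := by
  obtain ⟨l, t', ht, htt⟩ := exists_isNormalWith t
  obtain ⟨l', u', hu, huu⟩ := exists_isNormalWith u
  have : t'.kappa = u'.kappa := by rw [← htt.kappa_eq, h, huu.kappa_eq]
  exact htt.trans _ _ _ ((termEq_of_word_eq (word_eq_of_kappa_eq ⟨l, ht⟩ ⟨l', hu⟩ this)).trans _ _ _
    huu.symm)

theorem TermEq.toSJ {t u : SKTerm} (h : TermEq SKAxiom t u) : TermEq SJAxiom t u := by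
  induction h with
  | ax t u h => exact TermEq.ax _ _ (SJAxiom.ofSK _ _ h)
  | one_mul t => exact TermEq.one_mul t
  | mul_one t => exact TermEq.mul_one t
  | assoc t u v => exact TermEq.assoc t u v
  | refl t => exact TermEq.refl t
  | symm t u _ ih => exact ih.symm
  | trans t u v _ _ ih₁ ih₂ => exact ih₁.trans _ _ _ ih₂
  | mul t t' u u' _ _ ih₁ ih₂ => exact TermEq.mul _ _ _ _ ih₁ ih₂

/-- The circles in front of a normal form evaluate to `1` in `SJω`, so they can be dropped. -/
theorem exists_isJNormal (t : SKTerm) : ∃ u : SKTerm, u.IsJNormal ∧ TermEq SJAxiom t u := by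
  obtain ⟨l, A, P, B, hA, hP, hB, h⟩ := exists_normalWord t
  obtain ⟨v, hv⟩ := SKTerm.exists_word (normalWord_ne_nil 1 l A P B)
  obtain ⟨u, hu⟩ := SKTerm.exists_word (normalWord_ne_nil 1 0 A P B)
  refine ⟨u, SKTerm.isNormalWith_iff.2 ⟨A, P, B, hA, hP, hB, hu⟩, (h v hv).toSJ.trans _ _ _ ?_⟩
  have hc : TermMonoid.mk SJAxiom (SKTerm.cup 1) * TermMonoid.mk SJAxiom (SKTerm.cap 1) =
      (1 : SJOmega) := TermMonoid.eq_iff.2 (TermEq.ax _ _ (SJAxiom.circle 1))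
  rw [← TermMonoid.eq_iff, TermMonoid.mk_eq_prod _ u, TermMonoid.mk_eq_prod _ v, hu, hv,
    prod_normalWord _ rfl, prod_normalWord _ rfl, hc, one_pow, one_pow]

theorem termEq_of_iota_eq {t u : SKTerm} (h : t.iota = u.iota) : TermEq SJAxiom t u := by
  obtain ⟨t', ht, htt⟩ := exists_isJNormal t
  obtain ⟨u', hu, huu⟩ := exists_isJNormal u
  have : t'.iota = u'.iota := by rw [← htt.iota_eq, h, huu.iota_eq]
  exact htt.trans _ _ _ ((termEq_of_word_eq (normalWord_eq_of_iota_eq ht hu this)).trans _ _ _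
    huu.symm)

/-! ### Surjectivity and the isomorphisms -/

theorem exists_iota_eq (D : SJDiagram) : ∃ t : SKTerm, t.iota = D := by
  have h := SJDiagram.mem_generated D
  induction h using Submonoid.closure_induction with
  | mem x hx =>
    rcases hx with (⟨j, rfl⟩ | ⟨j, rfl⟩) | ⟨j, rfl⟩
    · exact ⟨SKTerm.cup j.succPNat, rfl⟩
    · exact ⟨SKTerm.cap j.succPNat, rfl⟩
    · exact ⟨SKTerm.cross j.succPNat, rfl⟩
  | one => exact ⟨SKTerm.one, rfl⟩
  | mul x y _ _ hx hy =>
    obtain ⟨t, rfl⟩ := hx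
    obtain ⟨u, rfl⟩ := hy
    exact ⟨t * u, rfl⟩

/-- The exponent of the circle in a normal form does not affect its `SJ` diagram, so it can be reset
to the required number of circles. -/
theorem exists_kappa_eq (E : SKDiagram) : ∃ t : SKTerm, t.kappa = E := by
  obtain ⟨t, ht⟩ := exists_iota_eq E.diagram
  obtain ⟨l, A, P, B, -, -, -, h⟩ := exists_normalWord t
  obtain ⟨v, hv⟩ := SKTerm.exists_word (normalWord_ne_nil 1 l A P B)
  obtain ⟨u, hu⟩ := SKTerm.exists_word (normalWord_ne_nil 1 E.circles A P B)
  refine ⟨u, SKDiagram.ext ?_ (circles_of_normalWord hu)⟩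
  rw [SKTerm.diagram_kappa, iota_of_normalWord hu, ← iota_of_normalWord hv, ← (h v hv).toSJ.iota_eq,
    ht]

theorem iota_mem_closure (t : SKTerm) : t.iota ∈ Subsemigroup.closure
    {D' : SJDiagram | D' = 1 ∨ ∃ k : ℕ+,
      D' = SJDiagram.cup k ∨ D' = SJDiagram.cap k ∨ D' = SJDiagram.crossing k} := by
  induction t with
  | sym s =>
    refine Subsemigroup.subset_closure ?_
    cases s with
    | one => exact Or.inl rfl
    | cup k => exact Or.inr ⟨k, Or.inl rfl⟩
    | cap k => exact Or.inr ⟨k, Or.inr (Or.inl rfl)⟩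
    | cross k => exact Or.inr ⟨k, Or.inr (Or.inr rfl)⟩
  | mul t u iht ihu => exact mul_mem iht ihu

theorem kappa_mem_closure (t : SKTerm) : t.kappa ∈ Subsemigroup.closure
    {E' : SKDiagram | E' = 1 ∨ ∃ k : ℕ+,
      E' = ⟨SJDiagram.cup k, 0⟩ ∨ E' = ⟨SJDiagram.cap k, 0⟩ ∨
      E' = ⟨SJDiagram.crossing k, 0⟩} := by
  induction t with
  | sym s =>
    refine Subsemigroup.subset_closure ?_
    cases s with
    | one => exact Or.inl rfl
    | cup k => exact Or.inr ⟨k, Or.inl rfl⟩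
    | cap k => exact Or.inr ⟨k, Or.inr (Or.inl rfl)⟩
    | cross k => exact Or.inr ⟨k, Or.inr (Or.inr rfl)⟩
  | mul t u iht ihu => exact mul_mem iht ihu

/-- The isomorphism induced by `κ`. -/
noncomputable def skOmegaEquiv : SKOmega ≃* SKDiagram :=
  MulEquiv.mk' (Equiv.ofBijective (Quotient.lift SKTerm.kappa fun _ _ h => TermEq.kappa_eq h)
    ⟨by
      rintro ⟨t⟩ ⟨u⟩ h
      exact Quotient.sound (termEq_of_kappa_eq h),
    fun E => by
      obtain ⟨t, ht⟩ := exists_kappa_eq E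
      exact ⟨Quotient.mk _ t, ht⟩⟩) (by
    rintro ⟨t⟩ ⟨u⟩
    rfl)

/-- The isomorphism induced by `ι`. -/
noncomputable def sjOmegaEquiv : SJOmega ≃* SJDiagram :=
  MulEquiv.mk' (Equiv.ofBijective (Quotient.lift SKTerm.iota fun _ _ h => TermEq.iota_eq h)
    ⟨by
      rintro ⟨t⟩ ⟨u⟩ h
      exact Quotient.sound (termEq_of_iota_eq h),
    fun D => by
      obtain ⟨t, ht⟩ := exists_iota_eq D
      exact ⟨Quotient.mk _ t, ht⟩⟩) (by
    rintro ⟨t⟩ ⟨u⟩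
    rfl)

theorem mainTheorem1 :
    -- the `SJ` diagrams and the `SK` diagrams form monoids
    ((∀ D₁ D₂ D₃ : SJDiagram, D₁ * D₂ * D₃ = D₁ * (D₂ * D₃)) ∧
      (∀ D : SJDiagram, 1 * D = D ∧ D * 1 = D)) ∧
    ((∀ E₁ E₂ E₃ : SKDiagram, E₁ * E₂ * E₃ = E₁ * (E₂ * E₃)) ∧
      (∀ E : SKDiagram, 1 * E = E ∧ E * 1 = E)) ∧
    -- soundness
    (∀ t u : SKTerm, TermEq SKAxiom t u → t.kappa = u.kappa) ∧
    (∀ t u : SKTerm, TermEq SJAxiom t u → t.iota = u.iota) ∧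
    -- generation by the cup, cap, crossing and unit diagrams under composition
    (∀ D : SJDiagram, D ∈ Subsemigroup.closure
      {D' : SJDiagram | D' = 1 ∨ ∃ k : ℕ+,
        D' = SJDiagram.cup k ∨ D' = SJDiagram.cap k ∨ D' = SJDiagram.crossing k}) ∧
    (∀ E : SKDiagram, E ∈ Subsemigroup.closure
      {E' : SKDiagram | E' = 1 ∨ ∃ k : ℕ+,
        E' = ⟨SJDiagram.cup k, 0⟩ ∨ E' = ⟨SJDiagram.cap k, 0⟩ ∨
        E' = ⟨SJDiagram.crossing k, 0⟩}) ∧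
    -- terms in normal form with the same diagram are the same (up to parentheses)
    (∀ (k : ℕ+) (t u : SKTerm), t.IsNormal k → u.IsNormal k → t.kappa = u.kappa →
      t.word = u.word) ∧
    (∀ t u : SKTerm, t.IsJNormal → u.IsJNormal → t.iota = u.iota → t.word = u.word) ∧
    -- completeness
    (∀ t u : SKTerm, t.kappa = u.kappa → TermEq SKAxiom t u) ∧
    (∀ t u : SKTerm, t.iota = u.iota → TermEq SJAxiom t u) ∧
    -- the induced monoid isomorphisms
    (∃ e : SKOmega ≃* SKDiagram, e 1 = 1 ∧ ∀ t : SKTerm, e (TermMonoid.mk SKAxiom t) = t.kappa) ∧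
    (∃ e : SJOmega ≃* SJDiagram, e 1 = 1 ∧ ∀ t : SKTerm, e (TermMonoid.mk SJAxiom t) = t.iota) := by
  exact ⟨⟨SJDiagram.diagram_mul_assoc, fun D =>
      ⟨SJDiagram.diagram_one_mul D, SJDiagram.diagram_mul_one D⟩⟩,
    ⟨SKDiagram.monoid.mul_assoc, fun E => ⟨SKDiagram.monoid.one_mul E, SKDiagram.monoid.mul_one E⟩⟩,
    fun _ _ => TermEq.kappa_eq, fun _ _ => TermEq.iota_eq,
    fun D => (exists_iota_eq D).elim fun t ht => ht ▸ iota_mem_closure t,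
    fun E => (exists_kappa_eq E).elim fun t ht => ht ▸ kappa_mem_closure t,
    fun _ _ _ => word_eq_of_kappa_eq, fun _ _ => normalWord_eq_of_iota_eq,
    fun _ _ => termEq_of_kappa_eq, fun _ _ => termEq_of_iota_eq,
    ⟨skOmegaEquiv, rfl, fun _ => rfl⟩, ⟨sjOmegaEquiv, rfl, fun _ => rfl⟩⟩
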